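/- Let $T>0$, $Q(T)=(0,T)\times(0,1)$, $H=L^2(0,1)$ and $X=H^1(0,1)$. Let $h,b\in C^2(\mathbb{R})$ and suppose that there are positive constants $C_{h,1},C_{h,2},C_{b,1},C_{b,2}$ such that on $\mathbb{R}$ (A1) $C_{h,1}\le h'\le C_{h,2}$ and $|h''|\le C_{h,2}$; (A2) $C_{b,1}\le b\le C_{b,2}$ and $|b'|,|b''|\le C_{b,2}$. If $p\in W^{1,2}(0,T;H)\cap L^\infty(Q(T))\cap L^2(0,T;X)$ and $v_0\in X$, then the problem $$\partial_t h(v)=\partial_x\big(\partial_x v+b(v)p\big)\ \text{ in } Q(T),\qquad \partial_x v+b(v)p=0\ \text{ at } x=0,1 \text{ for } t\in(0,T),\qquad v(0,\cdot)=v_0 \ \text{ in } (0,1)$$ has a unique strong solution $v\in W^{1,2}(0,T;H)\cap L^\infty(0,T;X)\cap L^2(0,T;H^2(0,1))$. Here a strong solution is a function $v$ in this class for which the equation holds almost everywhere in $Q(T)$ (with weak derivatives), the flux $\partial_x v+b(v)p$ has zero boundary values at $x=0$ and $x=1$ for almost every $t\in(0,T)$, and the representative of $v$ in $C([0,T];H)$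 equals $v_0$ at $t=0$; uniqueness is up to equality almost everywhere in $Q(T)$. -/

import Mathlib

open MeasureTheory Set
open scoped ENNReal ContDiff

/-- The space `H = L²(0,1)`. -/
abbrev L2Unit : Type := Lp ℝ 2 (volume.restrict (Ioo (0 : ℝ) 1))

/-- `g` is the weak (distributional) derivative of `f` on the open interval `(a, b)`, for
functions with values in a Banach space: `∫ φ' f = - ∫ φ g` for all `φ ∈ C_c^∞(a, b)`. -/
def IsWeakDeriv {E : Type*} [NormedAddCommGroup E] [NormedSpace ℝ E] [CompleteSpace E]
    (a b : ℝ) (f g : ℝ → E) : Prop :=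
  LocallyIntegrableOn f (Ioo a b) ∧ LocallyIntegrableOn g (Ioo a b) ∧
    ∀ φ : ℝ → ℝ, ContDiff ℝ ∞ φ → HasCompactSupport φ → tsupport φ ⊆ Ioo a b →
      ∫ s in Ioo a b, deriv φ s • f s = - ∫ s in Ioo a b, φ s • g s

/-- `w = ∂ₓ u` weakly on `(0,1)`, for `u, w ∈ L²(0,1)`. -/
def IsDx (u w : L2Unit) : Prop :=
  IsWeakDeriv 0 1 (fun x => u x) (fun x => w x)

/-- `u ∈ H¹(0,1)`. -/
def MemH1 (u : L2Unit) : Prop := ∃ w : L2Unit, IsDx u w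

/-- The boundary values (traces) of `u` at `x = 0` and `x = 1` are `α` and `β`: `u` has a
representative that is continuous on `[0,1]` and takes these values at the end points. -/
def HasBoundaryValues (u : L2Unit) (α β : ℝ) : Prop :=
  ∃ g : ℝ → ℝ, ContinuousOn g (Icc 0 1) ∧
    (∀ᵐ x ∂(volume.restrict (Ioo (0 : ℝ) 1)), u x = g x) ∧ g 0 = α ∧ g 1 = β

/-- The Bochner space `L^q(0,T;H)`. -/
def MemLqL2 (T : ℝ) (q : ℝ≥0∞) (v : ℝ → L2Unit) : Prop :=
  MemLp v q (volume.restrict (Ioo 0 T))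

/-- `W^{1,2}(0,T;H)`. -/
def MemW12L2 (T : ℝ) (v : ℝ → L2Unit) : Prop :=
  MemLqL2 T 2 v ∧ ∃ w : ℝ → L2Unit, MemLqL2 T 2 w ∧ IsWeakDeriv 0 T v w

/-- `L^q(0,T;H¹(0,1))`: both `v` and `∂ₓ v` belong to `L^q(0,T;H)`. -/
def MemLqH1 (T : ℝ) (q : ℝ≥0∞) (v : ℝ → L2Unit) : Prop :=
  MemLqL2 T q v ∧ ∃ w : ℝ → L2Unit, MemLqL2 T q w ∧
    ∀ᵐ t ∂(volume.restrict (Ioo 0 T)), IsDx (v t) (w t)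

/-- `L^q(0,T;H²(0,1))`: `v`, `∂ₓ v` and `∂ₓ² v` belong to `L^q(0,T;H)`. -/
def MemLqH2 (T : ℝ) (q : ℝ≥0∞) (v : ℝ → L2Unit) : Prop :=
  MemLqL2 T q v ∧ ∃ w z : ℝ → L2Unit, MemLqL2 T q w ∧ MemLqL2 T q z ∧
    ∀ᵐ t ∂(volume.restrict (Ioo 0 T)), IsDx (v t) (w t) ∧ IsDx (w t) (z t)

/-- `p ∈ L^∞(Q(T))`, `Q(T) = (0,T) × (0,1)`. -/
def MemLinfQ (T : ℝ) (p : ℝ → L2Unit) : Prop :=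
  AEStronglyMeasurable p (volume.restrict (Ioo 0 T)) ∧
    ∃ M : ℝ, ∀ᵐ t ∂(volume.restrict (Ioo 0 T)),
      ∀ᵐ x ∂(volume.restrict (Ioo (0 : ℝ) 1)), |p t x| ≤ M

/-- Assumption (A1) on `h`. -/
def AssumptionA1 (h : ℝ → ℝ) : Prop :=
  ContDiff ℝ 2 h ∧ ∃ c₁ c₂ : ℝ, 0 < c₁ ∧ 0 < c₂ ∧
    ∀ r, c₁ ≤ deriv h r ∧ deriv h r ≤ c₂ ∧ |deriv (deriv h) r| ≤ c₂

/-- Assumption (A2) on `b`. -/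
def AssumptionA2 (b : ℝ → ℝ) : Prop :=
  ContDiff ℝ 2 b ∧ ∃ c₁ c₂ : ℝ, 0 < c₁ ∧ 0 < c₂ ∧
    ∀ r, c₁ ≤ b r ∧ b r ≤ c₂ ∧ |deriv b r| ≤ c₂ ∧ |deriv (deriv b) r| ≤ c₂

/-- `v` is a strong solution on `(0,T)` of
`∂ₜ h(v) = ∂ₓ (∂ₓ v + b(v) p)` a.e. in `Q(T)`, `∂ₓ v + b(v) p = 0` at `x = 0, 1`, `v(0) = v₀`,
in the class `W^{1,2}(0,T;H) ∩ L^∞(0,T;H¹) ∩ L²(0,T;H²)`. -/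
structure IsStrongSolution (T : ℝ) (h b : ℝ → ℝ) (p : ℝ → L2Unit) (v₀ : L2Unit)
    (v : ℝ → L2Unit) : Prop where
  memW12 : MemW12L2 T v
  memLinfH1 : MemLqH1 T ∞ v
  memL2H2 : MemLqH2 T 2 v
  /-- `vx = ∂ₓ v`, `F = ∂ₓ v + b(v) p` is the flux, `Fx = ∂ₓ F`, `hv = h(v)` and
  `hvt = ∂ₜ h(v)`; the last two clauses are the equation and the no-flux condition. -/
  equation : ∃ vx F Fx hv hvt : ℝ → L2Unit,
    (∀ᵐ t ∂(volume.restrict (Ioo 0 T)), IsDx (v t) (vx t)) ∧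
    (∀ᵐ t ∂(volume.restrict (Ioo 0 T)), ∀ᵐ x ∂(volume.restrict (Ioo (0 : ℝ) 1)),
      F t x = vx t x + b (v t x) * p t x) ∧
    (∀ᵐ t ∂(volume.restrict (Ioo 0 T)), IsDx (F t) (Fx t)) ∧
    (∀ᵐ t ∂(volume.restrict (Ioo 0 T)), ∀ᵐ x ∂(volume.restrict (Ioo (0 : ℝ) 1)),
      hv t x = h (v t x)) ∧
    IsWeakDeriv 0 T hv hvt ∧
    (∀ᵐ t ∂(volume.restrict (Ioo 0 T)), ∀ᵐ x ∂(volume.restrict (Ioo (0 : ℝ) 1)),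
      hvt t x = Fx t x) ∧
    (∀ᵐ t ∂(volume.restrict (Ioo 0 T)), HasBoundaryValues (F t) 0 0)
  /-- The representative of `v` in `C([0,T];H)` takes the value `v₀` at `t = 0`. -/
  initial : ∃ vc : ℝ → L2Unit, ContinuousOn vc (Icc 0 T) ∧
    (∀ᵐ t ∂(volume.restrict (Ioo 0 T)), v t = vc t) ∧ vc 0 = v₀

/-!
Write `J : H¹ → L²` for the inclusion, `D` for the derivative, `N` for composition with `h` and `B`
for composition with `b` times `p(t)`. The problem is the evolution equation
`d/dt N(J u) + D†(D u + B(t, J u)) = 0`, whose weak form contains the no-flux condition.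

Existence: in each step of the semi-implicit Euler scheme, with the drift taken at the previous
step, a coercive strongly monotone equation is solved. Testing with the increments bounds `∂ₜ v` in
`L²` and `v` in `L^∞(H¹)`. As `J` is compact, the interpolants converge strongly in `L²` along an
ultrafilter, so that the nonlinear terms pass to the limit. The flux then has the derivative
`∂ₜ h(v)`, and the chain rule for `b(v) p` gives the `H²` regularity.

Uniqueness: testing the difference of two equations with the primitive `V (h(v) - h(w))` turns
strong monotonicity of `h` into a bound for `d/dt ‖V (h(v) - h(w))‖²`, and Grönwall applies.
-/

open Filter Topology

section AbsolutelyContinuous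

variable {E : Type*} [NormedAddCommGroup E]

theorem intervalIntegrable_of_integrableOn_Ioo {f : ℝ → E} {a b : ℝ} (hab : a ≤ b)
    (hf : IntegrableOn f (Ioo a b)) : IntervalIntegrable f volume a b :=
  (intervalIntegrable_iff_integrableOn_Ioo_of_le hab).2 hf

theorem absolutelyContinuousOnInterval_of_dist_le {X Y : Type*} [PseudoMetricSpace X]
    [PseudoMetricSpace Y] {f : ℝ → X} {g : ℝ → Y} {a b K : ℝ}
    (hg : AbsolutelyContinuousOnInterval g a b)
    (hfg : ∀ x ∈ uIcc a b, ∀ y ∈ uIcc a b, dist (f x) (f y) ≤ K * dist (g x) (g y)) :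
    AbsolutelyContinuousOnInterval f a b := by
  rw [absolutelyContinuousOnInterval_iff] at hg ⊢
  intro ε hε
  obtain ⟨δ, hδ, hgδ⟩ := hg (ε / (|K| + 1)) (by positivity)
  refine ⟨δ, hδ, fun I hI hlt => ?_⟩
  calc ∑ i ∈ Finset.range I.1, dist (f (I.2 i).1) (f (I.2 i).2)
      ≤ (|K| + 1) * ∑ i ∈ Finset.range I.1, dist (g (I.2 i).1) (g (I.2 i).2) := by
        rw [Finset.mul_sum]
        refine Finset.sum_le_sum fun i hi => ?_
        obtain ⟨hleft, hright⟩ := hI.1 i hi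
        refine (hfg _ hleft _ hright).trans ?_
        exact mul_le_mul_of_nonneg_right (by linarith [le_abs_self K]) dist_nonneg
    _ < (|K| + 1) * (ε / (|K| + 1)) := by gcongr; exact hgδ I hI hlt
    _ = ε := by field_simp

variable [NormedSpace ℝ E]

theorem absolutelyContinuousOnInterval_integral {f : ℝ → E} {a b : ℝ}
    (hf : IntervalIntegrable f volume a b) :
    AbsolutelyContinuousOnInterval (fun x => ∫ s in a..x, f s) a b := by
  refine absolutelyContinuousOnInterval_of_dist_le (K := 1)
    (hf.norm.absolutelyContinuousOnInterval_intervalIntegral (c := a) left_mem_uIcc) ?_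
  intro x hx y hy
  have hint : ∀ z ∈ uIcc a b, IntervalIntegrable f volume a z := fun z hz =>
    hf.mono_set (uIcc_subset_uIcc left_mem_uIcc hz)
  rw [dist_eq_norm, dist_eq_norm,
    intervalIntegral.integral_interval_sub_left (hint x hx) (hint y hy),
    intervalIntegral.integral_interval_sub_left (hint x hx).norm (hint y hy).norm, one_mul,
    Real.norm_eq_abs]
  exact intervalIntegral.norm_integral_le_abs_integral_norm

theorem integral_eq_sub_of_absolutelyContinuous [CompleteSpace E] {G g : ℝ → E} {a b : ℝ}
    (hG : AbsolutelyContinuousOnInterval G a b)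
    (hderiv : ∀ᵐ x, x ∈ uIcc a b → HasDerivAt G (g x) x) (hg : IntervalIntegrable g volume a b) :
    ∫ x in a..b, g x = G b - G a := by
  have hsub := hG.sub (absolutelyContinuousOnInterval_integral hg)
  obtain ⟨C, hC⟩ := hsub.const_of_ae_hasDerivAt_zero (by
    filter_upwards [hderiv, hg.ae_hasDerivAt_integral] with x hGx hgx hx
    simpa only [sub_self] using (hGx hx).sub (hgx hx a left_mem_uIcc))
  have ha := hC a left_mem_uIcc
  have hb := hC b right_mem_uIcc
  simp only [Pi.sub_apply, intervalIntegral.integral_same, sub_zero] at ha hb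
  rw [ha, ← hb]
  abel

end AbsolutelyContinuous

section TestFunction

variable {E : Type*} [NormedAddCommGroup E] [NormedSpace ℝ E] {a b : ℝ} {φ ψ : ℝ → ℝ}

/-- Test functions on the open interval `(a, b)`: the class `C_c^∞(a, b)` of `IsWeakDeriv`. -/
structure IsTestFunction (a b : ℝ) (φ : ℝ → ℝ) : Prop where
  contDiff : ContDiff ℝ ∞ φ
  hasCompactSupport : HasCompactSupport φ
  tsupport_subset : tsupport φ ⊆ Ioo a b

namespace IsTestFunction

theorem eq_zero_of_notMem (hφ : IsTestFunction a b φ) {x : ℝ} (hx : x ∉ Ioo a b) : φ x = 0 :=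
  image_eq_zero_of_notMem_tsupport fun h => hx (hφ.tsupport_subset h)

theorem integrable (hφ : IsTestFunction a b φ) : Integrable φ :=
  hφ.contDiff.continuous.integrable_of_hasCompactSupport hφ.hasCompactSupport

theorem deriv (hφ : IsTestFunction a b φ) : IsTestFunction a b (deriv φ) where
  contDiff := (contDiff_infty_iff_deriv.1 hφ.contDiff).2
  hasCompactSupport := hφ.hasCompactSupport.deriv
  tsupport_subset := tsupport_deriv_subset.trans hφ.tsupport_subset

theorem sub_const_mul (hφ : IsTestFunction a b φ) (hψ : IsTestFunction a b ψ) (c : ℝ) :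
    IsTestFunction a b (fun x => φ x - c * ψ x) where
  contDiff := hφ.contDiff.sub (contDiff_const.mul hψ.contDiff)
  hasCompactSupport := hφ.hasCompactSupport.sub hψ.hasCompactSupport.mul_left
  tsupport_subset := (tsupport_sub _ _).trans <| union_subset hφ.tsupport_subset <|
    (closure_mono (Function.support_mul_subset_right _ _)).trans hψ.tsupport_subset

theorem integrableOn_smul (hφ : IsTestFunction a b φ) {f : ℝ → E}
    (hf : LocallyIntegrableOn f (Ioo a b)) : IntegrableOn (fun s => φ s • f s) (Ioo a b) := by
  have hK : IsCompact (tsupport φ) := hφ.hasCompactSupport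
  have hint : IntegrableOn (fun s => φ s • f s) (tsupport φ) :=
    (hf.integrableOn_compact_subset hφ.tsupport_subset hK).continuousOn_smul
      hφ.contDiff.continuous.continuousOn hK
  refine (hint.integrable_of_forall_notMem_eq_zero fun x hx => ?_).integrableOn
  rw [image_eq_zero_of_notMem_tsupport hx, zero_smul]

theorem setIntegral_smul (hφ : IsTestFunction a b φ) (f : ℝ → E) :
    ∫ s in Ioo a b, φ s • f s = ∫ s, φ s • f s :=
  setIntegral_eq_integral_of_forall_compl_eq_zero fun x hx => by
    rw [hφ.eq_zero_of_notMem hx, zero_smul]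

theorem exists_support_subset_Icc (hφ : IsTestFunction a b φ) (hab : a < b) :
    ∃ α β, a < α ∧ β < b ∧ ∀ x ∉ Icc α β, φ x = 0 := by
  rcases (tsupport φ).eq_empty_or_nonempty with hempty | hne
  · exact ⟨b, a, hab, hab, fun x _ => image_eq_zero_of_notMem_tsupport (by simp [hempty])⟩
  have hK : IsCompact (tsupport φ) := hφ.hasCompactSupport
  refine ⟨sInf (tsupport φ), sSup (tsupport φ), (hφ.tsupport_subset (hK.sInf_mem hne)).1,
    (hφ.tsupport_subset (hK.sSup_mem hne)).2, fun x hx => ?_⟩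
  exact image_eq_zero_of_notMem_tsupport fun h =>
    hx ⟨csInf_le hK.bddBelow h, le_csSup hK.bddAbove h⟩

theorem exists_deriv_eq (hφ : IsTestFunction a b φ) (hab : a < b) (hint : ∫ x, φ x = 0) :
    ∃ Φ, IsTestFunction a b Φ ∧ _root_.deriv Φ = φ := by
  obtain ⟨α, β, hα, hβ, hzero⟩ := hφ.exists_support_subset_Icc hab
  have hderiv : ∀ x, HasDerivAt (fun x => ∫ s in a..x, φ s) (φ x) x := fun x =>
    (hφ.contDiff.continuous.integral_hasStrictDerivAt a x).hasDerivAt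
  have hderiv_eq : _root_.deriv (fun x => ∫ s in a..x, φ s) = φ :=
    funext fun x => (hderiv x).deriv
  have hsupp : tsupport (fun x => ∫ s in a..x, φ s) ⊆ Icc α β := by
    refine closure_minimal (fun x hx => by_contra fun hxI => hx ?_) isClosed_Icc
    rcases lt_or_ge x α with hxα | hαx
    · refine (intervalIntegral.integral_congr (g := 0) fun s hs => hzero s fun hsI => ?_).trans
        intervalIntegral.integral_zero
      exact absurd hsI.1 (not_le.2 (hs.2.trans_lt (max_lt hα hxα)))
    · have hβx : β < x := not_le.1 fun h => hxI ⟨hαx, h⟩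
      refine (intervalIntegral.integral_eq_integral_of_support_subset fun s hs => ?_).trans hint
      have hsI : s ∈ Icc α β := by_contra fun h => hs (hzero s h)
      exact ⟨hα.trans_le hsI.1, hsI.2.trans hβx.le⟩
  exact ⟨_, ⟨contDiff_infty_iff_deriv.2 ⟨fun x => (hderiv x).differentiableAt,
      hderiv_eq.symm ▸ hφ.contDiff⟩, isCompact_Icc.of_isClosed_subset (isClosed_tsupport _) hsupp,
      hsupp.trans (Icc_subset_Ioo hα hβ)⟩, hderiv_eq⟩

end IsTestFunction

theorem exists_isTestFunction_integral_eq_one (hab : a < b) :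
    ∃ η, IsTestFunction a b η ∧ ∫ x, η x = 1 := by
  let bump : ContDiffBump ((a + b) / 2) :=
    ⟨(b - a) / 8, (b - a) / 4, by linarith, by linarith⟩
  refine ⟨bump.normed volume, ⟨bump.contDiff_normed, bump.hasCompactSupport_normed, ?_⟩,
    bump.integral_normed⟩
  rw [bump.tsupport_normed_eq, Real.closedBall_eq_Icc]
  exact Icc_subset_Ioo (by simp only [bump]; linarith) (by simp only [bump]; linarith)

end TestFunction

section WeakDerivative

theorem locallyIntegrableOn_congr_ae_Ioo {E : Type*} [NormedAddCommGroup E] {a b : ℝ}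
    {f g : ℝ → E} (hf : LocallyIntegrableOn f (Ioo a b)) (hfg : f =ᵐ[volume.restrict (Ioo a b)] g) :
    LocallyIntegrableOn g (Ioo a b) := by
  rw [locallyIntegrableOn_iff isOpen_Ioo.isLocallyClosed] at hf ⊢
  exact fun k hk hkc => (hf k hk hkc).congr (ae_restrict_of_ae_restrict_of_subset hk hfg)

variable {E F : Type*} [NormedAddCommGroup E] [NormedSpace ℝ E] [CompleteSpace E]
  [NormedAddCommGroup F] [NormedSpace ℝ F] [CompleteSpace F] {a b : ℝ}

namespace IsWeakDeriv

variable {f g f' g' : ℝ → E}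

theorem setIntegral_deriv_smul (h : IsWeakDeriv a b f g) {φ : ℝ → ℝ} (hφ : IsTestFunction a b φ) :
    ∫ s in Ioo a b, deriv φ s • f s = -∫ s in Ioo a b, φ s • g s :=
  h.2.2 φ hφ.contDiff hφ.hasCompactSupport hφ.tsupport_subset

theorem congr (h : IsWeakDeriv a b f g) (hf : f =ᵐ[volume.restrict (Ioo a b)] f')
    (hg : g =ᵐ[volume.restrict (Ioo a b)] g') : IsWeakDeriv a b f' g' := by
  refine ⟨locallyIntegrableOn_congr_ae_Ioo h.1 hf, locallyIntegrableOn_congr_ae_Ioo h.2.1 hg,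
    fun φ hφ hc hs => ?_⟩
  rw [← integral_congr_ae (hf.mono fun t ht => congrArg (deriv φ t • ·) ht),
    ← integral_congr_ae (hg.mono fun t ht => congrArg (φ t • ·) ht)]
  exact h.2.2 φ hφ hc hs

theorem sub (h : IsWeakDeriv a b f g) (h' : IsWeakDeriv a b f' g') :
    IsWeakDeriv a b (fun t => f t - f' t) (fun t => g t - g' t) := by
  refine ⟨h.1.sub h'.1, h.2.1.sub h'.2.1, fun φ hsmooth hc hs => ?_⟩
  have hφ : IsTestFunction a b φ := ⟨hsmooth, hc, hs⟩
  simp only [smul_sub]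
  rw [integral_sub (hφ.deriv.integrableOn_smul h.1) (hφ.deriv.integrableOn_smul h'.1),
    integral_sub (hφ.integrableOn_smul h.2.1) (hφ.integrableOn_smul h'.2.1),
    h.setIntegral_deriv_smul hφ, h'.setIntegral_deriv_smul hφ]
  abel

theorem map (h : IsWeakDeriv a b f g) (A : E →L[ℝ] F) :
    IsWeakDeriv a b (fun t => A (f t)) (fun t => A (g t)) := by
  have map_locallyIntegrableOn : ∀ {k : ℝ → E}, LocallyIntegrableOn k (Ioo a b) →
      LocallyIntegrableOn (fun t => A (k t)) (Ioo a b) := by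
    intro k hk
    rw [locallyIntegrableOn_iff isOpen_Ioo.isLocallyClosed] at hk ⊢
    exact fun K hK hKc => A.integrable_comp (hk K hK hKc)
  refine ⟨map_locallyIntegrableOn h.1, map_locallyIntegrableOn h.2.1, fun φ hsmooth hc hs => ?_⟩
  have hφ : IsTestFunction a b φ := ⟨hsmooth, hc, hs⟩
  simp only [← map_smul]
  rw [A.integral_comp_comm (hφ.deriv.integrableOn_smul h.1),
    A.integral_comp_comm (hφ.integrableOn_smul h.2.1), h.setIntegral_deriv_smul hφ, map_neg]

end IsWeakDeriv

theorem isWeakDeriv_integral (hab : a ≤ b) {w : ℝ → E} (hw : IntegrableOn w (Ioo a b)) (c : E) :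
    IsWeakDeriv a b (fun t => c + ∫ s in a..t, w s) w := by
  have hwi := intervalIntegrable_of_integrableOn_Ioo hab hw
  have hconst : AbsolutelyContinuousOnInterval (fun _ : ℝ => c) a b :=
    (contDiff_const (n := 1)).contDiffOn.absolutelyContinuousOnInterval
  have hac : AbsolutelyContinuousOnInterval (fun t => c + ∫ s in a..t, w s) a b :=
    hconst.add (absolutelyContinuousOnInterval_integral hwi)
  refine ⟨((uIcc_of_le hab ▸ hac.continuousOn).mono Ioo_subset_Icc_self).locallyIntegrableOn
    measurableSet_Ioo, hw.locallyIntegrableOn, fun φ hsmooth hc hs => ?_⟩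
  have hφ : IsTestFunction a b φ := ⟨hsmooth, hc, hs⟩
  have hφac : AbsolutelyContinuousOnInterval φ a b :=
    (hsmooth.of_le (by simp)).contDiffOn.absolutelyContinuousOnInterval
  have hintφw : IntervalIntegrable (fun t => φ t • w t) volume a b :=
    hwi.continuousOn_smul hsmooth.continuous.continuousOn
  have hintφ' : IntervalIntegrable (fun t => deriv φ t • (c + ∫ s in a..t, w s)) volume a b :=
    (hφ.deriv.contDiff.continuous.continuousOn.smul hac.continuousOn).intervalIntegrable
  have hparts := integral_eq_sub_of_absolutelyContinuous (hφac.fun_smul hac)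
    (g := fun t => φ t • w t + deriv φ t • (c + ∫ s in a..t, w s)) (by
      filter_upwards [hwi.ae_hasDerivAt_integral] with x hwx hx
      exact (hsmooth.differentiable (by simp) x).hasDerivAt.smul
        ((hwx hx a left_mem_uIcc).const_add c)) (hintφw.add hintφ')
  rw [hφ.eq_zero_of_notMem left_notMem_Ioo, hφ.eq_zero_of_notMem right_notMem_Ioo, zero_smul,
    zero_smul, sub_zero, intervalIntegral.integral_add hintφw hintφ'] at hparts
  simp only [intervalIntegral.integral_of_le hab, integral_Ioc_eq_integral_Ioo] at hparts
  exact eq_neg_of_add_eq_zero_right hparts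

namespace IsWeakDeriv

variable {f g f' g' : ℝ → E}

theorem ae_eq_const (h : IsWeakDeriv a b f 0) (hab : a < b) :
    ∃ c, f =ᵐ[volume.restrict (Ioo a b)] fun _ => c := by
  obtain ⟨η, hη, hη_one⟩ := exists_isTestFunction_integral_eq_one hab
  set c := ∫ s in Ioo a b, η s • f s
  refine ⟨c, (ae_restrict_iff' measurableSet_Ioo).2 ?_⟩
  have hloc : LocallyIntegrableOn (fun t => f t - c) (Ioo a b) :=
    h.1.sub ((locallyIntegrable_const c).locallyIntegrableOn _)
  refine (isOpen_Ioo.ae_eq_zero_of_integral_contDiff_smul_eq_zero hloc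
    fun ψ hsmooth hcs hsub => ?_).mono fun x hx hxI => sub_eq_zero.1 (hx hxI)
  have hψ : IsTestFunction a b ψ := ⟨hsmooth, hcs, hsub⟩
  obtain ⟨Φ, hΦ, hΦ_deriv⟩ := (hψ.sub_const_mul hη (∫ x, ψ x)).exists_deriv_eq hab (by
    rw [integral_sub hψ.integrable (hη.integrable.const_mul _), integral_const_mul, hη_one,
      mul_one, sub_self])
  have hweak : ∫ s in Ioo a b, ψ s • f s = (∫ x, ψ x) • c := by
    have := h.setIntegral_deriv_smul hΦ
    simp only [hΦ_deriv, sub_smul, mul_smul, Pi.zero_apply, smul_zero, integral_zero,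
      neg_zero] at this
    rw [integral_sub (hψ.integrableOn_smul h.1) ((hη.integrableOn_smul h.1).fun_smul _),
      integral_smul, sub_eq_zero] at this
    exact this
  have hψc : ∫ s in Ioo a b, ψ s • c = (∫ x, ψ x) • c := by
    rw [hψ.setIntegral_smul, integral_smul_const]
  rw [← hψ.setIntegral_smul]
  simp only [smul_sub]
  rw [integral_sub (hψ.integrableOn_smul h.1) (hψ.integrable.smul_const c).integrableOn, hweak,
    hψc, sub_self]

theorem exists_eq_integral (h : IsWeakDeriv a b f g) (hab : a < b)
    (hg : IntegrableOn g (Ioo a b)) :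
    ∃ c, f =ᵐ[volume.restrict (Ioo a b)] fun t => c + ∫ s in a..t, g s := by
  have hsub := h.sub (isWeakDeriv_integral hab.le hg 0)
  obtain ⟨c, hc⟩ := (hsub.congr (g' := 0) .rfl (.of_forall fun _ => sub_self _)).ae_eq_const hab
  refine ⟨c, hc.mono fun t ht => ?_⟩
  simp only [zero_add] at ht
  simp only [← ht, sub_add_cancel]

theorem eq_add_integral_of_continuousOn (h : IsWeakDeriv a b f g) (hab : a < b)
    (hg : IntegrableOn g (Ioo a b)) (hf : ContinuousOn f (Icc a b)) {t : ℝ} (ht : t ∈ Icc a b) :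
    f t = f a + ∫ s in a..t, g s := by
  obtain ⟨c, hc⟩ := h.exists_eq_integral hab hg
  have hcont : ContinuousOn (fun t => c + ∫ s in a..t, g s) (Icc a b) := by
    refine continuousOn_const.add ?_
    simpa only [uIcc_of_le hab.le] using (absolutelyContinuousOnInterval_integral
      (intervalIntegrable_of_integrableOn_Ioo hab.le hg)).continuousOn
  rw [Measure.restrict_congr_set Ioo_ae_eq_Icc] at hc
  have heq := Measure.eqOn_Icc_of_ae_eq volume hab.ne hc hf hcont
  have hfa : f a = c := by simpa using heq (left_mem_Icc.2 hab.le)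
  rw [hfa]
  exact heq ht

theorem ae_eq_zero (h : IsWeakDeriv a b 0 g) : g =ᵐ[volume.restrict (Ioo a b)] 0 := by
  refine (ae_restrict_iff' measurableSet_Ioo).2
    (isOpen_Ioo.ae_eq_zero_of_integral_contDiff_smul_eq_zero h.2.1 fun φ hsmooth hc hs => ?_)
  have hφ : IsTestFunction a b φ := ⟨hsmooth, hc, hs⟩
  simpa [← hφ.setIntegral_smul] using (h.setIntegral_deriv_smul hφ).symm

theorem unique (h : IsWeakDeriv a b f g) (h' : IsWeakDeriv a b f g') :
    g =ᵐ[volume.restrict (Ioo a b)] g' :=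
  ((h.sub h').congr (.of_forall fun _ => sub_self _) .rfl).ae_eq_zero.mono fun _ ht =>
    sub_eq_zero.1 ht

end IsWeakDeriv

theorem ae_eq_zero_of_forall_intervalIntegral_eq_zero (hab : a ≤ b) {f : ℝ → E}
    (hf : IntegrableOn f (Ioo a b)) (hzero : ∀ t ∈ Ioo a b, ∫ s in a..t, f s = 0) :
    f =ᵐ[volume.restrict (Ioo a b)] 0 := by
  refine ((isWeakDeriv_integral hab hf 0).congr ?_ .rfl).ae_eq_zero
  filter_upwards [ae_restrict_mem measurableSet_Ioo] with t ht
  simp [hzero t ht]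

end WeakDerivative

section HilbertValuedIntegral

variable {H : Type*} [NormedAddCommGroup H] [InnerProductSpace ℝ H] {a b : ℝ} {f : ℝ → H}

theorem intervalIntegrable_inner_of_continuousOn {g : ℝ → H} (hg : ContinuousOn g (uIcc a b))
    (hf : IntervalIntegrable f volume a b) :
    IntervalIntegrable (fun s => inner ℝ (g s) (f s)) volume a b := by
  obtain ⟨C, hC⟩ := isCompact_uIcc.exists_bound_of_continuousOn hg
  rw [intervalIntegrable_iff] at hf ⊢
  refine Integrable.mono' (hf.norm.const_mul C)
    (((hg.mono uIoc_subset_uIcc).aestronglyMeasurable measurableSet_uIoc).inner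
      hf.aestronglyMeasurable) ?_
  filter_upwards [ae_restrict_mem measurableSet_uIoc] with s hs
  exact (norm_inner_le_norm _ _).trans
    (mul_le_mul_of_nonneg_right (hC s (uIoc_subset_uIcc hs)) (norm_nonneg _))

theorem sq_norm_integral_eq [CompleteSpace H] (hf : IntervalIntegrable f volume a b) :
    ‖∫ s in a..b, f s‖ ^ 2 = ∫ s in a..b, 2 * inner ℝ (∫ r in a..s, f r) (f s) := by
  have hac := absolutelyContinuousOnInterval_integral hf
  have hnorm : AbsolutelyContinuousOnInterval (fun s => ‖∫ r in a..s, f r‖) a b :=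
    absolutelyContinuousOnInterval_of_dist_le (K := 1) hac fun x _ y _ => by
      rw [one_mul, Real.dist_eq, dist_eq_norm]
      exact abs_norm_sub_norm_le _ _
  have hsq := integral_eq_sub_of_absolutelyContinuous (hnorm.fun_mul hnorm)
    (g := fun s => 2 * inner ℝ (∫ r in a..s, f r) (f s)) (by
      filter_upwards [hf.ae_hasDerivAt_integral] with x hfx hx
      simpa only [pow_two] using (hfx hx a left_mem_uIcc).norm_sq)
    ((intervalIntegrable_inner_of_continuousOn hac.continuousOn hf).const_mul 2)
  rw [hsq, intervalIntegral.integral_same, norm_zero, mul_zero, sub_zero, pow_two]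

end HilbertValuedIntegral

section DiscreteGronwall

theorem le_exp_mul_of_le_add_mul {δ p q : ℝ} (hδ : 0 ≤ δ) (hδ' : δ ≤ 1 / 2) (hq : 0 ≤ q)
    (h : q ≤ p + δ * q) : q ≤ Real.exp (2 * δ) * p := by
  have hp : 0 ≤ p := by nlinarith
  calc q ≤ (1 + 2 * δ) * ((1 - δ) * q) := by
        nlinarith [mul_nonneg (mul_nonneg hδ (by linarith : 0 ≤ 1 - 2 * δ)) hq]
    _ ≤ (1 + 2 * δ) * p := by gcongr; linarith
    _ ≤ Real.exp (2 * δ) * p := by gcongr; linarith [Real.add_one_le_exp (2 * δ)]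

theorem implicit_discrete_gronwall {y s g : ℕ → ℝ} {δ : ℝ} {n : ℕ} (hδ : 0 ≤ δ) (hδ' : δ ≤ 1 / 2)
    (hy : ∀ k ≤ n, 0 ≤ y k) (hs : ∀ k < n, 0 ≤ s k) (hg : ∀ k < n, 0 ≤ g k)
    (hstep : ∀ k < n, y (k + 1) + s k ≤ y k + δ * y (k + 1) + g k) :
    y n + ∑ k ∈ Finset.range n, s k
      ≤ Real.exp (2 * δ * n) * (y 0 + ∑ k ∈ Finset.range n, g k) := by
  induction n with
  | zero => simp
  | succ n ih =>
    have ih := ih (fun k hk => hy k (by lia)) (fun k hk => hs k (by lia))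
      (fun k hk => hg k (by lia)) (fun k hk => hstep k (by lia))
    have hsum : 0 ≤ ∑ k ∈ Finset.range (n + 1), s k :=
      Finset.sum_nonneg fun k hk => hs k (Finset.mem_range.1 hk)
    have himplicit : y (n + 1) + ∑ k ∈ Finset.range (n + 1), s k
        ≤ (y n + ∑ k ∈ Finset.range n, s k + g n)
          + δ * (y (n + 1) + ∑ k ∈ Finset.range (n + 1), s k) := by
      have hn := hstep n (by lia)
      have := mul_nonneg hδ hsum
      rw [Finset.sum_range_succ] at this ⊢
      linarith
    have hone : 1 ≤ Real.exp (2 * δ * n) := Real.one_le_exp (by positivity)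
    calc y (n + 1) + ∑ k ∈ Finset.range (n + 1), s k
        ≤ Real.exp (2 * δ) * (y n + ∑ k ∈ Finset.range n, s k + g n) :=
          le_exp_mul_of_le_add_mul hδ hδ' (add_nonneg (hy _ le_rfl) hsum) himplicit
      _ ≤ Real.exp (2 * δ) * (Real.exp (2 * δ * n) * (y 0 + ∑ k ∈ Finset.range n, g k)
          + Real.exp (2 * δ * n) * g n) := by
          gcongr
          exact le_mul_of_one_le_left (hg n (by lia)) hone
      _ = Real.exp (2 * δ * (n + 1 : ℕ)) * (y 0 + ∑ k ∈ Finset.range (n + 1), g k) := by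
          rw [← mul_add, ← mul_assoc, ← Real.exp_add, Finset.sum_range_succ, add_assoc]
          push_cast
          ring_nf

theorem sq_norm_sub_le_mul_sum_sq {E : Type*} [SeminormedAddCommGroup E] (v : ℕ → E) {k l : ℕ}
    (hkl : k ≤ l) :
    ‖v l - v k‖ ^ 2 ≤ (l - k : ℝ) * ∑ j ∈ Finset.range l, ‖v (j + 1) - v j‖ ^ 2 := by
  have hcard : ((Finset.Ico k l).card : ℝ) = l - k := by rw [Nat.card_Ico, Nat.cast_sub hkl]
  have hsub : Finset.Ico k l ⊆ Finset.range l := fun j hj =>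
    Finset.mem_range.2 (Finset.mem_Ico.1 hj).2
  calc ‖v l - v k‖ ^ 2 = ‖∑ j ∈ Finset.Ico k l, (v (j + 1) - v j)‖ ^ 2 := by
        rw [Finset.sum_Ico_sub v hkl]
    _ ≤ (∑ j ∈ Finset.Ico k l, ‖v (j + 1) - v j‖) ^ 2 := by gcongr; exact norm_sum_le _ _
    _ ≤ (Finset.Ico k l).card * ∑ j ∈ Finset.Ico k l, ‖v (j + 1) - v j‖ ^ 2 :=
        sq_sum_le_card_mul_sum_sq
    _ ≤ (l - k : ℝ) * ∑ j ∈ Finset.range l, ‖v (j + 1) - v j‖ ^ 2 := by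
        rw [← hcard]
        gcongr

end DiscreteGronwall

section StronglyMonotone

variable {H : Type*} [NormedAddCommGroup H] [InnerProductSpace ℝ H]

/-- `A` is strongly monotone with constant `c`, the nonlinear analogue of coercivity. -/
def IsStronglyMonotone (c : ℝ) (A : H → H) : Prop :=
  ∀ x y, c * ‖x - y‖ ^ 2 ≤ inner ℝ (A x - A y) (x - y)

namespace IsStronglyMonotone

variable {A : H → H} {c : ℝ} {K : NNReal}

theorem sq_norm_sub_smul_le (hA : IsStronglyMonotone c A) (hK : LipschitzWith K A) {ε : ℝ}
    (hε : 0 ≤ ε) (x y : H) :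
    ‖(x - y) - ε • (A x - A y)‖ ^ 2 ≤ (1 - 2 * ε * c + ε ^ 2 * K ^ 2) * ‖x - y‖ ^ 2 := by
  have hlip : ‖A x - A y‖ ^ 2 ≤ (K * ‖x - y‖) ^ 2 := by gcongr; exact hK.norm_sub_le x y
  rw [norm_sub_sq_real, inner_smul_right, norm_smul, Real.norm_eq_abs, abs_of_nonneg hε,
    real_inner_comm, mul_pow]
  linarith [mul_le_mul_of_nonneg_left (hA x y) hε, mul_le_mul_of_nonneg_left hlip (sq_nonneg ε)]

theorem exists_contractingWith (hA : IsStronglyMonotone c A) (hc : 0 < c)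
    (hK : LipschitzWith K A) (f : H) :
    ∃ ε : ℝ, 0 < ε ∧ ∃ q : NNReal, ContractingWith q fun x => x - ε • (A x - f) := by
  have hKc : 0 < (K : ℝ) + c := by positivity
  have hlt : 0 < c / (K + c) := by positivity
  have hle : c / (K + c) ≤ 1 := (div_le_one hKc).2 (by linarith [K.coe_nonneg])
  refine ⟨c / (K + c) ^ 2, by positivity, Real.toNNReal √(1 - (c / (K + c)) ^ 2), ?_, ?_⟩
  · rw [Real.toNNReal_lt_one, Real.sqrt_lt' one_pos]
    nlinarith
  · refine LipschitzWith.of_dist_le_mul fun x y => ?_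
    rw [dist_eq_norm, dist_eq_norm, Real.coe_toNNReal _ (Real.sqrt_nonneg _),
      ← Real.sqrt_sq (norm_nonneg (x - y)), ← Real.sqrt_mul (by nlinarith)]
    refine Real.le_sqrt_of_sq_le ?_
    have hfactor : 1 - 2 * (c / (K + c) ^ 2) * c + (c / (K + c) ^ 2) ^ 2 * K ^ 2
        ≤ 1 - (c / (K + c)) ^ 2 := by
      have hK1 : (K / (K + c)) ^ 2 ≤ 1 := by
        refine pow_le_one₀ (by positivity) ((div_le_one hKc).2 (by linarith))
      calc _ = 1 - 2 * (c / (K + c)) ^ 2 + (c / (K + c)) ^ 2 * (K / (K + c)) ^ 2 := by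
            field_simp
        _ ≤ _ := by nlinarith [sq_nonneg (c / (K + c))]
    calc _ = ‖(x - y) - (c / (K + c) ^ 2) • (A x - A y)‖ ^ 2 := by
          congr 2
          simp only [smul_sub]
          abel
      _ ≤ _ := hA.sq_norm_sub_smul_le hK (by positivity) x y
      _ ≤ _ := by gcongr

theorem surjective [CompleteSpace H] (hA : IsStronglyMonotone c A) (hc : 0 < c)
    (hK : LipschitzWith K A) : Function.Surjective A := by
  intro f
  obtain ⟨ε, hε, q, hq⟩ := hA.exists_contractingWith hc hK f
  have hfix : ε • (A (hq.fixedPoint _) - f) = 0 := sub_eq_self.1 hq.fixedPoint_isFixedPt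
  exact ⟨hq.fixedPoint _, sub_eq_zero.1 ((smul_eq_zero.1 hfix).resolve_left hε.ne')⟩

end IsStronglyMonotone

end StronglyMonotone

section Energy

variable {H : Type*} [NormedAddCommGroup H] [InnerProductSpace ℝ H] {M : ℝ}

/-- The energy `½‖a‖² + ⟪β, a⟫ + M²` controlling the gradient `a` of the unknown in the presence
of a drift `β` with `‖β‖ ≤ M`; the shift by `M²` makes it coercive. -/
noncomputable def driftEnergy (M : ℝ) (a β : H) : ℝ := 1 / 2 * ‖a‖ ^ 2 + inner ℝ β a + M ^ 2

theorem quarter_sq_norm_le_driftEnergy {a β : H} (hβ : ‖β‖ ≤ M) :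
    1 / 4 * ‖a‖ ^ 2 ≤ driftEnergy M a β := by
  have hinner : -(‖β‖ * ‖a‖) ≤ inner ℝ β a := (abs_le.1 (abs_real_inner_le_norm β a)).1
  have hM : ‖β‖ * ‖a‖ ≤ M * ‖a‖ := by gcongr
  unfold driftEnergy
  nlinarith [sq_nonneg (‖a‖ / 2 - M)]

theorem driftEnergy_nonneg {a β : H} (hβ : ‖β‖ ≤ M) : 0 ≤ driftEnergy M a β :=
  le_trans (by positivity) (quarter_sq_norm_le_driftEnergy hβ)

theorem driftEnergy_sub_le (a a' β β' : H) :
    driftEnergy M a' β' - driftEnergy M a β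
      ≤ inner ℝ (a' + β) (a' - a) + ‖β' - β‖ * ‖a'‖ := by
  have hconvex : 0 ≤ ‖a' - a‖ ^ 2 := sq_nonneg _
  have hcs := real_inner_le_norm (β' - β) a'
  rw [norm_sub_sq_real] at hconvex
  simp only [driftEnergy, inner_add_left, inner_sub_left, inner_sub_right,
    real_inner_self_eq_norm_sq] at hcs ⊢
  linarith

/-- The rate in the Grönwall argument for `driftEnergy` when the drift is `L`-Lipschitz in an
unknown whose time derivative is `c`-strongly dissipated. -/
noncomputable def energyRate (L c : ℝ) : ℝ := 2 * L ^ 2 / c + 2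

theorem energyRate_pos {L c : ℝ} (hc : 0 < c) : 0 < energyRate L c := by
  unfold energyRate
  positivity

theorem driftEnergy_step {a a' β β' : H} {c τ L d r σ : ℝ} (hc : 0 < c) (hτ : 0 < τ)
    (hstep : c * d ^ 2 + τ * inner ℝ (a' + β) (a' - a) ≤ 0) (hβ' : ‖β'‖ ≤ M)
    (hL : ‖β' - β‖ ≤ L * d + r) (hr : r ^ 2 ≤ τ * σ) :
    driftEnergy M a' β' + c / (2 * τ) * d ^ 2
      ≤ driftEnergy M a β + energyRate L c * τ * driftEnergy M a' β' + σ / 2 := by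
  have hdissipation : inner ℝ (a' + β) (a' - a) ≤ -(2 * (c / (2 * τ) * d ^ 2)) := by
    rw [show 2 * (c / (2 * τ) * d ^ 2) = c * d ^ 2 / τ by field_simp, ← neg_div, le_div_iff₀ hτ]
    linarith
  have hdrift : ‖β' - β‖ * ‖a'‖ ≤ (L * d + r) * ‖a'‖ := by gcongr
  have young_lipschitz : L * d * ‖a'‖ ≤ c / (2 * τ) * d ^ 2 + τ * L ^ 2 / (2 * c) * ‖a'‖ ^ 2 := by
    have : 0 ≤ (c * d - τ * L * ‖a'‖) ^ 2 / (2 * c * τ) := by positivity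
    have expand : (c * d - τ * L * ‖a'‖) ^ 2 / (2 * c * τ)
        = c / (2 * τ) * d ^ 2 + τ * L ^ 2 / (2 * c) * ‖a'‖ ^ 2 - L * d * ‖a'‖ := by
      field_simp
      ring
    linarith
  have young_remainder : r * ‖a'‖ ≤ σ / 2 + τ / 2 * ‖a'‖ ^ 2 := by
    refine le_of_mul_le_mul_left ?_ hτ
    nlinarith [sq_nonneg (r - τ * ‖a'‖)]
  have habsorb : τ * L ^ 2 / (2 * c) * ‖a'‖ ^ 2 + τ / 2 * ‖a'‖ ^ 2
      ≤ energyRate L c * τ * driftEnergy M a' β' :=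
    calc _ = energyRate L c * τ * (1 / 4 * ‖a'‖ ^ 2) := by
          unfold energyRate
          field_simp
          ring
      _ ≤ _ := mul_le_mul_of_nonneg_left (quarter_sq_norm_le_driftEnergy hβ')
          (mul_nonneg (energyRate_pos hc).le hτ.le)
  linarith [driftEnergy_sub_le (M := M) a a' β β']

end Energy

section EulerScheme

/-- A time-dependent drift on `[0, T]` that is `L`-Lipschitz in the state, bounded by `M`, and
whose increments in time are controlled by `ρ`. The last condition encodes `B ∈ W^{1,2}(0, T)`
uniformly in the state, with `ρ t` in the role of `∫₀ᵗ ‖∂ₜ B‖²`. -/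
structure IsBoundedLipschitzDrift {H : Type*} [NormedAddCommGroup H] (T : ℝ) (L : NNReal) (M : ℝ)
    (ρ : ℝ → ℝ) (B : ℝ → H → H) : Prop where
  lipschitzWith : ∀ t ∈ Icc 0 T, LipschitzWith L (B t)
  norm_le : ∀ t ∈ Icc 0 T, ∀ u, ‖B t u‖ ≤ M
  sq_norm_sub_le : ∀ s ∈ Icc 0 T, ∀ t ∈ Icc 0 T, s ≤ t → ∀ u,
    ‖B t u - B s u‖ ^ 2 ≤ (t - s) * (ρ t - ρ s)

theorem IsBoundedLipschitzDrift.monotoneOn {H : Type*} [NormedAddCommGroup H] {T : ℝ} {L : NNReal}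
    {M : ℝ} {ρ : ℝ → ℝ} {B : ℝ → H → H} (hB : IsBoundedLipschitzDrift T L M ρ B) :
    MonotoneOn ρ (Icc 0 T) := by
  intro s hs t ht hst
  rcases hst.eq_or_lt with rfl | hlt
  · rfl
  have hnonneg := (sq_nonneg _).trans (hB.sq_norm_sub_le s hs t ht hst 0)
  exact sub_nonneg.1 (nonneg_of_mul_nonneg_right hnonneg (sub_pos.2 hlt))

variable {W H : Type*} [NormedAddCommGroup W] [InnerProductSpace ℝ W] [CompleteSpace W]
  [NormedAddCommGroup H] [InnerProductSpace ℝ H] [CompleteSpace H]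

/-- The Euler scheme with step `τ` for `d/dt N(Jx) + D†(Dx + B(t, Jx)) = 0`, tested against `J φ`:
implicit in the monotone part, explicit in the drift `B`. -/
def IsEulerScheme (J D : W →L[ℝ] H) (N : H → H) (B : ℝ → H → H) (τ : ℝ) (x : ℕ → W) : Prop :=
  ∀ k, J.adjoint (N (J (x (k + 1))) - N (J (x k)))
    + τ • D.adjoint (D (x (k + 1)) + B (k * τ) (J (x k))) = 0

variable {J D : W →L[ℝ] H} {N : H → H} {B : ℝ → H → H} {K LN L : NNReal} {c T M τ : ℝ} {ρ : ℝ → ℝ}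
  {x : ℕ → W}

theorem isStronglyMonotone_adjoint_comp_add (hK : ∀ x, ‖x‖ ^ 2 ≤ K * (‖J x‖ ^ 2 + ‖D x‖ ^ 2))
    (hc : 0 ≤ c) (hmono : IsStronglyMonotone c N) (hτ : 0 ≤ τ) :
    IsStronglyMonotone (min c τ / (K + 1))
      (fun x => J.adjoint (N (J x)) + τ • D.adjoint (D x)) := by
  intro x y
  have htested : inner ℝ (J.adjoint (N (J x)) + τ • D.adjoint (D x)
      - (J.adjoint (N (J y)) + τ • D.adjoint (D y))) (x - y)
      = inner ℝ (N (J x) - N (J y)) (J x - J y) + τ * ‖D (x - y)‖ ^ 2 := by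
    rw [add_sub_add_comm, ← map_sub, ← smul_sub, ← map_sub, ← map_sub, inner_add_left,
      real_inner_smul_left, ContinuousLinearMap.adjoint_inner_left,
      ContinuousLinearMap.adjoint_inner_left, real_inner_self_eq_norm_sq, map_sub J]
  have : 0 ≤ min c τ := le_min hc hτ
  have hnorm : ‖x - y‖ ^ 2 ≤ (‖J (x - y)‖ ^ 2 + ‖D (x - y)‖ ^ 2) * (K + 1) := by
    nlinarith [hK (x - y), sq_nonneg ‖J (x - y)‖, sq_nonneg ‖D (x - y)‖]
  rw [htested, div_mul_eq_mul_div, div_le_iff₀ (by positivity)]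
  calc min c τ * ‖x - y‖ ^ 2
      ≤ min c τ * ((‖J (x - y)‖ ^ 2 + ‖D (x - y)‖ ^ 2) * (K + 1)) := by gcongr
    _ = (min c τ * ‖J (x - y)‖ ^ 2 + min c τ * ‖D (x - y)‖ ^ 2) * (K + 1) := by ring
    _ ≤ (c * ‖J x - J y‖ ^ 2 + τ * ‖D (x - y)‖ ^ 2) * (K + 1) := by
        rw [map_sub J]
        gcongr
        · exact min_le_left _ _
        · exact min_le_right _ _
    _ ≤ _ := by gcongr; exact hmono _ _

theorem exists_eulerStep (hK : ∀ x, ‖x‖ ^ 2 ≤ K * (‖J x‖ ^ 2 + ‖D x‖ ^ 2)) (hc : 0 < c)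
    (hN : LipschitzWith LN N) (hmono : IsStronglyMonotone c N) (hτ : 0 < τ) (g β : H) :
    ∃ x : W, J.adjoint (N (J x) - g) + τ • D.adjoint (D x + β) = 0 := by
  obtain ⟨x, hx⟩ := (isStronglyMonotone_adjoint_comp_add hK hc.le hmono hτ.le).surjective
    (by positivity) ((J.adjoint.lipschitz.comp (hN.comp J.lipschitz)).add
      ((lipschitzWith_smul τ).comp (D.adjoint.lipschitz.comp D.lipschitz)))
    (J.adjoint g - τ • D.adjoint β)
  refine ⟨x, ?_⟩
  rw [map_sub, map_add, smul_add, sub_add_eq_add_sub, ← add_assoc]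
  simp only [hx]
  abel

theorem exists_isEulerScheme (hK : ∀ x, ‖x‖ ^ 2 ≤ K * (‖J x‖ ^ 2 + ‖D x‖ ^ 2)) (hc : 0 < c)
    (hN : LipschitzWith LN N) (hmono : IsStronglyMonotone c N) (B : ℝ → H → H) (hτ : 0 < τ)
    (x₀ : W) : ∃ x, IsEulerScheme J D N B τ x ∧ x 0 = x₀ := by
  choose next hnext using fun (x : W) (t : ℝ) =>
    exists_eulerStep hK hc hN hmono hτ (N (J x)) (B t (J x))
  let x : ℕ → W := Nat.rec x₀ fun j y => next y (j * τ)
  exact ⟨x, fun k => hnext (x k) (k * τ), rfl⟩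

namespace IsEulerScheme

theorem inner_add_inner_eq_zero (hx : IsEulerScheme J D N B τ x) (k : ℕ) (φ : W) :
    inner ℝ (N (J (x (k + 1))) - N (J (x k))) (J φ)
      + τ * inner ℝ (D (x (k + 1)) + B (k * τ) (J (x k))) (D φ) = 0 := by
  have h := congrArg (inner ℝ · φ) (hx k)
  simpa only [inner_add_left, real_inner_smul_left, ContinuousLinearMap.adjoint_inner_left,
    inner_zero_left] using h

theorem driftEnergy_step (hx : IsEulerScheme J D N B τ x) (hc : 0 < c)
    (hmono : IsStronglyMonotone c N) (hB : IsBoundedLipschitzDrift T L M ρ B) (hτ : 0 < τ) {k : ℕ}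
    (hk : (k + 1 : ℕ) * τ ≤ T) :
    driftEnergy M (D (x (k + 1))) (B ((k + 1 : ℕ) * τ) (J (x (k + 1))))
        + c / (2 * τ) * ‖J (x (k + 1)) - J (x k)‖ ^ 2
      ≤ driftEnergy M (D (x k)) (B (k * τ) (J (x k)))
        + energyRate L c * τ
          * driftEnergy M (D (x (k + 1))) (B ((k + 1 : ℕ) * τ) (J (x (k + 1))))
        + (ρ ((k + 1 : ℕ) * τ) - ρ (k * τ)) / 2 := by
  have hle : k * τ ≤ (k + 1 : ℕ) * τ := by gcongr; simp
  have hmem : k * τ ∈ Icc 0 T := ⟨by positivity, hle.trans hk⟩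
  have hmem' : (k + 1 : ℕ) * τ ∈ Icc 0 T := ⟨by positivity, hk⟩
  refine _root_.driftEnergy_step hc hτ ?_ (hB.norm_le _ hmem' _)
    (r := ‖B ((k + 1 : ℕ) * τ) (J (x k)) - B (k * τ) (J (x k))‖) ?_ ?_
  · have htest := hx.inner_add_inner_eq_zero k (x (k + 1) - x k)
    rw [map_sub, map_sub] at htest
    linarith [hmono (J (x (k + 1))) (J (x k))]
  · rw [← sub_add_sub_cancel _ (B ((k + 1 : ℕ) * τ) (J (x k)))]
    exact (norm_add_le _ _).trans (add_le_add_left ((hB.lipschitzWith _ hmem').norm_sub_le _ _) _)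
  · refine (hB.sq_norm_sub_le _ hmem _ hmem' hle _).trans_eq ?_
    push_cast
    ring

/-- The discrete energy bound, from the initial energy `Y` and the variation `V` of `ρ`. -/
noncomputable def energyBound (L c T Y V : ℝ) : ℝ := Real.exp (2 * energyRate L c * T) * (Y + V / 2)

theorem driftEnergy_add_sum_le (hx : IsEulerScheme J D N B τ x) (hc : 0 < c)
    (hmono : IsStronglyMonotone c N) (hB : IsBoundedLipschitzDrift T L M ρ B) (hτ : 0 < τ)
    (hτ' : energyRate L c * τ ≤ 1 / 2) {n : ℕ} (hn : n * τ ≤ T) :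
    driftEnergy M (D (x n)) (B (n * τ) (J (x n)))
        + ∑ k ∈ Finset.range n, c / (2 * τ) * ‖J (x (k + 1)) - J (x k)‖ ^ 2
      ≤ energyBound L c T (driftEnergy M (D (x 0)) (B 0 (J (x 0)))) (ρ T - ρ 0) := by
  have hT : 0 ≤ T := le_trans (by positivity) hn
  have hmem : ∀ k ≤ n, (k : ℝ) * τ ∈ Icc 0 T := fun k hk =>
    ⟨by positivity, le_trans (by gcongr) hn⟩
  have hrate := energyRate_pos (L := L) hc
  have hgronwall := implicit_discrete_gronwall (n := n)
    (y := fun k => driftEnergy M (D (x k)) (B (k * τ) (J (x k))))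
    (s := fun k => c / (2 * τ) * ‖J (x (k + 1)) - J (x k)‖ ^ 2)
    (g := fun k => (ρ ((k + 1 : ℕ) * τ) - ρ (k * τ)) / 2)
    (by positivity) hτ' (fun k hk => driftEnergy_nonneg (hB.norm_le _ (hmem k hk) _))
    (fun k _ => by positivity)
    (fun k hk => div_nonneg (sub_nonneg.2 (hB.monotoneOn (hmem k hk.le) (hmem (k + 1) hk)
      (by gcongr; simp))) zero_le_two)
    (fun k hk => hx.driftEnergy_step hc hmono hB hτ (hmem (k + 1) hk).2)
  have htelescope : ∑ k ∈ Finset.range n, (ρ ((k + 1 : ℕ) * τ) - ρ (k * τ)) / 2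
      = (ρ (n * τ) - ρ 0) / 2 := by
    rw [← Finset.sum_div, Finset.sum_range_sub (fun j : ℕ => ρ (j * τ)), Nat.cast_zero, zero_mul]
  have hρn : ρ (n * τ) ≤ ρ T := hB.monotoneOn (hmem n le_rfl) (right_mem_Icc.2 hT) hn
  have hρ0 : ρ 0 ≤ ρ (n * τ) := hB.monotoneOn (left_mem_Icc.2 hT) (hmem n le_rfl) (by positivity)
  have hY := driftEnergy_nonneg (a := D (x 0)) (hB.norm_le _ (left_mem_Icc.2 hT) (J (x 0)))
  rw [htelescope, Nat.cast_zero, zero_mul] at hgronwall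
  refine hgronwall.trans (mul_le_mul ?_ (by linarith) (by linarith) (Real.exp_nonneg _))
  refine Real.exp_le_exp.2 ?_
  calc 2 * (energyRate L c * τ) * n = 2 * energyRate L c * (n * τ) := by ring
    _ ≤ _ := by gcongr

section Bounds

variable (hx : IsEulerScheme J D N B τ x) (hc : 0 < c) (hmono : IsStronglyMonotone c N)
  (hB : IsBoundedLipschitzDrift T L M ρ B) (hτ : 0 < τ) (hτ' : energyRate L c * τ ≤ 1 / 2) {P : ℝ}
  (hP : energyBound L c T (driftEnergy M (D (x 0)) (B 0 (J (x 0)))) (ρ T - ρ 0) ≤ P)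
include hx hc hmono hB hτ hτ' hP

theorem sum_sq_norm_sub_le {n : ℕ} (hn : n * τ ≤ T) :
    ∑ k ∈ Finset.range n, ‖J (x (k + 1)) - J (x k)‖ ^ 2 ≤ 2 / c * P * τ := by
  have henergy := hx.driftEnergy_add_sum_le hc hmono hB hτ hτ' hn
  have hnonneg := driftEnergy_nonneg (a := D (x n)) (hB.norm_le _ ⟨by positivity, hn⟩ (J (x n)))
  rw [← Finset.mul_sum] at henergy
  calc ∑ k ∈ Finset.range n, ‖J (x (k + 1)) - J (x k)‖ ^ 2
      = 2 / c * (c / (2 * τ) * ∑ k ∈ Finset.range n, ‖J (x (k + 1)) - J (x k)‖ ^ 2) * τ := by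
        field_simp
    _ ≤ 2 / c * P * τ := by gcongr; linarith

theorem sq_norm_gradient_le {n : ℕ} (hn : n * τ ≤ T) : ‖D (x n)‖ ^ 2 ≤ 4 * P := by
  have henergy := hx.driftEnergy_add_sum_le hc hmono hB hτ hτ' hn
  have hsum : 0 ≤ ∑ k ∈ Finset.range n, c / (2 * τ) * ‖J (x (k + 1)) - J (x k)‖ ^ 2 :=
    Finset.sum_nonneg fun _ _ => by positivity
  linarith [quarter_sq_norm_le_driftEnergy (a := D (x n))
    (hB.norm_le _ ⟨by positivity, hn⟩ (J (x n)))]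

theorem sq_norm_state_le {n : ℕ} (hn : n * τ ≤ T) :
    ‖J (x n)‖ ^ 2 ≤ 2 * ‖J (x 0)‖ ^ 2 + 2 * (T * (2 / c * P)) := by
  have hsum := hx.sum_sq_norm_sub_le hc hmono hB hτ hτ' hP hn
  have hS : 0 ≤ 2 / c * P :=
    nonneg_of_mul_nonneg_left ((Finset.sum_nonneg fun _ _ => by positivity).trans hsum) hτ
  have hdist : ‖J (x n) - J (x 0)‖ ^ 2 ≤ T * (2 / c * P) :=
    calc _ ≤ (n - (0 : ℕ) : ℝ) * ∑ k ∈ Finset.range n, ‖J (x (k + 1)) - J (x k)‖ ^ 2 :=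
          sq_norm_sub_le_mul_sum_sq (fun k => J (x k)) n.zero_le
      _ ≤ n * (2 / c * P * τ) := by rw [Nat.cast_zero, sub_zero]; gcongr
      _ = n * τ * (2 / c * P) := by ring
      _ ≤ T * (2 / c * P) := by gcongr
  have htriangle : ‖J (x n)‖ ≤ ‖J (x n) - J (x 0)‖ + ‖J (x 0)‖ := by
    simpa only [sub_add_cancel] using norm_add_le (J (x n) - J (x 0)) (J (x 0))
  nlinarith [norm_nonneg (J (x n)), sq_nonneg (‖J (x n) - J (x 0)‖ - ‖J (x 0)‖)]

end Bounds

end IsEulerScheme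

theorem exists_bound_isEulerScheme (hK : ∀ x, ‖x‖ ^ 2 ≤ K * (‖J x‖ ^ 2 + ‖D x‖ ^ 2)) (hc : 0 < c)
    (hmono : IsStronglyMonotone c N) (hB : IsBoundedLipschitzDrift T L M ρ B) (x₀ : W) :
    ∃ R, 0 ≤ R ∧ ∃ δ > 0, ∀ τ, 0 < τ → τ ≤ δ → ∀ x, IsEulerScheme J D N B τ x → x 0 = x₀ →
      ∀ n : ℕ, n * τ ≤ T → ‖x n‖ ≤ R ∧
        ∑ k ∈ Finset.range n, ‖J (x (k + 1)) - J (x k)‖ ^ 2 ≤ R * τ := by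
  have hrate := energyRate_pos (L := L) hc
  set P := IsEulerScheme.energyBound L c T (driftEnergy M (D x₀) (B 0 (J x₀))) (ρ T - ρ 0)
  set V := K * (2 * ‖J x₀‖ ^ 2 + 2 * (T * (2 / c * P)) + 4 * P)
  refine ⟨max √V (2 / c * P), le_max_of_le_left (Real.sqrt_nonneg _), 1 / (2 * energyRate L c),
    by positivity, fun τ hτ hτδ x hx hx₀ n hn => ?_⟩
  have hτ' : energyRate L c * τ ≤ 1 / 2 := by
    rw [le_div_iff₀ (by positivity)] at hτδ
    linarith
  have hP : IsEulerScheme.energyBound L c T (driftEnergy M (D (x 0)) (B 0 (J (x 0))))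
      (ρ T - ρ 0) ≤ P := by rw [hx₀]
  constructor
  · have hstate := hx.sq_norm_state_le hc hmono hB hτ hτ' hP hn
    rw [hx₀] at hstate
    have hgradient := hx.sq_norm_gradient_le hc hmono hB hτ hτ' hP hn
    exact le_max_of_le_left (Real.le_sqrt_of_sq_le ((hK (x n)).trans
      (mul_le_mul_of_nonneg_left (add_le_add hstate hgradient) K.coe_nonneg)))
  · refine (hx.sum_sq_norm_sub_le hc hmono hB hτ hτ' hP hn).trans ?_
    gcongr
    exact le_max_right _ _

end EulerScheme

section WeakConvergence

variable {ι W H : Type*} [NormedAddCommGroup W] [InnerProductSpace ℝ W]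
  [NormedAddCommGroup H] [InnerProductSpace ℝ H]

/-- Weak convergence in a real inner product space. The a priori bounds are turned into weak limits
along an ultrafilter, which avoids the extraction of nested subsequences. -/
def TendstoWeakly (l : Filter ι) (x : ι → W) (y : W) : Prop :=
  ∀ ψ, Tendsto (fun i => inner ℝ (x i) ψ) l (𝓝 (inner ℝ y ψ))

theorem tendstoWeakly_of_tendsto {l : Filter ι} {x : ι → W} {y : W} (h : Tendsto x l (𝓝 y)) :
    TendstoWeakly l x y :=
  fun _ => h.inner tendsto_const_nhds

theorem exists_tendstoWeakly [CompleteSpace W] {x : ι → W} {R : ℝ} (hx : ∀ i, ‖x i‖ ≤ R)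
    (U : Ultrafilter ι) : ∃ y, ‖y‖ ≤ R ∧ TendstoWeakly U x y := by
  let f : ι → WeakDual ℝ W := fun i =>
    StrongDual.toWeakDual (InnerProductSpace.toDual ℝ W (x i))
  have hmem : ∀ᶠ i in (U : Filter ι), f i ∈
      WeakDual.toStrongDual ⁻¹' Metric.closedBall (0 : StrongDual ℝ W) R :=
    .of_forall fun i => mem_closedBall_zero_iff.2 (by
      exact ((InnerProductSpace.toDual ℝ W).norm_map (x i)).trans_le (hx i))
  obtain ⟨g, hg, hfg⟩ := (WeakDual.isCompact_closedBall (𝕜 := ℝ) (E := W) 0 R).ultrafilter_le_nhds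
    (U.map f) (le_principal_iff.2 hmem)
  refine ⟨(InnerProductSpace.toDual ℝ W).symm (WeakDual.toStrongDual g), ?_, fun ψ => ?_⟩
  · rw [LinearIsometryEquiv.norm_map]
    exact mem_closedBall_zero_iff.1 hg
  · rw [InnerProductSpace.toDual_symm_apply]
    exact ((WeakDual.eval_continuous (𝕜 := ℝ) ψ).tendsto g).comp hfg

namespace TendstoWeakly

variable {l : Filter ι} {x x' : ι → W} {y y' : W}

theorem add (h : TendstoWeakly l x y) (h' : TendstoWeakly l x' y') :
    TendstoWeakly l (fun i => x i + x' i) (y + y') := fun ψ => by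
  simpa only [inner_add_left] using (h ψ).add (h' ψ)

theorem map [CompleteSpace W] [CompleteSpace H] (h : TendstoWeakly l x y) (A : W →L[ℝ] H) :
    TendstoWeakly l (fun i => A (x i)) (A y) := fun ψ => by
  simpa only [ContinuousLinearMap.adjoint_inner_right] using h (A.adjoint ψ)

theorem unique [l.NeBot] (h : TendstoWeakly l x y) (h' : TendstoWeakly l x y') : y = y' :=
  ext_inner_right ℝ fun ψ => tendsto_nhds_unique (h ψ) (h' ψ)

variable [CompleteSpace W] [CompleteSpace H] {U : Ultrafilter ι} {R : ℝ} {J : W →L[ℝ] H}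

theorem of_injective (hJ : Function.Injective J) (hx : ∀ i, ‖x i‖ ≤ R)
    (h : TendstoWeakly U (fun i => J (x i)) (J y)) : TendstoWeakly U x y := by
  obtain ⟨y', -, hy'⟩ := exists_tendstoWeakly hx U
  rwa [hJ (h.unique (hy'.map J))]

theorem tendsto_of_isCompactOperator (h : TendstoWeakly U x y) (hJ : IsCompactOperator J)
    (hx : ∀ i, ‖x i‖ ≤ R) : Tendsto (fun i => J (x i)) U (𝓝 (J y)) := by
  obtain ⟨S, hS, hJS⟩ := IsCompactOperator.image_closedBall_subset_compact (f := J.toLinearMap) hJ R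
  have hmem : ∀ᶠ i in (U : Filter ι), J (x i) ∈ S :=
    .of_forall fun i => hJS (mem_image_of_mem J (mem_closedBall_zero_iff.2 (hx i)))
  obtain ⟨z, -, hz⟩ := hS.ultrafilter_le_nhds (U.map fun i => J (x i)) (le_principal_iff.2 hmem)
  have hz : Tendsto (fun i => J (x i)) U (𝓝 z) := hz
  rwa [← (tendstoWeakly_of_tendsto hz).unique (h.map J)]

end TendstoWeakly

theorem isCompactOperator_of_tendstoWeakly [CompleteSpace W] {A : W →L[ℝ] H}
    (hA : ∀ (U : Ultrafilter (Metric.closedBall (0 : W) 1)) (y : W),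
      TendstoWeakly (U : Filter _) (fun x : Metric.closedBall (0 : W) 1 => (x : W)) y →
      Tendsto (fun x : Metric.closedBall (0 : W) 1 => A x) (U : Filter _) (𝓝 (A y))) :
    IsCompactOperator A := by
  refine ⟨A '' Metric.closedBall 0 1, ?_, mem_of_superset (Metric.closedBall_mem_nhds 0 one_pos)
    (subset_preimage_image A _)⟩
  refine isCompact_iff_ultrafilter_le_nhds'.2 fun V hV => ?_
  have hrange : (fun x : Metric.closedBall (0 : W) 1 => A x) '' univ ∈ V := by
    rwa [image_univ, range_comp' A, Subtype.range_coe]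
  obtain ⟨y, hy, hUy⟩ := exists_tendstoWeakly (x := ((↑) : Metric.closedBall (0 : W) 1 → W))
    (fun x => mem_closedBall_zero_iff.1 x.2) (.ofComapInfPrincipal hrange)
  refine ⟨A y, mem_image_of_mem A (mem_closedBall_zero_iff.2 hy), ?_⟩
  rw [← Ultrafilter.ofComapInfPrincipal_eq_of_map hrange]
  exact hA _ y hUy

theorem sq_norm_toLp {α : Type*} [MeasurableSpace α] {μ : Measure α} {w : α → H}
    (hw : MemLp w 2 μ) : ‖hw.toLp w‖ ^ 2 = ∫ s, ‖w s‖ ^ 2 ∂μ := by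
  rw [← real_inner_self_eq_norm_sq, L2.inner_def]
  refine integral_congr_ae ?_
  filter_upwards [hw.coeFn_toLp] with s hs
  rw [hs, real_inner_self_eq_norm_sq]

variable {T R : ℝ}

theorem intervalIntegral_toLp {w : ℝ → H} (hw : MemLp w 2 (volume.restrict (Ioo 0 T))) {t : ℝ}
    (ht : t ∈ Icc 0 T) : ∫ s in (0 : ℝ)..t, hw.toLp w s = ∫ s in (0 : ℝ)..t, w s := by
  rw [intervalIntegral.integral_of_le ht.1, intervalIntegral.integral_of_le ht.1,
    integral_Ioc_eq_integral_Ioo, integral_Ioc_eq_integral_Ioo]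
  exact integral_congr_ae
    (ae_restrict_of_ae_restrict_of_subset (Ioo_subset_Ioo_right ht.2) hw.coeFn_toLp)

variable [CompleteSpace H]

theorem inner_indicatorConstLp_Ioo (f : Lp H 2 (volume.restrict (Ioo 0 T))) {t : ℝ}
    (ht : t ∈ Icc 0 T) (ψ : H) :
    inner ℝ f (indicatorConstLp 2 (measurableSet_Ioo : MeasurableSet (Ioo 0 t))
      (measure_ne_top _ _) ψ) = inner ℝ (∫ s in (0 : ℝ)..t, f s) ψ := by
  rw [real_inner_comm, L2.inner_indicatorConstLp_eq_inner_setIntegral, real_inner_comm,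
    Measure.restrict_restrict measurableSet_Ioo, intervalIntegral.integral_of_le ht.1,
    integral_Ioc_eq_integral_Ioo, inter_eq_left.2 (Ioo_subset_Ioo_right ht.2)]

theorem exists_memLp_integral_eq_of_tendsto {w : ι → ℝ → H}
    (hw : ∀ i, MemLp (w i) 2 (volume.restrict (Ioo 0 T)))
    (hR : ∀ i, ∫ s in Ioo 0 T, ‖w i s‖ ^ 2 ≤ R) {U : Ultrafilter ι} {g : ℝ → H}
    (hg : ∀ t ∈ Icc 0 T, Tendsto (fun i => ∫ s in (0 : ℝ)..t, w i s) U (𝓝 (g t))) :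
    ∃ v : ℝ → H, MemLp v 2 (volume.restrict (Ioo 0 T)) ∧
      ∀ t ∈ Icc 0 T, ∫ s in (0 : ℝ)..t, v s = g t := by
  obtain ⟨v, -, hv⟩ := exists_tendstoWeakly (x := fun i => (hw i).toLp (w i)) (R := √R)
    (fun i => Real.le_sqrt_of_sq_le ((sq_norm_toLp (hw i)).trans_le (hR i))) U
  refine ⟨v, Lp.memLp v, fun t ht => ext_inner_right ℝ fun ψ => ?_⟩
  have hlim := hv (indicatorConstLp 2 measurableSet_Ioo (measure_ne_top _ (Ioo 0 t)) ψ)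
  simp only [inner_indicatorConstLp_Ioo _ ht, intervalIntegral_toLp (hw _) ht] at hlim
  exact tendsto_nhds_unique hlim ((hg t ht).inner tendsto_const_nhds)

end WeakConvergence

section UniformConvergence

variable {ι E : Type*} {l : Filter ι}

theorem tendsto_intervalIntegral_of_tendstoUniformlyOn [NormedAddCommGroup E]
    [NormedSpace ℝ E] {f : ι → ℝ → E} {g : ℝ → E} {a b : ℝ}
    (h : TendstoUniformlyOn f g l (uIoc a b)) (hf : ∀ i, IntervalIntegrable (f i) volume a b)
    (hg : IntervalIntegrable g volume a b) :
    Tendsto (fun i => ∫ s in a..b, f i s) l (𝓝 (∫ s in a..b, g s)) := by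
  rw [Metric.tendstoUniformlyOn_iff] at h
  rw [Metric.tendsto_nhds]
  intro ε hε
  filter_upwards [h (ε / (|b - a| + 1)) (by positivity)] with i hi
  rw [dist_eq_norm, ← intervalIntegral.integral_sub (hf i) hg]
  calc _ ≤ ε / (|b - a| + 1) * |b - a| :=
        intervalIntegral.norm_integral_le_of_norm_le_const fun s hs => by
          rw [← dist_eq_norm, dist_comm]
          exact (hi s hs).le
    _ < ε := by
        rw [div_mul_eq_mul_div, div_lt_iff₀ (by positivity)]
        linarith

/-- Uniform equicontinuity on `S` up to errors that vanish along `l`: for fixed `i` the function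
`f i` may have jumps, as the step functions of a time discretization do. -/
def AsymptoticallyEquicontinuousOn {α : Type*} [PseudoMetricSpace α] [PseudoMetricSpace E]
    (f : ι → α → E) (l : Filter ι) (S : Set α) : Prop :=
  ∀ ε > 0, ∃ δ > 0, ∀ᶠ i in l, ∀ s ∈ S, ∀ t ∈ S, dist s t < δ → dist (f i s) (f i t) < ε

namespace AsymptoticallyEquicontinuousOn

theorem of_sq_norm_sub_le [SeminormedAddCommGroup E] {S : Set ℝ} {R : ℝ} (hR : 0 ≤ R)
    {τ : ι → ℝ} (hτ : Tendsto τ l (𝓝 0)) {f : ι → ℝ → E}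
    (hf : ∀ i, ∀ s ∈ S, ∀ t ∈ S, ‖f i s - f i t‖ ^ 2 ≤ R * (|s - t| + τ i)) :
    AsymptoticallyEquicontinuousOn f l S := by
  intro ε hε
  have hδ : 0 < ε ^ 2 / (2 * (R + 1)) := by positivity
  refine ⟨_, hδ, ?_⟩
  filter_upwards [hτ.eventually (gt_mem_nhds hδ)] with i hi s hs t ht hst
  rw [dist_eq_norm]
  refine lt_of_pow_lt_pow_left₀ 2 hε.le ((hf i s hs t ht).trans_lt ?_)
  calc R * (|s - t| + τ i) ≤ R * (ε ^ 2 / (2 * (R + 1)) + ε ^ 2 / (2 * (R + 1))) := by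
        gcongr
        exact hst.le
    _ = R / (R + 1) * ε ^ 2 := by field_simp; ring
    _ < 1 * ε ^ 2 := by
        gcongr
        rw [div_lt_one (by positivity)]
        linarith
    _ = ε ^ 2 := one_mul _

variable {α : Type*} [PseudoMetricSpace α] [PseudoMetricSpace E] {f : ι → α → E} {g : α → E}
  {S : Set α} [l.NeBot] (hf : AsymptoticallyEquicontinuousOn f l S)
  (hg : ∀ t ∈ S, Tendsto (fun i => f i t) l (𝓝 (g t)))
include hf hg

theorem uniformContinuousOn_of_tendsto : UniformContinuousOn g S := by
  rw [Metric.uniformContinuousOn_iff]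
  intro ε hε
  obtain ⟨δ, hδ, hfδ⟩ := hf (ε / 2) (by positivity)
  refine ⟨δ, hδ, fun s hs t ht hst => lt_of_le_of_lt ?_ (half_lt_self hε)⟩
  refine le_of_tendsto ((hg s hs).dist (hg t ht)) ?_
  filter_upwards [hfδ] with i hi using (hi s hs t ht hst).le

theorem tendstoUniformlyOn (hS : IsCompact S) : TendstoUniformlyOn f g l S := by
  rw [Metric.tendstoUniformlyOn_iff]
  intro ε hε
  obtain ⟨δ, hδ, hfδ⟩ := hf (ε / 3) (by positivity)
  obtain ⟨δ', hδ', hgδ⟩ := Metric.uniformContinuousOn_iff.1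
    (hf.uniformContinuousOn_of_tendsto hg) (ε / 3) (by positivity)
  obtain ⟨F, hFS, hF, hcover⟩ := hS.finite_cover_balls (lt_min hδ hδ')
  have hnet : ∀ᶠ i in l, ∀ s ∈ F, dist (f i s) (g s) < ε / 3 :=
    (eventually_all_finite hF).2 fun s hs => Metric.tendsto_nhds.1 (hg s (hFS hs)) _ (by positivity)
  filter_upwards [hfδ, hnet] with i hfi hneti t ht
  obtain ⟨s, hs, hts⟩ := mem_iUnion₂.1 (hcover ht)
  have hts : dist t s < min δ δ' := hts
  calc dist (g t) (f i t) ≤ dist (g t) (g s) + dist (g s) (f i s) + dist (f i s) (f i t) :=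
        dist_triangle4 _ _ _ _
    _ < ε / 3 + ε / 3 + ε / 3 := by
        gcongr
        · exact hgδ t ht s (hFS hs) (hts.trans_le (min_le_right _ _))
        · rw [dist_comm]
          exact hneti s hs
        · rw [dist_comm]
          exact hfi t ht s (hFS hs) (hts.trans_le (min_le_left _ _))
    _ = ε := by ring

end AsymptoticallyEquicontinuousOn

end UniformConvergence

section StepFunctions

variable {E : Type*} {τ t : ℝ} {n j : ℕ}

/-- The step function with value `a k` on the interval `((k - 1) τ, k τ]`. -/
noncomputable def stepFun (τ : ℝ) (a : ℕ → E) (t : ℝ) : E := a ⌈t / τ⌉₊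

/-- The step function of backward difference quotients of `a`, that is, the derivative of the
piecewise affine interpolation of `a`. -/
noncomputable def stepSlope [AddCommGroup E] [Module ℝ E] (τ : ℝ) (a : ℕ → E) : ℝ → E :=
  stepFun τ fun k => τ⁻¹ • (a k - a (k - 1))

theorem ceil_div_le (hτ : 0 < τ) (ht : t ≤ n * τ) : ⌈t / τ⌉₊ ≤ n :=
  Nat.ceil_le.2 ((div_le_iff₀ hτ).2 ht)

theorem stepFun_eq (hτ : 0 < τ) (a : ℕ → E) (ht : t ∈ Ioc (j * τ) ((j + 1) * τ)) :
    stepFun τ a t = a (j + 1) := by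
  have hceil : ⌈t / τ⌉₊ = j + 1 := by
    rw [Nat.ceil_eq_iff j.succ_ne_zero, lt_div_iff₀ hτ, div_le_iff₀ hτ]
    simpa using ht
  rw [stepFun, hceil]

theorem exists_mem_Ioc_grid (hτ : 0 < τ) (ht : t ∈ Ioc 0 (n * τ)) :
    ∃ j < n, t ∈ Ioc (j * τ) ((j + 1) * τ) := by
  obtain ⟨j, hj⟩ := Nat.exists_eq_succ_of_ne_zero (Nat.ceil_pos.2 (div_pos ht.1 hτ)).ne'
  have hmem := (Nat.ceil_eq_iff j.succ_ne_zero).1 hj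
  rw [lt_div_iff₀ hτ, div_le_iff₀ hτ] at hmem
  exact ⟨j, Nat.lt_of_succ_le (hj.symm.trans_le (ceil_div_le hτ ht.2)), by simpa using hmem⟩

variable [NormedAddCommGroup E]

theorem stronglyMeasurable_stepFun (τ : ℝ) (a : ℕ → E) : StronglyMeasurable (stepFun τ a) :=
  (StronglyMeasurable.of_discrete (f := a)).comp_measurable
    (Nat.measurable_ceil.comp (measurable_id.div_const τ))

theorem memLp_stepFun (hτ : 0 < τ) (a : ℕ → E) (n : ℕ) (p : ℝ≥0∞) :
    MemLp (stepFun τ a) p (volume.restrict (Ioo 0 (n * τ))) := by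
  refine MemLp.of_bound (stronglyMeasurable_stepFun τ a).aestronglyMeasurable
    (∑ k ∈ Finset.range (n + 1), ‖a k‖) ?_
  filter_upwards [ae_restrict_mem measurableSet_Ioo] with t ht
  exact Finset.single_le_sum (f := fun k => ‖a k‖) (fun _ _ => norm_nonneg _)
    (Finset.mem_range.2 (Nat.lt_succ_of_le (ceil_div_le hτ ht.2.le)))

theorem intervalIntegrable_stepFun (hτ : 0 < τ) (a : ℕ → E) (ht : 0 ≤ t) :
    IntervalIntegrable (stepFun τ a) volume 0 t :=
  intervalIntegrable_of_integrableOn_Ioo ht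
    (((memLp_stepFun hτ a ⌈t / τ⌉₊ 1).integrable le_rfl).mono_measure
      (Measure.restrict_mono (Ioo_subset_Ioo_right ((div_le_iff₀ hτ).1 (Nat.le_ceil _))) le_rfl))

theorem sq_norm_stepFun_sub_le (hτ : 0 < τ) (v : ℕ → E) {S : ℝ} (hS0 : 0 ≤ S)
    (hS : ∑ k ∈ Finset.range n, ‖v (k + 1) - v k‖ ^ 2 ≤ S * τ) {s : ℝ} (hs : s ∈ Icc 0 (n * τ))
    (ht : t ∈ Icc 0 (n * τ)) : ‖stepFun τ v s - stepFun τ v t‖ ^ 2 ≤ S * (|s - t| + τ) := by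
  wlog hst : t ≤ s generalizing s t
  · rw [norm_sub_rev, abs_sub_comm]
    exact this ht hs (le_of_not_ge hst)
  have hmono : ⌈t / τ⌉₊ ≤ ⌈s / τ⌉₊ := Nat.ceil_le_ceil (div_le_div_of_nonneg_right hst hτ.le)
  have hgap : (⌈s / τ⌉₊ - ⌈t / τ⌉₊ : ℝ) * τ ≤ |s - t| + τ := by
    have hlower := (div_le_iff₀ hτ).1 (Nat.le_ceil (t / τ))
    have hupper : (⌈s / τ⌉₊ : ℝ) * τ ≤ s + τ :=
      calc _ ≤ (s / τ + 1) * τ := by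
            gcongr
            exact (Nat.ceil_lt_add_one (div_nonneg hs.1 hτ.le)).le
        _ = s + τ := by field_simp
    rw [abs_of_nonneg (sub_nonneg.2 hst)]
    linarith
  calc ‖stepFun τ v s - stepFun τ v t‖ ^ 2
      ≤ (⌈s / τ⌉₊ - ⌈t / τ⌉₊ : ℝ) * ∑ k ∈ Finset.range ⌈s / τ⌉₊, ‖v (k + 1) - v k‖ ^ 2 :=
        sq_norm_sub_le_mul_sum_sq v hmono
    _ ≤ (⌈s / τ⌉₊ - ⌈t / τ⌉₊ : ℝ) * (S * τ) := by
        refine mul_le_mul_of_nonneg_left (le_trans ?_ hS) (sub_nonneg.2 (by exact_mod_cast hmono))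
        exact Finset.sum_le_sum_of_subset_of_nonneg
          (Finset.range_mono (ceil_div_le hτ hs.2)) fun _ _ _ => by positivity
    _ = S * ((⌈s / τ⌉₊ - ⌈t / τ⌉₊ : ℝ) * τ) := by ring
    _ ≤ S * (|s - t| + τ) := by gcongr

variable [NormedSpace ℝ E]

theorem memLp_stepSlope (hτ : 0 < τ) (a : ℕ → E) (n : ℕ) (p : ℝ≥0∞) :
    MemLp (stepSlope τ a) p (volume.restrict (Ioo 0 (n * τ))) :=
  memLp_stepFun hτ _ n p

variable [CompleteSpace E]

theorem integral_stepFun_cell (hτ : 0 < τ) (a : ℕ → E) (ht : t ∈ Icc (j * τ) ((j + 1) * τ)) :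
    ∫ s in (j * τ)..t, stepFun τ a s = (t - j * τ) • a (j + 1) := by
  rw [← intervalIntegral.integral_const]
  refine intervalIntegral.integral_congr_ae (.of_forall fun s hs => ?_)
  rw [uIoc_of_le ht.1] at hs
  exact stepFun_eq hτ a ⟨hs.1, hs.2.trans ht.2⟩

theorem integral_stepFun (hτ : 0 < τ) (a : ℕ → E) (ht : t ∈ Icc (j * τ) ((j + 1) * τ)) :
    ∫ s in (0 : ℝ)..t, stepFun τ a s
      = τ • ∑ i ∈ Finset.range j, a (i + 1) + (t - j * τ) • a (j + 1) := by
  have hint : ∀ {r r' : ℝ}, 0 ≤ r → 0 ≤ r' → IntervalIntegrable (stepFun τ a) volume r r' :=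
    fun hr hr' => (intervalIntegrable_stepFun hτ a hr).symm.trans
      (intervalIntegrable_stepFun hτ a hr')
  have hj : 0 ≤ j * τ := by positivity
  have hgrid : ∫ s in (0 : ℝ)..(j * τ), stepFun τ a s = τ • ∑ i ∈ Finset.range j, a (i + 1) := by
    have hsum := intervalIntegral.sum_integral_adjacent_intervals (f := stepFun τ a)
      (a := fun i : ℕ => i * τ) (n := j) (μ := volume)
      fun i _ => hint (by positivity) (by positivity)
    rw [Nat.cast_zero, zero_mul] at hsum
    rw [← hsum, Finset.smul_sum]
    refine Finset.sum_congr rfl fun i _ => ?_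
    rw [Nat.cast_succ, integral_stepFun_cell hτ a ⟨by nlinarith, le_rfl⟩]
    congr 1
    ring
  rw [← intervalIntegral.integral_add_adjacent_intervals (hint le_rfl hj)
    (hint hj (hj.trans ht.1)), hgrid, integral_stepFun_cell hτ a ht]

theorem norm_integral_stepSlope_sub_le (hτ : 0 < τ) (v : ℕ → E) {S : ℝ}
    (hS : ∑ k ∈ Finset.range n, ‖v (k + 1) - v k‖ ^ 2 ≤ S) (ht : t ∈ Icc 0 (n * τ)) :
    ‖(∫ s in (0 : ℝ)..t, stepSlope τ v s) - (stepFun τ v t - v 0)‖ ≤ √S := by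
  rcases ht.1.eq_or_lt with rfl | hpos
  · simp [stepFun, Real.sqrt_nonneg]
  obtain ⟨j, hj, htj⟩ := exists_mem_Ioc_grid hτ ⟨hpos, ht.2⟩
  have hlast : (∫ s in (0 : ℝ)..t, stepSlope τ v s) - (stepFun τ v t - v 0)
      = ((t - j * τ) / τ - 1) • (v (j + 1) - v j) := by
    rw [stepSlope, integral_stepFun hτ _ (Ioc_subset_Icc_self htj), stepFun_eq hτ v htj]
    simp only [Nat.add_sub_cancel]
    rw [← Finset.smul_sum, Finset.sum_range_sub, smul_inv_smul₀ hτ.ne', smul_smul,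
      ← div_eq_mul_inv, sub_smul, one_smul]
    abel
  have hfrac : ‖(t - j * τ) / τ - 1‖ ≤ 1 := by
    have hlower : 0 ≤ (t - j * τ) / τ := div_nonneg (sub_nonneg.2 htj.1.le) hτ.le
    have hupper : (t - j * τ) / τ ≤ 1 := (div_le_one hτ).2 (by linarith [htj.2])
    exact abs_le.2 ⟨by linarith, by linarith⟩
  rw [hlast, norm_smul]
  refine (mul_le_of_le_one_left (norm_nonneg _) hfrac).trans (Real.le_sqrt_of_sq_le ?_)
  exact hS.trans' <| Finset.single_le_sum (f := fun j => ‖v (j + 1) - v j‖ ^ 2)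
    (fun _ _ => by positivity) (Finset.mem_range.2 hj)

omit [CompleteSpace E] in
theorem integral_sq_norm_stepSlope_le (hτ : 0 < τ) (v : ℕ → E) {S : ℝ}
    (hS : ∑ k ∈ Finset.range n, ‖v (k + 1) - v k‖ ^ 2 ≤ S * τ) :
    ∫ s in Ioo 0 (n * τ), ‖stepSlope τ v s‖ ^ 2 ≤ S := by
  have hint := integral_stepFun hτ (fun k => ‖τ⁻¹ • (v k - v (k - 1))‖ ^ 2) (j := n) (t := n * τ)
    ⟨le_rfl, by nlinarith⟩
  rw [sub_self, zero_smul, add_zero, intervalIntegral.integral_of_le (by positivity),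
    integral_Ioc_eq_integral_Ioo] at hint
  calc ∫ s in Ioo 0 (n * τ), ‖stepSlope τ v s‖ ^ 2
      = τ * (τ⁻¹ ^ 2 * ∑ k ∈ Finset.range n, ‖v (k + 1) - v k‖ ^ 2) := by
        simpa only [stepSlope, stepFun, Nat.add_sub_cancel, norm_smul, mul_pow, ← Finset.mul_sum,
          norm_inv, Real.norm_eq_abs, abs_of_pos hτ, smul_eq_mul] using hint
    _ ≤ τ * (τ⁻¹ ^ 2 * (S * τ)) := by gcongr
    _ = S := by field_simp

end StepFunctions

theorem intervalIntegrable_continuousLinearMap_comp {E F : Type*} [NormedAddCommGroup E]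
    [NormedSpace ℝ E] [NormedAddCommGroup F] [NormedSpace ℝ F] (A : E →L[ℝ] F) {f : ℝ → E}
    {a b : ℝ} (hf : IntervalIntegrable f volume a b) :
    IntervalIntegrable (fun s => A (f s)) volume a b :=
  ⟨A.integrable_comp hf.1, A.integrable_comp hf.2⟩

section StepFunctionLimits

variable {ι H : Type*} [NormedAddCommGroup H] [InnerProductSpace ℝ H] [CompleteSpace H] {T S : ℝ}
  {τ : ι → ℝ} {v : ι → ℕ → H}

theorem tendsto_integral_stepSlope {l : Filter ι} (hτ : ∀ i, 0 < τ i) (hτ₀ : Tendsto τ l (𝓝 0))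
    (hS : ∀ i, ∃ n : ℕ, n * τ i = T ∧
      ∑ k ∈ Finset.range n, ‖v i (k + 1) - v i k‖ ^ 2 ≤ S * τ i) {t : ℝ} (ht : t ∈ Icc 0 T) {y : H}
    (hy : Tendsto (fun i => stepFun (τ i) (v i) t - v i 0) l (𝓝 y)) :
    Tendsto (fun i => ∫ s in (0 : ℝ)..t, stepSlope (τ i) (v i) s) l (𝓝 y) := by
  have hsqrt : Tendsto (fun i => √(S * τ i)) l (𝓝 0) := by
    simpa only [mul_zero, Real.sqrt_zero] using (hτ₀.const_mul S).sqrt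
  have herror : Tendsto (fun i => (∫ s in (0 : ℝ)..t, stepSlope (τ i) (v i) s)
      - (stepFun (τ i) (v i) t - v i 0)) l (𝓝 0) := by
    refine squeeze_zero_norm (fun i => ?_) hsqrt
    obtain ⟨n, hn, hSn⟩ := hS i
    exact norm_integral_stepSlope_sub_le (hτ i) (v i) hSn (by rwa [hn])
  simpa only [sub_add_cancel, zero_add] using herror.add hy

theorem exists_memLp_integral_eq_of_tendsto_stepFun {U : Ultrafilter ι} (hτ : ∀ i, 0 < τ i)
    (hτ₀ : Tendsto τ U (𝓝 0))
    (hS : ∀ i, ∃ n : ℕ, n * τ i = T ∧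
      ∑ k ∈ Finset.range n, ‖v i (k + 1) - v i k‖ ^ 2 ≤ S * τ i) {g : ℝ → H}
    (hg : ∀ t ∈ Icc 0 T, Tendsto (fun i => stepFun (τ i) (v i) t - v i 0) U (𝓝 (g t))) :
    ∃ w : ℝ → H, MemLp w 2 (volume.restrict (Ioo 0 T)) ∧
      ∀ t ∈ Icc 0 T, ∫ s in (0 : ℝ)..t, w s = g t := by
  refine exists_memLp_integral_eq_of_tendsto (R := S) (fun i => ?_) (fun i => ?_)
    fun t ht => tendsto_integral_stepSlope hτ hτ₀ hS ht (hg t ht)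
  all_goals obtain ⟨n, rfl, hSn⟩ := hS i
  · exact memLp_stepSlope (hτ i) (v i) n 2
  · exact integral_sq_norm_stepSlope_le (hτ i) (v i) hSn

end StepFunctionLimits

section Drift

variable {H : Type*} [NormedAddCommGroup H] {T M : ℝ} {L : NNReal} {ρ : ℝ → ℝ} {B : ℝ → H → H}
  (hB : IsBoundedLipschitzDrift T L M ρ B)
include hB

namespace IsBoundedLipschitzDrift

theorem sq_norm_sub_le_abs {s t : ℝ} (hs : s ∈ Icc 0 T) (ht : t ∈ Icc 0 T) (u : H) :
    ‖B s u - B t u‖ ^ 2 ≤ (ρ T - ρ 0) * |s - t| := by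
  wlog hst : t ≤ s generalizing s t
  · rw [norm_sub_rev, abs_sub_comm]
    exact this ht hs (le_of_not_ge hst)
  have hT : 0 ≤ T := hs.1.trans hs.2
  have hρs := hB.monotoneOn hs (right_mem_Icc.2 hT) hs.2
  have hρt := hB.monotoneOn (left_mem_Icc.2 hT) ht ht.1
  rw [abs_of_nonneg (sub_nonneg.2 hst), mul_comm]
  exact (hB.sq_norm_sub_le t ht s hs hst u).trans
    (mul_le_mul_of_nonneg_left (by linarith) (sub_nonneg.2 hst))

theorem norm_sub_le {s t : ℝ} (hs : s ∈ Icc 0 T) (ht : t ∈ Icc 0 T) (u v : H) :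
    ‖B s u - B t v‖ ≤ L * ‖u - v‖ + √((ρ T - ρ 0) * |s - t|) := by
  rw [← sub_add_sub_cancel _ (B s v)]
  exact (norm_add_le _ _).trans (add_le_add ((hB.lipschitzWith s hs).norm_sub_le u v)
    (Real.le_sqrt_of_sq_le (hB.sq_norm_sub_le_abs hs ht v)))

theorem continuousOn {y : ℝ → H} (hy : ContinuousOn y (Icc 0 T)) :
    ContinuousOn (fun t => B t (y t)) (Icc 0 T) := by
  intro t ht
  have hbound : Tendsto (fun s => L * ‖y s - y t‖ + √((ρ T - ρ 0) * |s - t|)) (𝓝[Icc 0 T] t)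
      (𝓝 0) := by
    have hstate := (tendsto_iff_norm_sub_tendsto_zero.1 (hy t ht)).const_mul (L : ℝ)
    have htime : Tendsto (fun s => √((ρ T - ρ 0) * |s - t|)) (𝓝[Icc 0 T] t) (𝓝 0) := by
      have hcont : Continuous fun s => √((ρ T - ρ 0) * |s - t|) := by fun_prop
      simpa only [sub_self, abs_zero, mul_zero, Real.sqrt_zero] using
        (hcont.tendsto t).mono_left nhdsWithin_le_nhds
    simpa only [mul_zero, add_zero] using hstate.add htime
  rw [ContinuousWithinAt, tendsto_iff_norm_sub_tendsto_zero]
  refine squeeze_zero' (.of_forall fun _ => norm_nonneg _) ?_ hbound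
  filter_upwards [self_mem_nhdsWithin] with s hs using hB.norm_sub_le hs ht (y s) (y t)

end IsBoundedLipschitzDrift

end Drift

section EulerFamily

variable {ι W H : Type*} [NormedAddCommGroup W] [InnerProductSpace ℝ W] [CompleteSpace W]
  [NormedAddCommGroup H] [InnerProductSpace ℝ H] [CompleteSpace H] {J D : W →L[ℝ] H} {N : H → H}
  {B : ℝ → H → H} {K LN L : NNReal} {c T M R : ℝ} {ρ : ℝ → ℝ} {x₀ : W}

/-- The drift at the left endpoint of each step, as it enters the scheme. -/
noncomputable def laggedDrift (J : W →L[ℝ] H) (B : ℝ → H → H) (τ : ℝ) (x : ℕ → W) : ℝ → H :=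
  stepFun τ fun k => B ((k - 1 : ℕ) * τ) (J (x (k - 1)))

/-- A family of Euler schemes on `[0, T]` from the same initial value whose steps `τ i` divide `T`
and tend to zero, bounded as in `exists_bound_isEulerScheme`. -/
structure IsBoundedEulerFamily (J D : W →L[ℝ] H) (N : H → H) (B : ℝ → H → H) (T R : ℝ) (x₀ : W)
    (l : Filter ι) (τ : ι → ℝ) (x : ι → ℕ → W) : Prop where
  step_pos : ∀ i, 0 < τ i
  tendsto_step : Tendsto τ l (𝓝 0)
  exists_mul_eq : ∀ i, ∃ n : ℕ, n * τ i = T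
  isEulerScheme : ∀ i, IsEulerScheme J D N B (τ i) (x i)
  initial : ∀ i, x i 0 = x₀
  norm_le : ∀ i, ∀ n : ℕ, n * τ i ≤ T → ‖x i n‖ ≤ R
  sum_le : ∀ i, ∀ n : ℕ, n * τ i ≤ T →
    ∑ k ∈ Finset.range n, ‖J (x i (k + 1)) - J (x i k)‖ ^ 2 ≤ R * τ i

theorem exists_isBoundedEulerFamily (hK : ∀ x, ‖x‖ ^ 2 ≤ K * (‖J x‖ ^ 2 + ‖D x‖ ^ 2)) (hc : 0 < c)
    (hN : LipschitzWith LN N) (hmono : IsStronglyMonotone c N) (hT : 0 < T)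
    (hB : IsBoundedLipschitzDrift T L M ρ B) (x₀ : W) :
    ∃ R τ x, IsBoundedEulerFamily J D N B T R x₀ (hyperfilter ℕ : Filter ℕ) τ x := by
  obtain ⟨R, -, δ, hδ, hbound⟩ := exists_bound_isEulerScheme hK hc hmono hB x₀
  obtain ⟨n₀, hn₀⟩ := exists_nat_gt (T / δ)
  let n : ℕ → ℕ := fun m => n₀ + 1 + m
  have hn : ∀ m, (0 : ℝ) < n m := fun m => Nat.cast_pos.2 (by lia)
  let τ : ℕ → ℝ := fun m => T / n m
  have hτ : ∀ m, 0 < τ m := fun m => div_pos hT (hn m)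
  have hτδ : ∀ m, τ m ≤ δ := fun m => by
    have hle : (n₀ : ℝ) ≤ n m := Nat.cast_le.2 (by lia)
    rw [div_lt_iff₀ hδ] at hn₀
    exact (div_le_iff₀ (hn m)).2 (by nlinarith)
  choose x hx hx₀ using fun m => exists_isEulerScheme hK hc hN hmono B (hτ m) x₀
  refine ⟨R, τ, x, hτ, Tendsto.mono_left ?_ Nat.hyperfilter_le_atTop,
    fun m => ⟨n m, mul_div_cancel₀ T (hn m).ne'⟩, hx, hx₀,
    fun m k hk => (hbound _ (hτ m) (hτδ m) _ (hx m) (hx₀ m) k hk).1,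
    fun m k hk => (hbound _ (hτ m) (hτδ m) _ (hx m) (hx₀ m) k hk).2⟩
  have hn_atTop : Tendsto n atTop atTop :=
    tendsto_atTop_mono (fun m => Nat.le_add_left m _) tendsto_id
  exact tendsto_const_nhds.div_atTop (tendsto_natCast_atTop_atTop.comp hn_atTop)

section IntegratedEquation

variable {f k : ℝ → H} {g : ℝ → W} {a b : ℝ} (J D : W →L[ℝ] H)
  (hf : IntervalIntegrable f volume a b) (hg : IntervalIntegrable g volume a b)
  (hk : IntervalIntegrable k volume a b)
include hf hg hk

theorem intervalIntegrable_adjoint_add :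
    IntervalIntegrable (fun s => J.adjoint (f s) + D.adjoint (D (g s) + k s)) volume a b :=
  (intervalIntegrable_continuousLinearMap_comp _ hf).add
    (intervalIntegrable_continuousLinearMap_comp _
      ((intervalIntegrable_continuousLinearMap_comp D hg).add hk))

theorem integral_adjoint_add :
    ∫ s in a..b, (J.adjoint (f s) + D.adjoint (D (g s) + k s))
      = J.adjoint (∫ s in a..b, f s)
        + D.adjoint (D (∫ s in a..b, g s) + ∫ s in a..b, k s) := by
  have hDg := intervalIntegrable_continuousLinearMap_comp D hg
  rw [intervalIntegral.integral_add (intervalIntegrable_continuousLinearMap_comp _ hf)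
      (intervalIntegrable_continuousLinearMap_comp _ (hDg.add hk)),
    ContinuousLinearMap.intervalIntegral_comp_comm _ hf,
    ContinuousLinearMap.intervalIntegral_comp_comm _ (hDg.add hk),
    intervalIntegral.integral_add hDg hk, ContinuousLinearMap.intervalIntegral_comp_comm _ hg]

end IntegratedEquation

/-- A solution of `d/dt N(J X) + D†(D X + B(t, J X)) = 0`, `J (X 0) = J x₀` on `[0, T]`. The
derivatives of `J X` and `N(J X)` are encoded by the integrals of their densities, and the equation
in the dual of `W` by adjoints. -/
structure IsEvolutionSolution (J D : W →L[ℝ] H) (N : H → H) (B : ℝ → H → H) (T : ℝ) (x₀ : W)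
    (X : ℝ → W) : Prop where
  exists_norm_le : ∃ R, ∀ t ∈ Icc 0 T, ‖X t‖ ≤ R
  aestronglyMeasurable : AEStronglyMeasurable X (volume.restrict (Ioo 0 T))
  exists_state_eq : ∃ w : ℝ → H, MemLp w 2 (volume.restrict (Ioo 0 T)) ∧
    ∀ t ∈ Icc 0 T, J (X t) = J x₀ + ∫ s in (0 : ℝ)..t, w s
  exists_momentum_eq : ∃ z : ℝ → H, MemLp z 2 (volume.restrict (Ioo 0 T)) ∧
    (∀ t ∈ Icc 0 T, N (J (X t)) = N (J x₀) + ∫ s in (0 : ℝ)..t, z s) ∧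
    ∀ᵐ t ∂volume.restrict (Ioo 0 T), J.adjoint (z t) + D.adjoint (D (X t) + B t (J (X t))) = 0

namespace IsBoundedEulerFamily

variable {τ : ι → ℝ} {x : ι → ℕ → W}

section Filter

variable {l : Filter ι} (h : IsBoundedEulerFamily J D N B T R x₀ l τ x)
include h

theorem norm_stepFun_le (i : ι) {t : ℝ} (ht : t ≤ T) : ‖stepFun (τ i) (x i) t‖ ≤ R := by
  obtain ⟨n, rfl⟩ := h.exists_mul_eq i
  exact h.norm_le i _ (mul_le_mul_of_nonneg_right
    (Nat.cast_le.2 (ceil_div_le (h.step_pos i) ht)) (h.step_pos i).le)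

theorem exists_grid (i : ι) {t : ℝ} (ht : t ∈ Ioc 0 T) :
    ∃ j : ℕ, t ∈ Ioc (j * τ i) ((j + 1) * τ i) ∧ (j + 1 : ℕ) * τ i ≤ T := by
  obtain ⟨n, rfl⟩ := h.exists_mul_eq i
  obtain ⟨j, hj, htj⟩ := exists_mem_Ioc_grid (h.step_pos i) ht
  exact ⟨j, htj, mul_le_mul_of_nonneg_right (Nat.cast_le.2 hj) (h.step_pos i).le⟩

theorem asymptoticallyEquicontinuousOn [l.NeBot] :
    AsymptoticallyEquicontinuousOn (fun i => stepFun (τ i) fun k => J (x i k)) l (Icc 0 T) := by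
  rcases lt_or_ge T 0 with hT | hT
  · simp [AsymptoticallyEquicontinuousOn, Icc_eq_empty_of_lt hT, exists_gt]
  obtain ⟨i₀⟩ := l.nonempty_of_neBot
  have hR : 0 ≤ R := (norm_nonneg _).trans (h.norm_stepFun_le i₀ hT)
  refine .of_sq_norm_sub_le hR h.tendsto_step fun i s hs t ht => ?_
  obtain ⟨n, hn⟩ := h.exists_mul_eq i
  rw [← hn] at hs ht
  exact sq_norm_stepFun_sub_le (h.step_pos i) (fun k => J (x i k)) hR (h.sum_le i n hn.le) hs ht

theorem adjoint_stepSlope_add (i : ι) {t : ℝ} (ht : t ∈ Ioc 0 T) :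
    J.adjoint (stepSlope (τ i) (fun k => N (J (x i k))) t)
      + D.adjoint (D (stepFun (τ i) (x i) t) + laggedDrift J B (τ i) (x i) t) = 0 := by
  obtain ⟨j, htj, -⟩ := h.exists_grid i ht
  have hτ := h.step_pos i
  have hstep := congrArg ((τ i)⁻¹ • ·) (h.isEulerScheme i j)
  simp only [smul_add, smul_zero, inv_smul_smul₀ hτ.ne'] at hstep
  simpa only [stepSlope, laggedDrift, stepFun_eq hτ _ htj, Nat.add_sub_cancel, map_smul, smul_add,
    map_add] using hstep

theorem norm_laggedDrift_sub_le (hB : IsBoundedLipschitzDrift T L M ρ B) (i : ι) {t : ℝ}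
    (ht : t ∈ Ioc 0 T) (y : H) :
    ‖laggedDrift J B (τ i) (x i) t - B t y‖
      ≤ L * (√(R * τ i) + ‖J (stepFun (τ i) (x i) t) - y‖) + √((ρ T - ρ 0) * τ i) := by
  obtain ⟨j, htj, hjT⟩ := h.exists_grid i ht
  have hτ := h.step_pos i
  have hj : j * τ i ∈ Icc 0 T := ⟨by positivity, htj.1.le.trans ht.2⟩
  have hincrement : ‖J (x i (j + 1)) - J (x i j)‖ ≤ √(R * τ i) :=
    Real.le_sqrt_of_sq_le <| (h.sum_le i _ hjT).trans' <|
      Finset.single_le_sum (f := fun k => ‖J (x i (k + 1)) - J (x i k)‖ ^ 2)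
        (fun _ _ => by positivity) (Finset.self_mem_range_succ j)
  have hgap : |j * τ i - t| ≤ τ i := by
    rw [abs_sub_comm, abs_of_pos (sub_pos.2 htj.1)]
    linarith [htj.2]
  have hρ : 0 ≤ ρ T - ρ 0 :=
    have hT : 0 ≤ T := ht.1.le.trans ht.2
    sub_nonneg.2 (hB.monotoneOn (left_mem_Icc.2 hT) (right_mem_Icc.2 hT) hT)
  simp only [laggedDrift, stepFun_eq hτ _ htj, Nat.add_sub_cancel]
  refine (hB.norm_sub_le hj (Ioc_subset_Icc_self ht) _ y).trans ?_
  gcongr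
  calc ‖J (x i j) - y‖ ≤ ‖J (x i j) - J (x i (j + 1))‖ + ‖J (x i (j + 1)) - y‖ :=
        norm_sub_le_norm_sub_add_norm_sub _ _ _
    _ ≤ _ := by
        rw [norm_sub_rev]
        gcongr

theorem tendstoUniformlyOn_laggedDrift (hB : IsBoundedLipschitzDrift T L M ρ B) {y : ℝ → H}
    (hy : TendstoUniformlyOn (fun i => stepFun (τ i) fun k => J (x i k)) y l (Icc 0 T)) :
    TendstoUniformlyOn (fun i => laggedDrift J B (τ i) (x i)) (fun t => B t (y t)) l
      (Ioc 0 T) := by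
  have hvanish : Tendsto (fun i => L * √(R * τ i) + √((ρ T - ρ 0) * τ i)) l (𝓝 0) := by
    have hsqrt : ∀ A : ℝ, Tendsto (fun i => √(A * τ i)) l (𝓝 0) := fun A => by
      simpa only [mul_zero, Real.sqrt_zero] using (h.tendsto_step.const_mul A).sqrt
    simpa only [mul_zero, add_zero] using ((hsqrt R).const_mul (L : ℝ)).add (hsqrt (ρ T - ρ 0))
  rw [Metric.tendstoUniformlyOn_iff] at hy ⊢
  intro ε hε
  filter_upwards [hy (ε / (2 * (L + 1))) (by positivity),
    hvanish.eventually (gt_mem_nhds (half_pos hε))] with i hyi hi t ht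
  have hstate : L * ‖J (stepFun (τ i) (x i) t) - y t‖ ≤ ε / 2 :=
    calc L * ‖J (stepFun (τ i) (x i) t) - y t‖ ≤ (L + 1) * (ε / (2 * (L + 1))) := by
          have := hyi t (Ioc_subset_Icc_self ht)
          rw [dist_comm, dist_eq_norm] at this
          gcongr
          · linarith
          · exact this.le
      _ = ε / 2 := by field_simp
  rw [dist_comm, dist_eq_norm]
  linarith [h.norm_laggedDrift_sub_le hB i ht (y t)]

end Filter

section Limit

variable {U : Ultrafilter ι} (h : IsBoundedEulerFamily J D N B T R x₀ U τ x)
include h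

theorem exists_limit : ∃ X : ℝ → W, ∀ t ∈ Icc 0 T, ‖X t‖ ≤ R ∧
    TendstoWeakly U (fun i => stepFun (τ i) (x i) t) (X t) := by
  choose! X hX using fun t (ht : t ∈ Icc 0 T) => exists_tendstoWeakly (h.norm_stepFun_le · ht.2) U
  exact ⟨X, hX⟩

variable {X : ℝ → W} (hJ : IsCompactOperator J)
  (hX : ∀ t ∈ Icc 0 T, TendstoWeakly U (fun i => stepFun (τ i) (x i) t) (X t))
include hJ hX

theorem tendsto_state {t : ℝ} (ht : t ∈ Icc 0 T) :
    Tendsto (fun i => stepFun (τ i) (fun k => J (x i k)) t) U (𝓝 (J (X t))) :=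
  (hX t ht).tendsto_of_isCompactOperator hJ (h.norm_stepFun_le · ht.2)

theorem continuousOn_state : ContinuousOn (fun t => J (X t)) (Icc 0 T) :=
  (h.asymptoticallyEquicontinuousOn.uniformContinuousOn_of_tendsto
    fun _ => h.tendsto_state hJ hX).continuousOn

theorem tendstoUniformlyOn_state :
    TendstoUniformlyOn (fun i => stepFun (τ i) fun k => J (x i k)) (fun t => J (X t)) U
      (Icc 0 T) :=
  h.asymptoticallyEquicontinuousOn.tendstoUniformlyOn (fun _ => h.tendsto_state hJ hX) isCompact_Icc

theorem exists_memLp_state : ∃ w : ℝ → H, MemLp w 2 (volume.restrict (Ioo 0 T)) ∧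
    ∀ t ∈ Icc 0 T, J (X t) = J x₀ + ∫ s in (0 : ℝ)..t, w s := by
  obtain ⟨w, hw, hwX⟩ := exists_memLp_integral_eq_of_tendsto_stepFun
    (v := fun i k => J (x i k)) (g := fun t => J (X t) - J x₀) h.step_pos h.tendsto_step
    (fun i => (h.exists_mul_eq i).imp fun n hn => ⟨hn, h.sum_le i n hn.le⟩) fun t ht => by
      simpa only [h.initial] using (h.tendsto_state hJ hX ht).sub_const (J x₀)
  exact ⟨w, hw, fun t ht => by rw [hwX t ht, add_sub_cancel]⟩

theorem exists_memLp_momentum (hN : LipschitzWith LN N) :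
    ∃ z : ℝ → H, MemLp z 2 (volume.restrict (Ioo 0 T)) ∧ ∀ t ∈ Icc 0 T,
      N (J (X t)) = N (J x₀) + (∫ s in (0 : ℝ)..t, z s) ∧
      Tendsto (fun i => ∫ s in (0 : ℝ)..t, stepSlope (τ i) (fun k => N (J (x i k))) s) U
        (𝓝 (∫ s in (0 : ℝ)..t, z s)) := by
  have hsum : ∀ i, ∃ n : ℕ, n * τ i = T ∧
      ∑ k ∈ Finset.range n, ‖N (J (x i (k + 1))) - N (J (x i k))‖ ^ 2 ≤ LN ^ 2 * R * τ i :=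
    fun i => (h.exists_mul_eq i).imp fun n hn => ⟨hn, by
      calc ∑ k ∈ Finset.range n, ‖N (J (x i (k + 1))) - N (J (x i k))‖ ^ 2
          ≤ ∑ k ∈ Finset.range n, LN ^ 2 * ‖J (x i (k + 1)) - J (x i k)‖ ^ 2 := by
            gcongr with k
            rw [← mul_pow]
            gcongr
            exact hN.norm_sub_le _ _
        _ ≤ LN ^ 2 * R * τ i := by
            rw [← Finset.mul_sum, mul_assoc]
            gcongr
            exact h.sum_le i n hn.le⟩
  have hlim : ∀ t ∈ Icc 0 T, Tendsto
      (fun i => stepFun (τ i) (fun k => N (J (x i k))) t - N (J (x i 0))) U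
      (𝓝 (N (J (X t)) - N (J x₀))) := fun t ht => by
    simp only [h.initial]
    exact ((hN.continuous.tendsto _).comp (h.tendsto_state hJ hX ht)).sub_const (N (J x₀))
  obtain ⟨z, hz, hzX⟩ :=
    exists_memLp_integral_eq_of_tendsto_stepFun (v := fun i k => N (J (x i k)))
      h.step_pos h.tendsto_step hsum hlim
  refine ⟨z, hz, fun t ht => ?_⟩
  rw [hzX t ht]
  exact ⟨(add_sub_cancel _ _).symm,
    tendsto_integral_stepSlope (v := fun i k => N (J (x i k))) h.step_pos h.tendsto_step hsum ht
      (hlim t ht)⟩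

theorem tendsto_integral_laggedDrift (hB : IsBoundedLipschitzDrift T L M ρ B) {t : ℝ}
    (ht : t ∈ Icc 0 T) :
    Tendsto (fun i => ∫ s in (0 : ℝ)..t, laggedDrift J B (τ i) (x i) s) U
      (𝓝 (∫ s in (0 : ℝ)..t, B s (J (X s)))) := by
  refine tendsto_intervalIntegral_of_tendstoUniformlyOn ?_
    (fun i => intervalIntegrable_stepFun (h.step_pos i) _ ht.1)
    ((hB.continuousOn (h.continuousOn_state hJ hX)).mono ?_).intervalIntegrable
  · rw [uIoc_of_le ht.1]
    exact (h.tendstoUniformlyOn_laggedDrift hB (h.tendstoUniformlyOn_state hJ hX)).mono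
      (Ioc_subset_Ioc_right ht.2)
  · rw [uIcc_of_le ht.1]
    exact Icc_subset_Icc_right ht.2

theorem tendstoWeakly_integral {t : ℝ} (ht : t ∈ Icc 0 T) (hJi : Function.Injective J)
    (hXint : IntervalIntegrable X volume 0 t) :
    TendstoWeakly U (fun i => ∫ s in (0 : ℝ)..t, stepFun (τ i) (x i) s)
      (∫ s in (0 : ℝ)..t, X s) := by
  refine .of_injective hJi (R := R * |t - 0|) (fun i => ?_) (tendstoWeakly_of_tendsto ?_)
  · refine intervalIntegral.norm_integral_le_of_norm_le_const fun s hs => ?_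
    rw [uIoc_of_le ht.1] at hs
    exact h.norm_stepFun_le i (hs.2.trans ht.2)
  · have hint := fun i => intervalIntegrable_stepFun (h.step_pos i) (x i) ht.1
    simp only [← J.intervalIntegral_comp_comm (hint _), ← J.intervalIntegral_comp_comm hXint]
    refine tendsto_intervalIntegral_of_tendstoUniformlyOn ?_
      (fun i => intervalIntegrable_continuousLinearMap_comp J (hint i))
      (intervalIntegrable_continuousLinearMap_comp J hXint)
    rw [uIoc_of_le ht.1]
    exact (h.tendstoUniformlyOn_state hJ hX).mono
      (Ioc_subset_Icc_self.trans (Icc_subset_Icc_right ht.2))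

theorem adjoint_integral_add_eq_zero (hB : IsBoundedLipschitzDrift T L M ρ B) {t : ℝ}
    (ht : t ∈ Icc 0 T) (hJi : Function.Injective J) (hXint : IntervalIntegrable X volume 0 t)
    {y : H} (hy : Tendsto
      (fun i => ∫ s in (0 : ℝ)..t, stepSlope (τ i) (fun k => N (J (x i k))) s) U (𝓝 y)) :
    J.adjoint y + D.adjoint (D (∫ s in (0 : ℝ)..t, X s) + ∫ s in (0 : ℝ)..t, B s (J (X s)))
      = 0 := by
  have hlim := ((tendstoWeakly_of_tendsto hy).map J.adjoint).add
    ((((h.tendstoWeakly_integral hJ hX ht hJi hXint).map D).add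
      (tendstoWeakly_of_tendsto (h.tendsto_integral_laggedDrift hJ hX hB ht))).map D.adjoint)
  refine hlim.unique (tendstoWeakly_of_tendsto (tendsto_const_nhds.congr fun i => ?_))
  have hτ := h.step_pos i
  have hslope : IntervalIntegrable (stepSlope (τ i) fun k => N (J (x i k))) volume 0 t :=
    intervalIntegrable_stepFun hτ _ ht.1
  have hlag : IntervalIntegrable (laggedDrift J B (τ i) (x i)) volume 0 t :=
    intervalIntegrable_stepFun hτ _ ht.1
  rw [← integral_adjoint_add J D hslope (intervalIntegrable_stepFun hτ (x i) ht.1) hlag,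
    intervalIntegral.integral_of_le ht.1]
  exact (setIntegral_eq_zero_of_forall_eq_zero fun s hs =>
    h.adjoint_stepSlope_add i ⟨hs.1, hs.2.trans ht.2⟩).symm

theorem aestronglyMeasurable_limit [SecondCountableTopology W] (hJi : Function.Injective J) :
    AEStronglyMeasurable X (volume.restrict (Ioo 0 T)) := by
  borelize W
  borelize H
  exact ((J.continuous.measurableEmbedding hJi).aemeasurable_comp_iff.1
    (((h.continuousOn_state hJ hX).mono Ioo_subset_Icc_self).aemeasurable
      measurableSet_Ioo)).aestronglyMeasurable

theorem isEvolutionSolution [SecondCountableTopology W] (hJi : Function.Injective J)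
    (hN : LipschitzWith LN N) (hT : 0 ≤ T) (hB : IsBoundedLipschitzDrift T L M ρ B)
    (hR : ∀ t ∈ Icc 0 T, ‖X t‖ ≤ R) : IsEvolutionSolution J D N B T x₀ X := by
  obtain ⟨z, hz, hzX⟩ := h.exists_memLp_momentum hJ hX hN
  have hmeas := h.aestronglyMeasurable_limit hJ hX hJi
  refine ⟨⟨R, hR⟩, hmeas, h.exists_memLp_state hJ hX, z, hz, fun t ht => (hzX t ht).1, ?_⟩
  have hX_integrable : IntegrableOn X (Ioo 0 T) :=
    Integrable.of_bound hmeas R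
      ((ae_restrict_mem measurableSet_Ioo).mono fun s hs => hR s (Ioo_subset_Icc_self hs))
  have hz_integrable : IntegrableOn z (Ioo 0 T) := hz.integrable one_le_two
  have hXint : ∀ t ∈ Icc 0 T, IntervalIntegrable X volume 0 t := fun t ht =>
    intervalIntegrable_of_integrableOn_Ioo ht.1
      (hX_integrable.mono_set (Ioo_subset_Ioo_right ht.2))
  have hzint : ∀ t ∈ Icc 0 T, IntervalIntegrable z volume 0 t := fun t ht =>
    intervalIntegrable_of_integrableOn_Ioo ht.1
      (hz_integrable.mono_set (Ioo_subset_Ioo_right ht.2))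
  have hBint : ∀ t ∈ Icc 0 T, IntervalIntegrable (fun s => B s (J (X s))) volume 0 t :=
    fun t ht => ((hB.continuousOn (h.continuousOn_state hJ hX)).mono
      (by rw [uIcc_of_le ht.1]; exact Icc_subset_Icc_right ht.2)).intervalIntegrable
  have hTmem := right_mem_Icc.2 hT
  refine ae_eq_zero_of_forall_intervalIntegral_eq_zero hT
    ((intervalIntegrable_iff_integrableOn_Ioo_of_le hT).1 (intervalIntegrable_adjoint_add J D
      (hzint T hTmem) (hXint T hTmem) (hBint T hTmem))) fun t ht => ?_
  have ht := Ioo_subset_Icc_self ht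
  rw [integral_adjoint_add J D (hzint t ht) (hXint t ht) (hBint t ht)]
  exact h.adjoint_integral_add_eq_zero hJ hX hB ht hJi (hXint t ht) (hzX t ht).2

end Limit

end IsBoundedEulerFamily

theorem exists_isEvolutionSolution [SecondCountableTopology W] (hJ : IsCompactOperator J)
    (hJi : Function.Injective J) (hK : ∀ x, ‖x‖ ^ 2 ≤ K * (‖J x‖ ^ 2 + ‖D x‖ ^ 2))
    (hN : LipschitzWith LN N) (hc : 0 < c) (hmono : IsStronglyMonotone c N) (hT : 0 < T)
    (hB : IsBoundedLipschitzDrift T L M ρ B) (x₀ : W) :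
    ∃ X, IsEvolutionSolution J D N B T x₀ X := by
  obtain ⟨R, τ, x, hx⟩ := exists_isBoundedEulerFamily hK hc hN hmono hT hB x₀
  obtain ⟨X, hX⟩ := hx.exists_limit
  exact ⟨X, hx.isEvolutionSolution hJ (fun t ht => (hX t ht).2) hJi hN hT.le hB
    fun t ht => (hX t ht).1⟩

end EulerFamily

section UnitInterval

theorem sq_norm_integral_le {H : Type*} [NormedAddCommGroup H] [InnerProductSpace ℝ H]
    {w : ℝ → H} {s t : ℝ} (hst : s ≤ t) (hw : IntervalIntegrable w volume s t)
    (hw2 : IntervalIntegrable (fun r => ‖w r‖ ^ 2) volume s t) :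
    ‖∫ r in s..t, w r‖ ^ 2 ≤ (t - s) * ∫ r in s..t, ‖w r‖ ^ 2 := by
  rcases hst.eq_or_lt with rfl | hlt
  · simp
  have : 0 < t - s := sub_pos.2 hlt
  set I := ∫ r in s..t, ‖w r‖ with hI
  set m := I / (t - s) with hm
  have hIm : I = m * (t - s) := by rw [hm]; field_simp
  have hvariance : 0 ≤ ∫ r in s..t, (‖w r‖ ^ 2 - 2 * m * ‖w r‖ + m ^ 2) :=
    intervalIntegral.integral_nonneg hst fun r _ => by nlinarith [sq_nonneg (‖w r‖ - m)]
  rw [intervalIntegral.integral_add (hw2.sub (hw.norm.const_mul _)) (by simp),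
    intervalIntegral.integral_sub hw2 (hw.norm.const_mul _), intervalIntegral.integral_const_mul,
    intervalIntegral.integral_const, ← hI, smul_eq_mul] at hvariance
  calc ‖∫ r in s..t, w r‖ ^ 2 ≤ I ^ 2 := by
        gcongr
        exact intervalIntegral.norm_integral_le_integral_norm hst
    _ = (t - s) * (2 * m * I - (t - s) * m ^ 2) := by rw [hIm]; ring
    _ ≤ (t - s) * ∫ r in s..t, ‖w r‖ ^ 2 := by
        gcongr
        linarith

namespace L2Unit

theorem integrableOn (w : L2Unit) : IntegrableOn w (Ioo 0 1) :=
  (Lp.memLp w).integrable one_le_two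

theorem intervalIntegrable (w : L2Unit) {x y : ℝ} (hx : x ∈ Icc (0 : ℝ) 1)
    (hy : y ∈ Icc (0 : ℝ) 1) : IntervalIntegrable w volume x y :=
  (intervalIntegrable_of_integrableOn_Ioo zero_le_one (integrableOn w)).mono_set
    (by rw [uIcc_of_le zero_le_one]; exact uIcc_subset_Icc hx hy)

theorem intervalIntegral_congr {f g : ℝ → ℝ} (h : f =ᵐ[volume.restrict (Ioo 0 1)] g) {x y : ℝ}
    (hx : x ∈ Icc (0 : ℝ) 1) (hy : y ∈ Icc (0 : ℝ) 1) : ∫ s in x..y, f s = ∫ s in x..y, g s := by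
  rw [Filter.EventuallyEq, Measure.restrict_congr_set Ioo_ae_eq_Icc] at h
  exact intervalIntegral.integral_congr_ae_restrict
    (ae_restrict_of_ae_restrict_of_subset (uIoc_subset_uIcc.trans (uIcc_subset_Icc hx hy)) h)

theorem sq_abs_integral_le (w : L2Unit) {x y : ℝ} (hx : x ∈ Icc (0 : ℝ) 1)
    (hy : y ∈ Icc (0 : ℝ) 1) : |∫ s in x..y, w s| ^ 2 ≤ ‖w‖ ^ 2 * |y - x| := by
  wlog hxy : x ≤ y generalizing x y
  · rw [intervalIntegral.integral_symm, abs_neg, abs_sub_comm]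
    exact this hy hx (le_of_not_ge hxy)
  have hsq : IntegrableOn (fun s => ‖w s‖ ^ 2) (Ioo 0 1) :=
    (Lp.memLp w).integrable_norm_pow two_ne_zero
  have hnorm : ∫ s in Ioo (0 : ℝ) 1, ‖w s‖ ^ 2 = ‖w‖ ^ 2 := by
    rw [← sq_norm_toLp (Lp.memLp w), Lp.toLp_coeFn]
  have hsub : Ioo x y ⊆ Ioo 0 1 := Ioo_subset_Ioo hx.1 hy.2
  calc |∫ s in x..y, w s| ^ 2 ≤ (y - x) * ∫ s in x..y, ‖w s‖ ^ 2 :=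
        sq_norm_integral_le hxy (intervalIntegrable w hx hy)
          (intervalIntegrable_of_integrableOn_Ioo hxy (hsq.mono_set hsub))
    _ ≤ (y - x) * ‖w‖ ^ 2 := by
        rw [intervalIntegral.integral_of_le hxy, integral_Ioc_eq_integral_Ioo, ← hnorm]
        exact mul_le_mul_of_nonneg_left (setIntegral_mono_set hsq
          (.of_forall fun _ => sq_nonneg _) hsub.eventuallyLE) (sub_nonneg.2 hxy)
    _ = ‖w‖ ^ 2 * |y - x| := by rw [abs_of_nonneg (sub_nonneg.2 hxy), mul_comm]

theorem continuousOn_integral (w : L2Unit) :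
    ContinuousOn (fun x => ∫ s in (0 : ℝ)..x, w s) (Icc 0 1) := by
  rw [← uIcc_of_le (zero_le_one (α := ℝ))]
  exact (absolutelyContinuousOnInterval_integral (intervalIntegrable w (by simp) (by simp)))
    |>.continuousOn

theorem norm_le_of_ae_bound {u : L2Unit} {C : ℝ} (hC : 0 ≤ C)
    (h : ∀ᵐ x ∂volume.restrict (Ioo (0 : ℝ) 1), |u x| ≤ C) : ‖u‖ ≤ C := by
  have hone : measureUnivNNReal (volume.restrict (Ioo (0 : ℝ) 1)) = 1 := by
    simp [measureUnivNNReal]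
  simpa [hone] using Lp.norm_le_of_ae_bound (f := u) hC h

theorem inner_eq_integral (u w : L2Unit) : inner ℝ u w = ∫ x in (0 : ℝ)..1, u x * w x := by
  rw [L2.inner_def, intervalIntegral.integral_of_le zero_le_one, integral_Ioc_eq_integral_Ioo]
  simp only [RCLike.inner_apply, conj_trivial, mul_comm]

end L2Unit

instance : SecondCountableTopology L2Unit := by
  have : Fact ((2 : ℝ≥0∞) ≠ ⊤) := ⟨ENNReal.ofNat_ne_top⟩
  exact Lp.SecondCountableTopology

/-- The constant function `1` on `(0,1)`. -/
noncomputable def oneL2 : L2Unit := Lp.const 2 _ (1 : ℝ)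

theorem oneL2_ae : oneL2 =ᵐ[volume.restrict (Ioo 0 1)] fun _ => 1 :=
  Lp.coeFn_const 2 _ (1 : ℝ)

theorem inner_oneL2 (w : L2Unit) : inner ℝ w oneL2 = ∫ x in (0 : ℝ)..1, w x := by
  rw [L2Unit.inner_eq_integral]
  exact L2Unit.intervalIntegral_congr (oneL2_ae.mono fun x hx => by rw [hx, mul_one])
    (by simp) (by simp)

theorem norm_oneL2 : ‖oneL2‖ = 1 := by
  refine (pow_eq_one_iff_of_nonneg (norm_nonneg _) two_ne_zero).1 ?_
  rw [← real_inner_self_eq_norm_sq, inner_oneL2,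
    L2Unit.intervalIntegral_congr oneL2_ae (by simp) (by simp)]
  simp

end UnitInterval

section Volterra

theorem L2Unit.memLp_integral (w : L2Unit) :
    MemLp (fun x => ∫ s in (0 : ℝ)..x, w s) 2 (volume.restrict (Ioo 0 1)) := by
  obtain ⟨C, hC⟩ := isCompact_Icc.exists_bound_of_continuousOn (continuousOn_integral w)
  refine .of_bound (((continuousOn_integral w).mono Ioo_subset_Icc_self).aestronglyMeasurable
    measurableSet_Ioo) C ?_
  filter_upwards [ae_restrict_mem measurableSet_Ioo] with x hx using hC x (Ioo_subset_Icc_self hx)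

/-- The Volterra operator `(V w)(x) = ∫₀ˣ w` on `L²(0,1)`. It inverts `∂ₓ` on functions vanishing
at `0`, hence on fluxes satisfying the boundary conditions. -/
noncomputable def volterra : L2Unit →L[ℝ] L2Unit :=
  LinearMap.mkContinuous
    { toFun := fun w => (L2Unit.memLp_integral w).toLp _
      map_add' := fun u w => by
        rw [← MemLp.toLp_add, MemLp.toLp_eq_toLp_iff]
        filter_upwards [ae_restrict_mem measurableSet_Ioo] with x hx
        have hx := Ioo_subset_Icc_self hx
        rw [Pi.add_apply, ← intervalIntegral.integral_add
          (L2Unit.intervalIntegrable u (by simp) hx) (L2Unit.intervalIntegrable w (by simp) hx)]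
        exact L2Unit.intervalIntegral_congr (Lp.coeFn_add u w) (by simp) hx
      map_smul' := fun c u => by
        rw [← MemLp.toLp_const_smul, MemLp.toLp_eq_toLp_iff]
        filter_upwards [ae_restrict_mem measurableSet_Ioo] with x hx
        have hx := Ioo_subset_Icc_self hx
        rw [Pi.smul_apply, RingHom.id_apply, ← intervalIntegral.integral_smul]
        exact L2Unit.intervalIntegral_congr (Lp.coeFn_smul c u) (by simp) hx } 1 fun w => by
    rw [one_mul]
    refine L2Unit.norm_le_of_ae_bound (norm_nonneg w) ?_
    filter_upwards [(L2Unit.memLp_integral w).coeFn_toLp, ae_restrict_mem measurableSet_Ioo]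
      with x hx hmem
    refine (congrArg abs hx).trans_le (le_of_sq_le_sq ?_ (norm_nonneg w))
    refine (L2Unit.sq_abs_integral_le w (by simp) (Ioo_subset_Icc_self hmem)).trans
      (mul_le_of_le_one_right (sq_nonneg _) ?_)
    rw [sub_zero, abs_of_pos hmem.1]
    exact hmem.2.le

theorem volterra_ae (w : L2Unit) :
    volterra w =ᵐ[volume.restrict (Ioo 0 1)] fun x => ∫ s in (0 : ℝ)..x, w s :=
  (L2Unit.memLp_integral w).coeFn_toLp

theorem smul_oneL2_add_volterra_ae (c : ℝ) (w : L2Unit) :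
    (c • oneL2 + volterra w : L2Unit) =ᵐ[volume.restrict (Ioo 0 1)]
      fun x => c + ∫ s in (0 : ℝ)..x, w s := by
  filter_upwards [Lp.coeFn_add (c • oneL2) (volterra w), Lp.coeFn_smul c oneL2, oneL2_ae,
    volterra_ae w] with x hadd hsmul hone hvolterra
  rw [hadd, Pi.add_apply, hsmul, Pi.smul_apply, hone, hvolterra, smul_eq_mul, mul_one]

theorem norm_volterra_le (w : L2Unit) : ‖volterra w‖ ≤ ‖w‖ :=
  (LinearMap.mkContinuous_norm_le _ zero_le_one _ |> volterra.le_of_opNorm_le) w |>.trans_eq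
    (one_mul _)

theorem inner_volterra (w z : L2Unit) :
    inner ℝ (volterra w) z = ∫ x in (0 : ℝ)..1, (∫ s in (0 : ℝ)..x, w s) * z x := by
  rw [L2Unit.inner_eq_integral]
  exact L2Unit.intervalIntegral_congr ((volterra_ae w).mono fun x hx => by rw [hx])
    (by simp) (by simp)

-- Integration by parts: `V + V† = 1 ⊗ 1`, so `V` is antisymmetric on functions of mean zero.
theorem inner_volterra_add (w z : L2Unit) :
    inner ℝ (volterra w) z + inner ℝ w (volterra z) = inner ℝ w oneL2 * inner ℝ z oneL2 := by
  have hw := L2Unit.intervalIntegrable w (x := 0) (y := 1) (by simp) (by simp)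
  have hz := L2Unit.intervalIntegrable z (x := 0) (y := 1) (by simp) (by simp)
  have hwac := absolutelyContinuousOnInterval_integral hw
  have hzac := absolutelyContinuousOnInterval_integral hz
  have hwz := hz.continuousOn_mul hwac.continuousOn
  have hzw := hw.continuousOn_mul hzac.continuousOn
  rw [real_inner_comm _ w, inner_volterra, inner_volterra, inner_oneL2, inner_oneL2,
    ← intervalIntegral.integral_add hwz hzw,
    integral_eq_sub_of_absolutelyContinuous (hwac.fun_mul hzac) ?_ (hwz.add hzw)]
  · simp
  · filter_upwards [hw.ae_hasDerivAt_integral, hz.ae_hasDerivAt_integral] with x hwx hzx hx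
    exact ((hwx hx 0 (by simp)).mul (hzx hx 0 (by simp))).congr_deriv (by ring)

theorem isCompactOperator_volterra : IsCompactOperator volterra := by
  refine isCompactOperator_of_tendstoWeakly fun U y hUy => ?_
  have hHolder : ∀ w : L2Unit, ‖w‖ ≤ 1 → ∀ s ∈ Icc (0 : ℝ) 1, ∀ t ∈ Icc (0 : ℝ) 1,
      ‖(∫ r in (0 : ℝ)..s, w r) - ∫ r in (0 : ℝ)..t, w r‖ ^ 2 ≤ 1 * (|s - t| + 0) := by
    intro w hw s hs t ht
    rw [intervalIntegral.integral_interval_sub_left (L2Unit.intervalIntegrable w (by simp) hs)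
      (L2Unit.intervalIntegrable w (by simp) ht), add_zero]
    refine (L2Unit.sq_abs_integral_le w ht hs).trans ?_
    gcongr
    exact pow_le_one₀ (norm_nonneg w) hw
  have hpointwise : ∀ t ∈ Icc (0 : ℝ) 1, Tendsto
      (fun x : Metric.closedBall (0 : L2Unit) 1 => ∫ r in (0 : ℝ)..t, (x : L2Unit) r) U
      (𝓝 (∫ r in (0 : ℝ)..t, y r)) := fun t ht => by
    have hlim := hUy (indicatorConstLp 2 measurableSet_Ioo (measure_ne_top _ (Ioo 0 t)) 1)
    simpa only [inner_indicatorConstLp_Ioo _ ht, RCLike.inner_apply, conj_trivial, one_mul]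
      using hlim
  have huniform := (AsymptoticallyEquicontinuousOn.of_sq_norm_sub_le zero_le_one
    tendsto_const_nhds fun x : Metric.closedBall (0 : L2Unit) 1 =>
      hHolder x (mem_closedBall_zero_iff.1 x.2)).tendstoUniformlyOn hpointwise isCompact_Icc
  rw [Metric.tendsto_nhds]
  intro ε hε
  filter_upwards [Metric.tendstoUniformlyOn_iff.1 huniform (ε / 2) (half_pos hε)] with x hx
  rw [dist_comm, dist_eq_norm, ← map_sub]
  refine (L2Unit.norm_le_of_ae_bound (half_pos hε).le ?_).trans_lt (half_lt_self hε)
  filter_upwards [Lp.coeFn_sub (volterra y) (volterra x), volterra_ae x, volterra_ae y,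
    ae_restrict_mem measurableSet_Ioo] with t hsub hxt hyt ht
  rw [map_sub, hsub, Pi.sub_apply, hxt, hyt]
  exact (hx t (Ioo_subset_Icc_self ht)).le

theorem isDx_iff {u w : L2Unit} : IsDx u w ↔ ∃ c : ℝ, u = c • oneL2 + volterra w := by
  constructor
  · intro h
    obtain ⟨c, hc⟩ := h.exists_eq_integral zero_lt_one (L2Unit.integrableOn w)
    exact ⟨c, Lp.ext (hc.trans (smul_oneL2_add_volterra_ae c w).symm)⟩
  · rintro ⟨c, rfl⟩
    exact (isWeakDeriv_integral zero_le_one (L2Unit.integrableOn w) c).congr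
      (smul_oneL2_add_volterra_ae c w).symm .rfl

namespace IsDx

variable {u u' w w' : L2Unit}

theorem unique (h : IsDx u w) (h' : IsDx u w') : w = w' :=
  Lp.ext (IsWeakDeriv.unique h h')

theorem sub (h : IsDx u w) (h' : IsDx u' w') : IsDx (u - u') (w - w') := by
  obtain ⟨c, rfl⟩ := isDx_iff.1 h
  obtain ⟨c', rfl⟩ := isDx_iff.1 h'
  exact isDx_iff.2 ⟨c - c', by rw [sub_smul, map_sub]; abel⟩

theorem exists_absolutelyContinuous (h : IsDx u w) :
    ∃ F : ℝ → ℝ, AbsolutelyContinuousOnInterval F 0 1 ∧ u =ᵐ[volume.restrict (Ioo 0 1)] F ∧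
      ∀ᵐ x ∂volume.restrict (Ioo (0 : ℝ) 1), HasDerivAt F (w x) x := by
  obtain ⟨c, hc⟩ := h.exists_eq_integral zero_lt_one (L2Unit.integrableOn w)
  have hw := L2Unit.intervalIntegrable w (x := 0) (y := 1) (by simp) (by simp)
  refine ⟨_, absolutelyContinuousOnInterval_of_dist_le (K := 1)
    (absolutelyContinuousOnInterval_integral hw) fun x _ y _ => ?_, hc, ?_⟩
  · rw [dist_add_left, one_mul]
  · filter_upwards [ae_restrict_of_ae hw.ae_hasDerivAt_integral,
      ae_restrict_mem measurableSet_Ioo] with x hx hmem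
    refine (hx ?_ 0 (by simp)).const_add c
    rw [uIcc_of_le zero_le_one]
    exact Ioo_subset_Icc_self hmem

theorem of_absolutelyContinuous {F : ℝ → ℝ} (hF : AbsolutelyContinuousOnInterval F 0 1)
    (hu : u =ᵐ[volume.restrict (Ioo 0 1)] F)
    (hw : w =ᵐ[volume.restrict (Ioo 0 1)] deriv F) : IsDx u w := by
  refine (isWeakDeriv_integral zero_le_one (L2Unit.integrableOn w) (F 0)).congr ?_ .rfl
  filter_upwards [hu, ae_restrict_mem measurableSet_Ioo] with x hx hmem
  have hmem := Ioo_subset_Icc_self hmem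
  have hsub : uIcc 0 x ⊆ uIcc 0 1 := by
    rw [uIcc_of_le hmem.1, uIcc_of_le zero_le_one]
    exact Icc_subset_Icc_right hmem.2
  rw [L2Unit.intervalIntegral_congr hw (by simp) hmem, (hF.mono hsub).integral_deriv_eq_sub, hx]
  ring

theorem eq_volterra_of_hasBoundaryValues (h : IsDx u w) (hu : HasBoundaryValues u 0 0) :
    inner ℝ w oneL2 = 0 ∧ u = volterra w := by
  obtain ⟨g, hg, hug, hg₀, hg₁⟩ := hu
  have hgw {x : ℝ} (hx : x ∈ Icc (0 : ℝ) 1) : g x = ∫ s in (0 : ℝ)..x, w s := by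
    simpa only [hg₀, zero_add] using (IsWeakDeriv.congr h hug .rfl).eq_add_integral_of_continuousOn
      zero_lt_one (L2Unit.integrableOn w) hg hx
  refine ⟨?_, Lp.ext ?_⟩
  · rw [inner_oneL2, ← hgw (right_mem_Icc.2 zero_le_one), hg₁]
  · filter_upwards [hug, volterra_ae w, ae_restrict_mem measurableSet_Ioo] with x hx hwx hmem
    rw [hx, hwx, hgw (Ioo_subset_Icc_self hmem)]

end IsDx

theorem hasBoundaryValues_volterra {z : L2Unit} (hz : inner ℝ z oneL2 = 0) :
    HasBoundaryValues (volterra z) 0 0 :=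
  ⟨_, L2Unit.continuousOn_integral z, volterra_ae z, by simp, by rw [← inner_oneL2, hz]⟩

end Volterra

section H1Unit

/-- The Hilbert space `H¹(0,1)`, encoded by the value at `0` and the weak derivative. -/
abbrev H1Unit : Type := WithLp 2 (ℝ × L2Unit)

namespace H1Unit

/-- The derivative `H¹(0,1) → L²(0,1)`. -/
noncomputable def dx : H1Unit →L[ℝ] L2Unit := WithLp.sndL 2 ℝ ℝ L2Unit

/-- The embedding `H¹(0,1) → L²(0,1)`. -/
noncomputable def toL2 : H1Unit →L[ℝ] L2Unit :=
  (WithLp.fstL 2 ℝ ℝ L2Unit).smulRight oneL2 + volterra ∘L dx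

theorem toL2_apply (x : H1Unit) : toL2 x = x.fst • oneL2 + volterra x.snd := rfl

theorem dx_apply (x : H1Unit) : dx x = x.snd := rfl

theorem isDx (x : H1Unit) : IsDx (toL2 x) (dx x) := isDx_iff.2 ⟨x.fst, rfl⟩

theorem exists_of_isDx {u w : L2Unit} (h : IsDx u w) : ∃ x : H1Unit, toL2 x = u ∧ dx x = w := by
  obtain ⟨c, rfl⟩ := isDx_iff.1 h
  exact ⟨WithLp.toLp 2 (c, w), rfl, rfl⟩

theorem sq_norm_le (x : H1Unit) : ‖x‖ ^ 2 ≤ 3 * (‖toL2 x‖ ^ 2 + ‖dx x‖ ^ 2) := by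
  have hfst : ‖x.fst‖ ≤ ‖toL2 x‖ + ‖x.snd‖ := calc
    ‖x.fst‖ = ‖toL2 x - volterra x.snd‖ := by
      rw [toL2_apply, add_sub_cancel_right, norm_smul, norm_oneL2, mul_one]
    _ ≤ ‖toL2 x‖ + ‖x.snd‖ := (norm_sub_le _ _).trans (by gcongr; exact norm_volterra_le _)
  rw [WithLp.prod_norm_sq_eq_of_L2, dx_apply]
  nlinarith [norm_nonneg x.fst, sq_nonneg (‖toL2 x‖ - ‖x.snd‖), sq_nonneg ‖toL2 x‖]

theorem toL2_injective : Function.Injective toL2 := by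
  refine (injective_iff_map_eq_zero toL2).2 fun x hx => ?_
  have hdx : dx x = 0 := (isDx x).unique (by rw [hx]; simpa using (isDx 0))
  have hnorm := sq_norm_le x
  rw [hx, hdx, norm_zero, zero_pow two_ne_zero, add_zero, mul_zero] at hnorm
  exact norm_eq_zero.1 (pow_eq_zero_iff two_ne_zero |>.1 (le_antisymm hnorm (sq_nonneg _)))

theorem isCompactOperator_toL2 : IsCompactOperator toL2 := by
  have hfst : IsCompactOperator (WithLp.fstL 2 ℝ ℝ L2Unit) :=
    isCompactOperator_of_locallyCompactSpace_dom (WithLp.fstL 2 ℝ ℝ L2Unit)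
  exact (hfst.clm_comp (ContinuousLinearMap.toSpanSingleton ℝ oneL2)).add
    (isCompactOperator_volterra.comp_clm dx)

end H1Unit

-- Constants give the mean-zero condition, primitives `volterra w` identify the flux `F`.
theorem eq_volterra_of_adjoint_add_eq_zero {F z : L2Unit}
    (h : H1Unit.toL2.adjoint z + H1Unit.dx.adjoint F = 0) :
    inner ℝ z oneL2 = 0 ∧ F = volterra z := by
  have hweak (φ : H1Unit) : inner ℝ z (H1Unit.toL2 φ) + inner ℝ F (H1Unit.dx φ) = 0 := by
    rw [← ContinuousLinearMap.adjoint_inner_left, ← ContinuousLinearMap.adjoint_inner_left,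
      ← inner_add_left, h, inner_zero_left]
  have hmean : inner ℝ z oneL2 = 0 := by
    simpa [H1Unit.toL2_apply, H1Unit.dx_apply] using hweak (WithLp.toLp 2 (1, 0))
  refine ⟨hmean, ext_inner_right ℝ fun w => ?_⟩
  have hw : inner ℝ z (volterra w) + inner ℝ F w = 0 := by
    simpa [H1Unit.toL2_apply, H1Unit.dx_apply] using hweak (WithLp.toLp 2 (0, w))
  have hparts := inner_volterra_add z w
  rw [hmean, zero_mul] at hparts
  linarith

end H1Unit

section Nemytskii

open scoped NNReal

theorem memLp_of_abs_le_add {f : ℝ → ℝ}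
    (hf : AEStronglyMeasurable f (volume.restrict (Ioo (0 : ℝ) 1))) {α β : ℝ} {u q : L2Unit}
    (h : ∀ᵐ x ∂volume.restrict (Ioo (0 : ℝ) 1), |f x| ≤ α * |u x| + β * |q x|) :
    MemLp f 2 (volume.restrict (Ioo (0 : ℝ) 1)) :=
  (((Lp.memLp u).abs.const_mul α).add ((Lp.memLp q).abs.const_mul β)).mono' hf h

theorem norm_le_of_abs_le_add {f u q : L2Unit} {α β : ℝ} (hα : 0 ≤ α) (hβ : 0 ≤ β)
    (h : ∀ᵐ x ∂volume.restrict (Ioo (0 : ℝ) 1), |f x| ≤ α * |u x| + β * |q x|) :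
    ‖f‖ ≤ α * ‖u‖ + β * ‖q‖ := by
  have hle : ‖f‖ ≤ ‖α • |u| + β • |q|‖ := by
    refine Lp.norm_le_norm_of_ae_le ?_
    filter_upwards [h, Lp.coeFn_add (α • |u|) (β • |q|), Lp.coeFn_smul α |u|,
      Lp.coeFn_smul β |q|, Lp.coeFn_abs u, Lp.coeFn_abs q] with x hx hadd hsu hsq hu hq
    rw [hadd, Pi.add_apply, hsu, hsq, Pi.smul_apply, Pi.smul_apply, hu, hq]
    exact hx.trans (le_abs_self _)
  refine hle.trans ((norm_add_le _ _).trans_eq ?_)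
  rw [norm_smul, norm_smul, norm_abs_eq_norm, norm_abs_eq_norm, Real.norm_of_nonneg hα,
    Real.norm_of_nonneg hβ]

open Classical in
/-- The superposition operator `(u, q) ↦ G(u, q)` on `L²(0,1)`, with the junk value `0` where
`G(u, q)` is not square integrable. -/
noncomputable def nemytskii (G : ℝ → ℝ → ℝ) (u q : L2Unit) : L2Unit :=
  if h : MemLp (fun x => G (u x) (q x)) 2 (volume.restrict (Ioo (0 : ℝ) 1)) then h.toLp _ else 0

variable {G : ℝ → ℝ → ℝ} {K : ℝ≥0} (hG : LipschitzWith K (Function.uncurry G))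
include hG

theorem abs_sub_le_of_lipschitzWith_uncurry (r s r' s' : ℝ) :
    |G r s - G r' s'| ≤ K * |r - r'| + K * |s - s'| := by
  calc |G r s - G r' s'| ≤ K * max |r - r'| |s - s'| := hG.dist_le_mul (r, s) (r', s')
    _ ≤ K * (|r - r'| + |s - s'|) := by
        gcongr
        exact max_le_add_of_nonneg (abs_nonneg _) (abs_nonneg _)
    _ = K * |r - r'| + K * |s - s'| := mul_add _ _ _

theorem nemytskii_ae (u q : L2Unit) :
    nemytskii G u q =ᵐ[volume.restrict (Ioo 0 1)] fun x => G (u x) (q x) := by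
  have hmeas : AEStronglyMeasurable (fun x => G (u x) (q x)) (volume.restrict (Ioo (0 : ℝ) 1)) :=
    hG.continuous.comp_aestronglyMeasurable
      ((Lp.aestronglyMeasurable u).prodMk (Lp.aestronglyMeasurable q))
  have hsub : MemLp (fun x => G (u x) (q x) - G 0 0) 2 (volume.restrict (Ioo (0 : ℝ) 1)) :=
    memLp_of_abs_le_add (hmeas.sub aestronglyMeasurable_const) (.of_forall fun x => by
      simpa using abs_sub_le_of_lipschitzWith_uncurry hG (u x) (q x) 0 0)
  have hmem : MemLp (fun x => G (u x) (q x)) 2 (volume.restrict (Ioo (0 : ℝ) 1)) :=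
    (hsub.add (memLp_const (G 0 0))).ae_eq (.of_forall fun x => sub_add_cancel _ _)
  rw [nemytskii, dif_pos hmem]
  exact hmem.coeFn_toLp

theorem norm_nemytskii_sub_le (u q u' q' : L2Unit) :
    ‖nemytskii G u q - nemytskii G u' q'‖ ≤ K * ‖u - u'‖ + K * ‖q - q'‖ := by
  refine norm_le_of_abs_le_add K.2 K.2 ?_
  filter_upwards [Lp.coeFn_sub (nemytskii G u q) (nemytskii G u' q'), nemytskii_ae hG u q,
    nemytskii_ae hG u' q', Lp.coeFn_sub u u', Lp.coeFn_sub q q'] with x hsub hn hn' hu hq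
  rw [hsub, Pi.sub_apply, hn, hn', hu, hq]
  exact abs_sub_le_of_lipschitzWith_uncurry hG _ _ _ _

theorem lipschitzWith_nemytskii_left (q : L2Unit) : LipschitzWith K fun u => nemytskii G u q :=
  .of_dist_le_mul fun u u' => by
    simpa [dist_eq_norm] using norm_nemytskii_sub_le hG u q u' q

theorem continuous_nemytskii : Continuous (Function.uncurry (nemytskii G)) := by
  refine (LipschitzWith.of_dist_le_mul (K := K + K) fun x y => ?_).continuous
  calc dist (nemytskii G x.1 x.2) (nemytskii G y.1 y.2)
      ≤ K * dist x.1 y.1 + K * dist x.2 y.2 := by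
        simpa only [dist_eq_norm] using norm_nemytskii_sub_le hG x.1 x.2 y.1 y.2
    _ ≤ K * dist x y + K * dist x y := by
        gcongr
        exacts [le_max_left _ _, le_max_right _ _]
    _ = (K + K : ℝ≥0) * dist x y := by push_cast; ring

theorem norm_nemytskii_le {M : ℝ} (hM : 0 ≤ M) (hGM : ∀ r s, |G r s| ≤ M) (u q : L2Unit) :
    ‖nemytskii G u q‖ ≤ M := by
  refine L2Unit.norm_le_of_ae_bound hM ?_
  filter_upwards [nemytskii_ae hG u q] with x hx
  rw [hx]
  exact hGM _ _

end Nemytskii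

section Nonlinearities

open scoped NNReal

variable {h b : ℝ → ℝ} {c : ℝ} {K L C M : ℝ≥0}

/-- The superposition operator `u ↦ h(u)` on `L²(0,1)`; the second argument of `nemytskii` is
a dummy. -/
noncomputable def compL2 (h : ℝ → ℝ) (u : L2Unit) : L2Unit := nemytskii (fun r _ => h r) u 0

theorem lipschitzWith_uncurry_fst (hh : LipschitzWith K h) :
    LipschitzWith K (Function.uncurry fun r (_ : ℝ) => h r) :=
  (hh.comp LipschitzWith.prod_fst).weaken (mul_one K).le

theorem compL2_ae (hh : LipschitzWith K h) (u : L2Unit) :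
    compL2 h u =ᵐ[volume.restrict (Ioo 0 1)] fun x => h (u x) :=
  nemytskii_ae (lipschitzWith_uncurry_fst hh) u 0

theorem lipschitzWith_compL2 (hh : LipschitzWith K h) : LipschitzWith K (compL2 h) :=
  lipschitzWith_nemytskii_left (lipschitzWith_uncurry_fst hh) 0

theorem isStronglyMonotone_compL2 (hh : LipschitzWith K h) (hmono : IsStronglyMonotone c h) :
    IsStronglyMonotone c (compL2 h) := by
  intro u v
  rw [← real_inner_self_eq_norm_sq, L2.inner_def, L2.inner_def, ← integral_const_mul]
  refine integral_mono_ae ((L2.integrable_inner _ _).const_mul c) (L2.integrable_inner _ _) ?_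
  filter_upwards [Lp.coeFn_sub (compL2 h u) (compL2 h v), compL2_ae hh u, compL2_ae hh v,
    Lp.coeFn_sub u v] with x hsub hu hv huv
  simpa only [hsub, huv, Pi.sub_apply, hu, hv, real_inner_self_eq_norm_sq]
    using hmono (u x) (v x)

/-- Truncation at level `M`. It makes the drift `b(v) p` globally Lipschitz in `(v, p)`, without
changing it as long as `|p| ≤ M`. -/
noncomputable def clip (M r : ℝ) : ℝ := max (-M) (min M r)

theorem clip_eq {M r : ℝ} (h : |r| ≤ M) : clip M r = r := by
  rw [clip, min_eq_right (abs_le.1 h).2, max_eq_right (abs_le.1 h).1]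

theorem abs_clip_le {M : ℝ} (hM : 0 ≤ M) (r : ℝ) : |clip M r| ≤ M :=
  abs_le.2 ⟨le_max_left _ _, max_le (by linarith) (min_le_left _ _)⟩

theorem lipschitzWith_clip (M : ℝ) : LipschitzWith 1 (clip M) :=
  (LipschitzWith.id.const_min M).const_max (-M)

theorem abs_mul_clip_le (hbC : ∀ r, |b r| ≤ C) (r s : ℝ) : |b r * clip M s| ≤ C * M := by
  rw [abs_mul]
  exact mul_le_mul (hbC r) (abs_clip_le M.2 s) (abs_nonneg _) C.2

theorem lipschitzWith_mul_clip (hbC : ∀ r, |b r| ≤ C) (hb : LipschitzWith L b) :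
    LipschitzWith (L * M + C) (Function.uncurry fun r s => b r * clip M s) := by
  refine .of_dist_le_mul fun ⟨r, s⟩ ⟨r', s'⟩ => ?_
  have hclip : |clip M s - clip M s'| ≤ |s - s'| := by
    simpa only [Real.dist_eq, NNReal.coe_one, one_mul]
      using (lipschitzWith_clip M).dist_le_mul s s'
  calc |b r * clip M s - b r' * clip M s'|
      = |(b r - b r') * clip M s + b r' * (clip M s - clip M s')| := by ring_nf
    _ ≤ |b r - b r'| * |clip M s| + |b r'| * |clip M s - clip M s'| := by
        rw [← abs_mul, ← abs_mul]
        exact abs_add_le _ _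
    _ ≤ (L * |r - r'|) * M + C * |s - s'| := by
        gcongr ?_ * ?_ + ?_ * ?_
        · exact hb.dist_le_mul r r'
        · exact abs_clip_le M.2 s
        · exact hbC r'
    _ ≤ (L * max |r - r'| |s - s'|) * M + C * max |r - r'| |s - s'| := by
        gcongr
        exacts [le_max_left _ _, le_max_right _ _]
    _ = (L * M + C : ℝ≥0) * max |r - r'| |s - s'| := by push_cast; ring

/-- The drift `(u, p) ↦ b(u) p` on `L²(0,1)`, with `p` truncated at level `M`. -/
noncomputable def truncatedDrift (b : ℝ → ℝ) (M : ℝ) : L2Unit → L2Unit → L2Unit :=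
  nemytskii fun r s => b r * clip M s

theorem truncatedDrift_ae (hbC : ∀ r, |b r| ≤ C) (hb : LipschitzWith L b) {u p : L2Unit}
    (hp : ∀ᵐ x ∂volume.restrict (Ioo (0 : ℝ) 1), |p x| ≤ M) :
    truncatedDrift b M u p =ᵐ[volume.restrict (Ioo 0 1)] fun x => b (u x) * p x := by
  filter_upwards [nemytskii_ae (lipschitzWith_mul_clip hbC hb) u p, hp] with x hx hle
  rw [truncatedDrift, hx, clip_eq hle]

theorem isBoundedLipschitzDrift_truncatedDrift (hbC : ∀ r, |b r| ≤ C) (hb : LipschitzWith L b)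
    {T : ℝ} {q : ℝ → L2Unit} {ρ : ℝ → ℝ} (hq : ∀ s ∈ Icc 0 T, ∀ t ∈ Icc 0 T, s ≤ t →
      ‖q t - q s‖ ^ 2 ≤ (t - s) * (ρ t - ρ s)) :
    IsBoundedLipschitzDrift T (L * M + C) (C * M) (fun t => (L * M + C : ℝ) ^ 2 * ρ t)
      fun t u => truncatedDrift b M u (q t) where
  lipschitzWith t _ := lipschitzWith_nemytskii_left (lipschitzWith_mul_clip hbC hb) (q t)
  norm_le t _ u := norm_nemytskii_le (lipschitzWith_mul_clip hbC hb) (by positivity)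
    (abs_mul_clip_le hbC) u (q t)
  sq_norm_sub_le s hs t ht hst u := by
    have hle : ‖truncatedDrift b M u (q t) - truncatedDrift b M u (q s)‖
        ≤ (L * M + C) * ‖q t - q s‖ := by
      simpa [truncatedDrift]
        using norm_nemytskii_sub_le (lipschitzWith_mul_clip (M := M) hbC hb) u (q t) u (q s)
    calc ‖truncatedDrift b M u (q t) - truncatedDrift b M u (q s)‖ ^ 2
        ≤ (L * M + C) ^ 2 * ‖q t - q s‖ ^ 2 := by
          rw [← mul_pow]
          gcongr
      _ ≤ (L * M + C) ^ 2 * ((t - s) * (ρ t - ρ s)) := by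
          gcongr
          exact hq s hs t ht hst
      _ = (t - s) * ((L * M + C) ^ 2 * ρ t - (L * M + C) ^ 2 * ρ s) := by ring

theorem abs_deriv_comp_le_of_lipschitzWith (hb : LipschitzWith L b) {f : ℝ → ℝ} {f' x : ℝ}
    (hf : HasDerivAt f f' x) (hbf : DifferentiableAt ℝ (fun y => b (f y)) x) :
    |deriv (fun y => b (f y)) x| ≤ L * |f'| := by
  refine le_of_tendsto_of_tendsto (hasDerivAt_iff_tendsto_slope.1 hbf.hasDerivAt).abs
    ((hasDerivAt_iff_tendsto_slope.1 hf).abs.const_mul _) (.of_forall fun y => ?_)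
  simp only [slope_def_field, abs_div]
  rw [← mul_div_assoc]
  gcongr
  exact hb.dist_le_mul _ _

theorem IsDx.exists_isDx_comp_mul (hbC : ∀ r, |b r| ≤ C) (hb : LipschitzWith L b)
    {v vx q qx g : L2Unit} (hv : IsDx v vx) (hq : IsDx q qx)
    (hqM : ∀ᵐ x ∂volume.restrict (Ioo (0 : ℝ) 1), |q x| ≤ M)
    (hg : g =ᵐ[volume.restrict (Ioo 0 1)] fun x => b (v x) * q x) :
    ∃ gx, IsDx g gx ∧ ‖gx‖ ≤ L * M * ‖vx‖ + C * ‖qx‖ := by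
  obtain ⟨V, hVac, hvV, hV⟩ := hv.exists_absolutelyContinuous
  obtain ⟨Q, hQac, hqQ, hQ⟩ := hq.exists_absolutelyContinuous
  have hbVac : AbsolutelyContinuousOnInterval (fun x => b (V x)) 0 1 :=
    absolutelyContinuousOnInterval_of_dist_le (K := L) hVac fun x _ y _ => hb.dist_le_mul _ _
  set W : ℝ → ℝ := fun x => b (V x) * Q x
  have hbV : ∀ᵐ x ∂volume.restrict (Ioo (0 : ℝ) 1), DifferentiableAt ℝ (fun y => b (V y)) x := by
    rw [ae_restrict_iff' measurableSet_Ioo]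
    filter_upwards [hbVac.ae_differentiableAt] with x hx hmem
    exact hx (Ioo_subset_Icc_self.trans Icc_subset_uIcc hmem)
  have hderiv : ∀ᵐ x ∂volume.restrict (Ioo (0 : ℝ) 1),
      |deriv W x| ≤ L * M * |vx x| + C * |qx x| := by
    filter_upwards [hqM, hqQ, hV, hQ, hbV] with x hM hqx hVx hQx hbVx
    rw [hqx] at hM
    have hWx : HasDerivAt W (deriv (fun y => b (V y)) x * Q x + b (V x) * qx x) x :=
      hbVx.hasDerivAt.mul hQx
    rw [hWx.deriv]
    calc |deriv (fun y => b (V y)) x * Q x + b (V x) * qx x|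
        ≤ |deriv (fun y => b (V y)) x| * |Q x| + |b (V x)| * |qx x| := by
          rw [← abs_mul, ← abs_mul]
          exact abs_add_le _ _
      _ ≤ L * |vx x| * M + C * |qx x| := by
          gcongr
          · exact abs_deriv_comp_le_of_lipschitzWith hb hVx hbVx
          · exact hbC _
      _ = L * M * |vx x| + C * |qx x| := by ring
  have hmem := memLp_of_abs_le_add (measurable_deriv W).aestronglyMeasurable hderiv
  refine ⟨hmem.toLp _, .of_absolutelyContinuous (hbVac.fun_mul hQac) ?_ hmem.coeFn_toLp,
    norm_le_of_abs_le_add (by positivity) C.2 ?_⟩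
  · filter_upwards [hg, hvV, hqQ] with x hgx hvx hqx
    rw [hgx, hvx, hqx]
  · filter_upwards [hmem.coeFn_toLp, hderiv] with x hx hle
    rwa [hx]

end Nonlinearities

section Existence

open scoped NNReal

theorem IsWeakDeriv.of_eq_add_integral {E : Type*} [NormedAddCommGroup E] [NormedSpace ℝ E]
    [CompleteSpace E] {a b : ℝ} {f g : ℝ → E} {c : E} (hab : a ≤ b) (hg : IntegrableOn g (Ioo a b))
    (h : ∀ t ∈ Icc a b, f t = c + ∫ s in a..t, g s) : IsWeakDeriv a b f g := by
  refine (isWeakDeriv_integral hab hg c).congr ?_ .rfl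
  filter_upwards [ae_restrict_mem measurableSet_Ioo] with t ht
    using (h t (Ioo_subset_Icc_self ht)).symm

theorem IsEvolutionSolution.memLp_comp {W H E : Type*} [NormedAddCommGroup W]
    [InnerProductSpace ℝ W] [CompleteSpace W] [NormedAddCommGroup H] [InnerProductSpace ℝ H]
    [CompleteSpace H] [NormedAddCommGroup E] [NormedSpace ℝ E] {J D : W →L[ℝ] H} {N : H → H}
    {B : ℝ → H → H} {T : ℝ} {x₀ : W} {X : ℝ → W} (hX : IsEvolutionSolution J D N B T x₀ X)
    (A : W →L[ℝ] E) (r : ℝ≥0∞) : MemLp (fun t => A (X t)) r (volume.restrict (Ioo 0 T)) := by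
  obtain ⟨R, hR⟩ := hX.exists_norm_le
  refine .of_bound (A.continuous.comp_aestronglyMeasurable hX.aestronglyMeasurable) (‖A‖ * R) ?_
  filter_upwards [ae_restrict_mem measurableSet_Ioo] with t ht
    using A.le_opNorm_of_le (hR t (Ioo_subset_Icc_self ht))

theorem MemW12L2.exists_representative {T : ℝ} (hT : 0 < T) {p : ℝ → L2Unit} (hp : MemW12L2 T p) :
    ∃ (q : ℝ → L2Unit) (ρ : ℝ → ℝ), (∀ᵐ t ∂volume.restrict (Ioo 0 T), p t = q t) ∧
      ∀ s ∈ Icc 0 T, ∀ t ∈ Icc 0 T, s ≤ t → ‖q t - q s‖ ^ 2 ≤ (t - s) * (ρ t - ρ s) := by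
  obtain ⟨-, w, hw, hpw⟩ := hp
  have hint : IntegrableOn w (Ioo 0 T) := hw.integrable one_le_two
  have hsq : IntegrableOn (fun s => ‖w s‖ ^ 2) (Ioo 0 T) := hw.integrable_norm_pow two_ne_zero
  obtain ⟨c, hc⟩ := hpw.exists_eq_integral hT hint
  refine ⟨_, fun t => ∫ s in (0 : ℝ)..t, ‖w s‖ ^ 2, hc, fun s hs t ht hst => ?_⟩
  have hsub {x y : ℝ} (hx : x ∈ Icc 0 T) (hy : y ∈ Icc 0 T) : uIcc x y ⊆ uIcc 0 T := by
    rw [uIcc_of_le hT.le]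
    exact uIcc_subset_Icc hx hy
  have hi {x y : ℝ} (hx : x ∈ Icc 0 T) (hy : y ∈ Icc 0 T) : IntervalIntegrable w volume x y :=
    (intervalIntegrable_of_integrableOn_Ioo hT.le hint).mono_set (hsub hx hy)
  have hisq {x y : ℝ} (hx : x ∈ Icc 0 T) (hy : y ∈ Icc 0 T) :
      IntervalIntegrable (fun s => ‖w s‖ ^ 2) volume x y :=
    (intervalIntegrable_of_integrableOn_Ioo hT.le hsq).mono_set (hsub hx hy)
  have h0 : (0 : ℝ) ∈ Icc 0 T := left_mem_Icc.2 hT.le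
  rw [add_sub_add_left_eq_sub, intervalIntegral.integral_interval_sub_left (hi h0 ht) (hi h0 hs),
    intervalIntegral.integral_interval_sub_left (hisq h0 ht) (hisq h0 hs)]
  exact sq_norm_integral_le hst (hi hs ht) (hisq hs ht)

theorem MemLinfQ.exists_nnreal_bound {T : ℝ} {p : ℝ → L2Unit} (hp : MemLinfQ T p) :
    ∃ M : ℝ≥0, ∀ᵐ t ∂volume.restrict (Ioo 0 T), ∀ᵐ x ∂volume.restrict (Ioo (0 : ℝ) 1),
      |p t x| ≤ M := by
  obtain ⟨-, M, hM⟩ := hp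
  exact ⟨M.toNNReal, hM.mono fun t ht => ht.mono fun x hx => hx.trans M.le_coe_toNNReal⟩

-- The embedding `H¹ → L²` is a continuous injection of Polish spaces, hence has a measurable
-- inverse on its range.
theorem exists_aestronglyMeasurable_dx {T : ℝ} {f : ℝ → L2Unit}
    (hf : AEStronglyMeasurable f (volume.restrict (Ioo 0 T)))
    (h : ∀ᵐ t ∂volume.restrict (Ioo 0 T), MemH1 (f t)) :
    ∃ g : ℝ → L2Unit, AEStronglyMeasurable g (volume.restrict (Ioo 0 T)) ∧
      ∀ᵐ t ∂volume.restrict (Ioo 0 T), IsDx (f t) (g t) := by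
  have hlift : ∀ t, ∃ y : H1Unit, MemH1 (f t) → H1Unit.toL2 y = f t := fun t => by
    by_cases ht : MemH1 (f t)
    · obtain ⟨w, hw⟩ := ht
      obtain ⟨y, hy, -⟩ := H1Unit.exists_of_isDx hw
      exact ⟨y, fun _ => hy⟩
    · exact ⟨0, fun h => absurd h ht⟩
  choose y hy using hlift
  have hfy : f =ᵐ[volume.restrict (Ioo 0 T)] fun t => H1Unit.toL2 (y t) :=
    h.mono fun t ht => (hy t ht).symm
  refine ⟨fun t => H1Unit.dx (y t), H1Unit.dx.continuous.comp_aestronglyMeasurable ?_, ?_⟩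
  · borelize H1Unit
    borelize L2Unit
    have hemb : MeasurableEmbedding H1Unit.toL2 :=
      H1Unit.toL2.continuous.measurableEmbedding H1Unit.toL2_injective
    exact (hemb.aemeasurable_comp_iff.1 (hf.congr hfy).aemeasurable).aestronglyMeasurable
  · filter_upwards [hfy] with t ht
    rw [ht]
    exact H1Unit.isDx (y t)

variable {T c : ℝ} {h b : ℝ → ℝ} {K L C M : ℝ≥0} {p : ℝ → L2Unit}

-- `∂ₓ v` is the difference of the flux `vx + B ∈ H¹` and of `B = b(v) p ∈ H¹`.
theorem memLqH2_of_isDx_flux (hbC : ∀ r, |b r| ≤ C) (hb : LipschitzWith L b)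
    (hpM : ∀ᵐ t ∂volume.restrict (Ioo 0 T), ∀ᵐ x ∂volume.restrict (Ioo (0 : ℝ) 1), |p t x| ≤ M)
    (hp : MemLqH1 T 2 p) {v vx B z : ℝ → L2Unit} (hv : MemLqL2 T 2 v) (hvx : MemLqL2 T 2 vx)
    (hz : MemLqL2 T 2 z) (hvdx : ∀ᵐ t ∂volume.restrict (Ioo 0 T), IsDx (v t) (vx t))
    (hB : ∀ᵐ t ∂volume.restrict (Ioo 0 T),
      B t =ᵐ[volume.restrict (Ioo (0 : ℝ) 1)] fun x => b (v t x) * p t x)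
    (hflux : ∀ᵐ t ∂volume.restrict (Ioo 0 T), IsDx (vx t + B t) (z t)) : MemLqH2 T 2 v := by
  obtain ⟨-, px, hpx, hpdx⟩ := hp
  have hbound : ∀ᵐ t ∂volume.restrict (Ioo 0 T), ∃ y, IsDx (vx t) y ∧
      ‖y‖ ≤ ‖z t‖ + (L * M * ‖vx t‖ + C * ‖px t‖) := by
    filter_upwards [hpM, hpdx, hvdx, hB, hflux] with t hMt hpt hvt hBt hFt
    obtain ⟨gx, hgx, hle⟩ := IsDx.exists_isDx_comp_mul hbC hb hvt hpt hMt hBt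
    have hvxx := hFt.sub hgx
    rw [add_sub_cancel_right] at hvxx
    exact ⟨_, hvxx, (norm_sub_le _ _).trans (by gcongr)⟩
  obtain ⟨y, hy, hydx⟩ := exists_aestronglyMeasurable_dx hvx.aestronglyMeasurable
    (hbound.mono fun t ⟨w, hw, _⟩ => ⟨w, hw⟩)
  refine ⟨hv, vx, y, hvx, ?_, hvdx.and hydx⟩
  refine (hz.norm.add ((hvx.norm.const_mul (L * M)).add (hpx.norm.const_mul C))).mono' hy ?_
  filter_upwards [hbound, hydx] with t ⟨w, hw, hle⟩ hyt
  rwa [hyt.unique hw]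

theorem IsEvolutionSolution.isStrongSolution (hT : 0 < T) (hh : LipschitzWith K h)
    (hbC : ∀ r, |b r| ≤ C) (hb : LipschitzWith L b)
    (hpM : ∀ᵐ t ∂volume.restrict (Ioo 0 T), ∀ᵐ x ∂volume.restrict (Ioo (0 : ℝ) 1), |p t x| ≤ M)
    (hp : MemLqH1 T 2 p) {q : ℝ → L2Unit} (hpq : ∀ᵐ t ∂volume.restrict (Ioo 0 T), p t = q t)
    {x₀ : H1Unit} {X : ℝ → H1Unit} (hX : IsEvolutionSolution H1Unit.toL2 H1Unit.dx (compL2 h)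
      (fun t u => truncatedDrift b M u (q t)) T x₀ X) :
    IsStrongSolution T h b p (H1Unit.toL2 x₀) fun t => H1Unit.toL2 (X t) := by
  set v : ℝ → L2Unit := fun t => H1Unit.toL2 (X t)
  set vx : ℝ → L2Unit := fun t => H1Unit.dx (X t)
  set B : ℝ → L2Unit := fun t => truncatedDrift b M (v t) (q t)
  obtain ⟨w, hw, hvw⟩ := hX.exists_state_eq
  obtain ⟨z, hz, hNz, hadj⟩ := hX.exists_momentum_eq
  have hvdx : ∀ᵐ t ∂volume.restrict (Ioo 0 T), IsDx (v t) (vx t) :=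
    .of_forall fun t => H1Unit.isDx (X t)
  have hflux : ∀ᵐ t ∂volume.restrict (Ioo 0 T), inner ℝ (z t) oneL2 = 0 ∧
      vx t + B t = volterra (z t) := hadj.mono fun t => eq_volterra_of_adjoint_add_eq_zero
  have hFdx : ∀ᵐ t ∂volume.restrict (Ioo 0 T), IsDx (vx t + B t) (z t) :=
    hflux.mono fun t ht => isDx_iff.2 ⟨0, by rw [ht.2, zero_smul, zero_add]⟩
  have hB : ∀ᵐ t ∂volume.restrict (Ioo 0 T),
      B t =ᵐ[volume.restrict (Ioo (0 : ℝ) 1)] fun x => b (v t x) * p t x := by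
    filter_upwards [hpM, hpq] with t hMt hqt
    simpa only [B, ← hqt] using truncatedDrift_ae hbC hb hMt
  have hwint := hw.integrable one_le_two
  have hvcont : ContinuousOn v (Icc 0 T) := by
    refine ContinuousOn.congr (continuousOn_const.add ?_) hvw
    simpa only [uIcc_of_le hT.le] using (absolutelyContinuousOnInterval_integral
      (intervalIntegrable_of_integrableOn_Ioo hT.le hwint)).continuousOn
  have hv := hX.memLp_comp H1Unit.toL2
  have hvx := hX.memLp_comp H1Unit.dx
  refine ⟨⟨hv 2, w, hw, .of_eq_add_integral hT.le hwint hvw⟩, ⟨hv ∞, vx, hvx ∞, hvdx⟩,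
    memLqH2_of_isDx_flux hbC hb hpM hp (hv 2) (hvx 2) hz hvdx hB hFdx,
    ⟨vx, fun t => vx t + B t, z, fun t => compL2 h (v t), z, hvdx, ?_, hFdx,
      .of_forall fun t => compL2_ae hh (v t),
      .of_eq_add_integral hT.le (hz.integrable one_le_two) hNz,
      .of_forall fun t => .of_forall fun x => rfl, ?_⟩,
    ⟨v, hvcont, .of_forall fun t => rfl, ?_⟩⟩
  · filter_upwards [hB] with t ht
    filter_upwards [ht, Lp.coeFn_add (vx t) (B t)] with x hBx hadd
    rw [hadd, Pi.add_apply, hBx]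
  · filter_upwards [hflux] with t ht
    rw [ht.2]
    exact hasBoundaryValues_volterra ht.1
  · simpa using hvw 0 (left_mem_Icc.2 hT.le)

theorem exists_isStrongSolution (hT : 0 < T) (hh : LipschitzWith K h) (hc : 0 < c)
    (hmono : IsStronglyMonotone c h) (hbC : ∀ r, |b r| ≤ C) (hb : LipschitzWith L b)
    (hp_time : MemW12L2 T p) (hp_bdd : MemLinfQ T p) (hp_space : MemLqH1 T 2 p) {v₀ : L2Unit}
    (hv₀ : MemH1 v₀) : ∃ v, IsStrongSolution T h b p v₀ v := by
  obtain ⟨M, hM⟩ := hp_bdd.exists_nnreal_bound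
  obtain ⟨q, ρ, hpq, hqρ⟩ := hp_time.exists_representative hT
  obtain ⟨_, hv₀x⟩ := hv₀
  obtain ⟨x₀, rfl, -⟩ := H1Unit.exists_of_isDx hv₀x
  obtain ⟨X, hX⟩ := exists_isEvolutionSolution H1Unit.isCompactOperator_toL2
    H1Unit.toL2_injective (K := 3) H1Unit.sq_norm_le (lipschitzWith_compL2 hh) hc
    (isStronglyMonotone_compL2 hh hmono) hT
    (isBoundedLipschitzDrift_truncatedDrift (M := M) hbC hb hqρ) x₀
  exact ⟨_, hX.isStrongSolution hT hh hbC hb hM hp_space hpq⟩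

end Existence

section Uniqueness

open scoped NNReal

theorem IsStronglyMonotone.injective {H : Type*} [NormedAddCommGroup H] [InnerProductSpace ℝ H]
    {c : ℝ} {A : H → H} (hA : IsStronglyMonotone c A) (hc : 0 < c) : Function.Injective A := by
  intro x y hxy
  have hle := hA x y
  rw [hxy, sub_self, inner_zero_left] at hle
  have hsq : ‖x - y‖ ^ 2 ≤ 0 := nonpos_of_mul_nonpos_right hle hc
  exact sub_eq_zero.1 (norm_eq_zero.1 (pow_eq_zero_iff two_ne_zero |>.1
    (hsq.antisymm (sq_nonneg _))))

theorem volterra_injective : Function.Injective volterra := fun w w' h =>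
  IsDx.unique (isDx_iff.2 ⟨0, by rw [zero_smul, zero_add]⟩)
    (isDx_iff.2 ⟨0, by rw [zero_smul, zero_add, h]⟩)

theorem eq_zero_of_le_mul_integral {T K : ℝ} {y : ℝ → ℝ} (hy : ContinuousOn y (Icc 0 T))
    (hy₀ : ∀ t ∈ Icc 0 T, 0 ≤ y t) (h : ∀ t ∈ Icc 0 T, y t ≤ K * ∫ s in (0 : ℝ)..t, y s) {t : ℝ}
    (ht : t ∈ Icc 0 T) : y t = 0 := by
  have hT : 0 ≤ T := ht.1.trans ht.2
  have hint {s : ℝ} (hs : s ∈ Icc 0 T) : IntervalIntegrable y volume 0 s :=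
    (hy.mono (uIcc_of_le hs.1 ▸ Icc_subset_Icc_right hs.2)).intervalIntegrable
  have hnonneg {s : ℝ} (hs : s ∈ Icc 0 T) : 0 ≤ ∫ r in (0 : ℝ)..s, y r :=
    intervalIntegral.integral_nonneg hs.1 fun r hr => hy₀ r ⟨hr.1, hr.2.trans hs.2⟩
  have hcont : ContinuousOn (fun s => ∫ r in (0 : ℝ)..s, y r) (Icc 0 T) := by
    simpa only [uIcc_of_le hT] using
      (absolutelyContinuousOnInterval_integral (hint (right_mem_Icc.2 hT))).continuousOn
  have hderiv : ∀ s ∈ Ico 0 T, HasDerivWithinAt (fun s => ∫ r in (0 : ℝ)..s, y r) (y s)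
      (Ici s) s := fun s hs =>
    intervalIntegral.integral_hasDerivWithinAt_right (hint (Ico_subset_Icc_self hs))
      (t := Ioi s) ⟨Icc 0 T, Icc_mem_nhdsGT_of_mem hs,
        hy.aestronglyMeasurable measurableSet_Icc⟩
      ((hy s (Ico_subset_Icc_self hs)).mono_of_mem_nhdsWithin (Icc_mem_nhdsGT_of_mem hs))
  have hgronwall := norm_le_gronwallBound_of_norm_deriv_right_le (δ := 0) (K := K) (ε := 0) hcont
    hderiv (by simp) (fun s hs => by
      have hs := Ico_subset_Icc_self hs
      rw [Real.norm_of_nonneg (hy₀ s hs), Real.norm_of_nonneg (hnonneg hs), add_zero]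
      exact h s hs) t ht
  rw [gronwallBound_ε0_δ0, norm_le_zero_iff] at hgronwall
  exact ((h t ht).trans_eq (by rw [hgronwall, mul_zero])).antisymm (hy₀ t ht)

theorem IsWeakDeriv.eq_zero_of_two_mul_inner_le {H : Type*} [NormedAddCommGroup H]
    [InnerProductSpace ℝ H] [CompleteSpace H] {T K : ℝ} {y f : ℝ → H} (hyf : IsWeakDeriv 0 T y f)
    (hT : 0 < T) (hf : IntegrableOn f (Ioo 0 T)) (hy : ContinuousOn y (Icc 0 T)) (hy₀ : y 0 = 0)
    (h : ∀ᵐ t ∂volume.restrict (Ioo 0 T), 2 * inner ℝ (y t) (f t) ≤ K * ‖y t‖ ^ 2) {t : ℝ}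
    (ht : t ∈ Icc 0 T) : y t = 0 := by
  have hprimitive {t : ℝ} (ht : t ∈ Icc 0 T) : y t = ∫ s in (0 : ℝ)..t, f s := by
    rw [hyf.eq_add_integral_of_continuousOn hT hf hy ht, hy₀, zero_add]
  refine norm_eq_zero.1 (pow_eq_zero_iff two_ne_zero |>.1 (eq_zero_of_le_mul_integral (K := K)
    (y := fun t => ‖y t‖ ^ 2) (hy.norm.pow 2) (fun _ _ => sq_nonneg _) (fun t ht => ?_) ht))
  have hsub : uIcc 0 t ⊆ Icc 0 T := uIcc_of_le ht.1 ▸ Icc_subset_Icc_right ht.2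
  have hft : IntervalIntegrable f volume 0 t :=
    (intervalIntegrable_of_integrableOn_Ioo hT.le hf).mono_set (by rwa [uIcc_of_le hT.le])
  have hsq : ‖y t‖ ^ 2 = ∫ s in (0 : ℝ)..t, 2 * inner ℝ (y s) (f s) := by
    rw [hprimitive ht, sq_norm_integral_eq hft]
    exact intervalIntegral.integral_congr fun s hs => by rw [hprimitive (hsub hs)]
  rw [hsq, ← intervalIntegral.integral_const_mul]
  refine intervalIntegral.integral_mono_ae_restrict ht.1
    ((intervalIntegrable_inner_of_continuousOn (hy.mono hsub) hft).const_mul 2)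
    ((hy.mono hsub).norm.pow 2 |>.intervalIntegrable.const_mul K) ?_
  rw [← Measure.restrict_congr_set Ioo_ae_eq_Icc]
  exact ae_restrict_of_ae_restrict_of_subset (Ioo_subset_Ioo_right ht.2) h

-- `⟪V d, uₓ⟫ = -⟪d, u⟫ ≤ -c ‖u‖²` absorbs the contribution of `g` by Young's inequality.
theorem two_mul_inner_volterra_le {c K : ℝ} (hc : 0 < c) {d u ux g : L2Unit} (hu : IsDx u ux)
    (hd : inner ℝ d oneL2 = 0) (hmono : c * ‖u‖ ^ 2 ≤ inner ℝ d u) (hg : ‖g‖ ≤ K * ‖u‖) :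
    2 * inner ℝ (volterra d) (ux + g) ≤ K ^ 2 / (2 * c) * ‖volterra d‖ ^ 2 := by
  have hparts : inner ℝ (volterra d) ux = -inner ℝ d u := by
    obtain ⟨a, rfl⟩ := isDx_iff.1 hu
    have hanti := inner_volterra_add d ux
    rw [hd, zero_mul] at hanti
    rw [inner_add_right, inner_smul_right, hd, mul_zero, zero_add]
    exact eq_neg_of_add_eq_zero_left hanti
  have hsource : inner ℝ (volterra d) g ≤ ‖volterra d‖ * (K * ‖u‖) :=
    (real_inner_le_norm _ _).trans (mul_le_mul_of_nonneg_left hg (norm_nonneg _))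
  have hyoung : 2 * (‖volterra d‖ * (K * ‖u‖))
      ≤ K ^ 2 / (2 * c) * ‖volterra d‖ ^ 2 + 2 * (c * ‖u‖ ^ 2) := by
    have hsq : 0 ≤ (K * ‖volterra d‖ - 2 * c * ‖u‖) ^ 2 / (2 * c) := by positivity
    have hexpand : (K * ‖volterra d‖ - 2 * c * ‖u‖) ^ 2 / (2 * c)
        = K ^ 2 / (2 * c) * ‖volterra d‖ ^ 2 + 2 * (c * ‖u‖ ^ 2)
          - 2 * (‖volterra d‖ * (K * ‖u‖)) := by
      field_simp
      ring
    linarith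
  rw [inner_add_right, hparts]
  linarith

variable {T c : ℝ} {h b : ℝ → ℝ} {K L C M : ℝ≥0} {p : ℝ → L2Unit} {v₀ : L2Unit}
  {v w : ℝ → L2Unit}

theorem IsStrongSolution.exists_flux (hv : IsStrongSolution T h b p v₀ v) (hh : LipschitzWith K h)
    (hbC : ∀ r, |b r| ≤ C) (hb : LipschitzWith L b)
    (hp : AEStronglyMeasurable p (volume.restrict (Ioo 0 T)))
    (hpM : ∀ᵐ t ∂volume.restrict (Ioo 0 T), ∀ᵐ x ∂volume.restrict (Ioo (0 : ℝ) 1), |p t x| ≤ M) :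
    ∃ vx F : ℝ → L2Unit, (∀ᵐ t ∂volume.restrict (Ioo 0 T), IsDx (v t) (vx t)) ∧
      (∀ᵐ t ∂volume.restrict (Ioo 0 T), F t = vx t + truncatedDrift b M (v t) (p t)) ∧
      IntegrableOn F (Ioo 0 T) ∧ IsWeakDeriv 0 T (fun t => volterra (compL2 h (v t))) F ∧
      IsWeakDeriv 0 T (fun t => inner ℝ (compL2 h (v t)) oneL2) 0 := by
  obtain ⟨hv_mem, vx', hvx', hvdx'⟩ := hv.memLinfH1
  obtain ⟨vx, F, Fx, hv', hvt, hvdx, hF, hFdx, hhv, hweak, heq, hbdry⟩ := hv.equation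
  have hFdrift : ∀ᵐ t ∂volume.restrict (Ioo 0 T),
      F t = vx t + truncatedDrift b M (v t) (p t) := by
    filter_upwards [hF, hpM] with t hFt hMt
    refine Lp.ext ?_
    filter_upwards [hFt, Lp.coeFn_add (vx t) (truncatedDrift b M (v t) (p t)),
      truncatedDrift_ae hbC hb hMt] with x hx hadd hdrift
    rw [hx, hadd, Pi.add_apply, hdrift]
  have hflux : ∀ᵐ t ∂volume.restrict (Ioo 0 T),
      inner ℝ (hvt t) oneL2 = 0 ∧ F t = volterra (hvt t) := by
    filter_upwards [hFdx, heq, hbdry] with t hFt heqt hbt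
    rw [Lp.ext heqt]
    exact hFt.eq_volterra_of_hasBoundaryValues hbt
  have hhv_eq : ∀ᵐ t ∂volume.restrict (Ioo 0 T), hv' t = compL2 h (v t) :=
    hhv.mono fun t ht => Lp.ext (EventuallyEq.trans ht (compL2_ae hh (v t)).symm)
  refine ⟨vx, F, hvdx, hFdrift, ?_, ?_, ?_⟩
  · have hG := lipschitzWith_mul_clip (M := M) hbC hb
    have hdrift : IntegrableOn (fun t => truncatedDrift b M (v t) (p t)) (Ioo 0 T) :=
      (memLp_top_of_bound ((continuous_nemytskii hG).comp_aestronglyMeasurable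
        (hv_mem.aestronglyMeasurable.prodMk hp)) (C * M) (.of_forall fun t =>
          norm_nemytskii_le hG (by positivity) (abs_mul_clip_le hbC) _ _)).integrable le_top
    refine ((hvx'.integrable le_top).add hdrift).congr ?_
    filter_upwards [hFdrift, hvdx, hvdx'] with t hFt ht ht'
    rw [Pi.add_apply, hFt, ht'.unique ht]
  · exact (hweak.map volterra).congr (hhv_eq.mono fun t ht => congrArg volterra ht)
      (hflux.mono fun t ht => ht.2.symm)
  · refine (hweak.map (innerSL ℝ oneL2)).congr ?_ ?_
    · filter_upwards [hhv_eq] with t ht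
      rw [ht, innerSL_apply_apply, real_inner_comm]
    · filter_upwards [hflux] with t ht
      rw [innerSL_apply_apply, real_inner_comm, ht.1, Pi.zero_apply]

theorem two_mul_inner_volterra_compL2_sub_le (hh : LipschitzWith K h) (hc : 0 < c)
    (hmono : IsStronglyMonotone c h) (hbC : ∀ r, |b r| ≤ C) (hb : LipschitzWith L b)
    {u ux z zx q : L2Unit} (hu : IsDx u ux) (hz : IsDx z zx)
    (hmean : inner ℝ (compL2 h u - compL2 h z) oneL2 = 0) :
    2 * inner ℝ (volterra (compL2 h u - compL2 h z))
        (ux + truncatedDrift b M u q - (zx + truncatedDrift b M z q))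
      ≤ (L * M + C : ℝ≥0) ^ 2 / (2 * c) * ‖volterra (compL2 h u - compL2 h z)‖ ^ 2 := by
  rw [add_sub_add_comm]
  exact two_mul_inner_volterra_le hc (hu.sub hz) hmean (isStronglyMonotone_compL2 hh hmono u z)
    ((lipschitzWith_nemytskii_left (lipschitzWith_mul_clip hbC hb) q).norm_sub_le u z)

theorem IsStrongSolution.unique (hT : 0 < T) (hh : LipschitzWith K h) (hc : 0 < c)
    (hmono : IsStronglyMonotone c h) (hbC : ∀ r, |b r| ≤ C) (hb : LipschitzWith L b)
    (hp : MemLinfQ T p) (hv : IsStrongSolution T h b p v₀ v)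
    (hw : IsStrongSolution T h b p v₀ w) : ∀ᵐ t ∂volume.restrict (Ioo 0 T), v t = w t := by
  obtain ⟨M, hM⟩ := hp.exists_nnreal_bound
  obtain ⟨vx, F, hvx, hF, hFint, hFweak, hFmean⟩ := hv.exists_flux hh hbC hb hp.1 hM
  obtain ⟨wx, E, hwx, hE, hEint, hEweak, hEmean⟩ := hw.exists_flux hh hbC hb hp.1 hM
  obtain ⟨vc, hvc, hvvc, hvc₀⟩ := hv.initial
  obtain ⟨wc, hwc, hwwc, hwc₀⟩ := hw.initial
  have hcompL2 := (lipschitzWith_compL2 hh).continuous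
  set D : ℝ → L2Unit := fun t => compL2 h (vc t) - compL2 h (wc t)
  have hD : ContinuousOn D (Icc 0 T) :=
    (hcompL2.comp_continuousOn hvc).sub (hcompL2.comp_continuousOn hwc)
  have hD₀ : D 0 = 0 := by simp only [D, hvc₀, hwc₀, sub_self]
  have hDae : ∀ᵐ t ∂volume.restrict (Ioo 0 T), compL2 h (v t) - compL2 h (w t) = D t := by
    filter_upwards [hvvc, hwwc] with t hvt hwt
    rw [hvt, hwt]
  have hmean_weak : IsWeakDeriv 0 T (fun t => inner ℝ (D t) oneL2) 0 := by
    refine (hFmean.sub hEmean).congr ?_ (.of_forall fun _ => sub_self _)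
    filter_upwards [hDae] with t ht
    rw [← ht, inner_sub_left]
  have hmean {t : ℝ} (ht : t ∈ Icc 0 T) : inner ℝ (D t) oneL2 = 0 := by
    simpa [hD₀] using hmean_weak.eq_add_integral_of_continuousOn hT integrableOn_zero
      (hD.inner continuousOn_const) ht
  have hweak : IsWeakDeriv 0 T (fun t => volterra (D t)) fun t => F t - E t := by
    refine (hFweak.sub hEweak).congr ?_ .rfl
    filter_upwards [hDae] with t ht
    rw [← ht, map_sub]
  have hzero {t : ℝ} (ht : t ∈ Icc 0 T) : volterra (D t) = 0 := by
    refine hweak.eq_zero_of_two_mul_inner_le (K := (L * M + C : ℝ≥0) ^ 2 / (2 * c)) hT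
      (hFint.sub hEint) (volterra.continuous.comp_continuousOn hD) (by rw [hD₀, map_zero]) ?_ ht
    filter_upwards [hvx, hwx, hF, hE, hDae, ae_restrict_mem measurableSet_Ioo]
      with t hvt hwt hFt hEt hDt ht
    rw [hFt, hEt, ← hDt]
    exact two_mul_inner_volterra_compL2_sub_le hh hc hmono hbC hb hvt hwt
      (hDt ▸ hmean (Ioo_subset_Icc_self ht))
  filter_upwards [hDae, ae_restrict_mem measurableSet_Ioo] with t hDt ht
  have hDt₀ : D t = 0 := volterra_injective ((hzero (Ioo_subset_Icc_self ht)).trans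
    (map_zero volterra).symm)
  exact (isStronglyMonotone_compL2 hh hmono).injective hc (sub_eq_zero.1 (hDt.trans hDt₀))

end Uniqueness

section Assumptions

open scoped NNReal

variable {h b : ℝ → ℝ}

theorem lipschitzWith_of_abs_deriv_le {f : ℝ → ℝ} (hf : Differentiable ℝ f) {C : ℝ}
    (hC : ∀ r, |deriv f r| ≤ C) : LipschitzWith C.toNNReal f :=
  lipschitzWith_of_nnnorm_deriv_le hf fun r => NNReal.le_toNNReal_of_coe_le (hC r)

theorem isStronglyMonotone_of_le_deriv (hh : Differentiable ℝ h) {c : ℝ}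
    (hc : ∀ r, c ≤ deriv h r) : IsStronglyMonotone c h := by
  have hle {x y : ℝ} (hxy : y ≤ x) : c * ‖x - y‖ ^ 2 ≤ inner ℝ (h x - h y) (x - y) := by
    have hslope := mul_sub_le_image_sub_of_le_deriv hh hc hxy
    rw [Real.norm_eq_abs, sq_abs, Real.inner_apply]
    nlinarith [sub_nonneg.2 hxy]
  intro x y
  rcases le_total y x with hxy | hxy
  · exact hle hxy
  · rw [norm_sub_rev, ← inner_neg_neg, neg_sub, neg_sub]
    exact hle hxy

theorem AssumptionA1.exists_lipschitzWith_isStronglyMonotone (hh : AssumptionA1 h) :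
    ∃ (K : ℝ≥0) (c : ℝ), 0 < c ∧ LipschitzWith K h ∧ IsStronglyMonotone c h := by
  obtain ⟨hsmooth, c, C, hc, -, hbound⟩ := hh
  have hdiff : Differentiable ℝ h := hsmooth.differentiable two_ne_zero
  exact ⟨_, c, hc, lipschitzWith_of_abs_deriv_le hdiff fun r =>
    abs_le.2 ⟨by linarith [hbound r], (hbound r).2.1⟩,
    isStronglyMonotone_of_le_deriv hdiff fun r => (hbound r).1⟩

theorem AssumptionA2.exists_abs_le_lipschitzWith (hb : AssumptionA2 b) :
    ∃ C L : ℝ≥0, (∀ r, |b r| ≤ C) ∧ LipschitzWith L b := by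
  obtain ⟨hsmooth, c, C, hc, -, hbound⟩ := hb
  exact ⟨C.toNNReal, _, fun r => (abs_le.2 ⟨by linarith [hbound r], (hbound r).2.1⟩).trans
    C.le_coe_toNNReal, lipschitzWith_of_abs_deriv_le (hsmooth.differentiable two_ne_zero)
      fun r => (hbound r).2.2.1⟩

end Assumptions

theorem theorem1_general {T c : ℝ} {K C L : NNReal} {h b : ℝ → ℝ} {p : ℝ → L2Unit} {v₀ : L2Unit}
    (hT : 0 < T) (hh : LipschitzWith K h) (hc : 0 < c) (hmono : IsStronglyMonotone c h)
    (hbC : ∀ r, |b r| ≤ C) (hb : LipschitzWith L b) (hp_time : MemW12L2 T p)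
    (hp_bdd : MemLinfQ T p) (hp_space : MemLqH1 T 2 p) (hv₀ : MemH1 v₀) :
    (∃ v : ℝ → L2Unit, IsStrongSolution T h b p v₀ v) ∧
      ∀ v w : ℝ → L2Unit, IsStrongSolution T h b p v₀ v → IsStrongSolution T h b p v₀ w →
        ∀ᵐ t ∂(volume.restrict (Ioo 0 T)), v t = w t :=
  ⟨exists_isStrongSolution hT hh hc hmono hbC hb hp_time hp_bdd hp_space hv₀,
    fun _ _ hv hw => hv.unique hT hh hc hmono hbC hb hp_bdd hw⟩

theorem theorem1 (T : ℝ) (hT : 0 < T) (h b : ℝ → ℝ)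
    (hh : AssumptionA1 h) (hb : AssumptionA2 b)
    (p : ℝ → L2Unit) (hp_time : MemW12L2 T p) (hp_bdd : MemLinfQ T p) (hp_space : MemLqH1 T 2 p)
    (v₀ : L2Unit) (hv₀ : MemH1 v₀) :
    (∃ v : ℝ → L2Unit, IsStrongSolution T h b p v₀ v) ∧
      ∀ v w : ℝ → L2Unit, IsStrongSolution T h b p v₀ v → IsStrongSolution T h b p v₀ w →
        ∀ᵐ t ∂(volume.restrict (Ioo 0 T)), v t = w t := by
  obtain ⟨_, _, hc, hlip, hmono⟩ := hh.exists_lipschitzWith_isStronglyMonotone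
  obtain ⟨_, _, hbC, hbL⟩ := hb.exists_abs_le_lipschitzWith
  exact theorem1_general hT hlip hc hmono hbC hbL hp_time hp_bdd hp_space hv₀
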